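/- A function $h\colon\mathbb F_2^n\times[D]\to\mathbb F_2^r$ (with $D\ge1$) is a *$(\kappa,\epsilon)$-lossless condenser* if for every nonempty $S\subseteq\mathbb F_2^n$ with $|S|\le 2^\kappa$, and $X$ uniform on $S$, $Z$ uniform on $[D]$, independent, the law of $(Z,h(X,Z))$ is within statistical distance $\epsilon$ of some distribution on $[D]\times\mathbb F_2^r$ of min-entropy at least $\log(D|S|)$. Logarithms are to base $2$. Let $N=2^n$. The adjacency matrix $M\in\{0,1\}^{D2^r\times N}$ of the bipartite graph of $h$ has entry $1$ at row $(b,t)\in\mathbb F_2^r\times[D]$ and column $a\in\mathbb F_2^n$ iff $h(a,t)=b$; the bit-selection matrix $B\in\{0,1\}^{n\times N}$ has as its $(j,i)$ entry the $j$-th bit of $i\in\mathbb F_2^n$; and $M\otimes B$ is the matrix whose row indexed by $(p,j)$ is the coordinate-wise product of row $p$ of $M$ and row $j$ of $B$. For $x\in\mathbb R^N$, $H_k(x)$ agrees with $x$ on $k$ coordinates of largest absolute value and is zero elsewhere; a vector is $k$-sparse if it has at most $k$ nonzero coordinates. Write $\log_+ y:=\max(1,\log y)$ for $y>0$. **Theorem.**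 There are absolute constants $c>0$ and $\epsilon'>0$ and a randomized algorithm, working on a real RAM with unit-cost arithmetic operations and using a subroutine for $h$ whose steps are counted, such that the following holds. Let $n\ge1$, $1\le k\le 2^n$, $r\le n$, $D\ge1$, and let $h\colon\mathbb F_2^n\times[D]\to\mathbb F_2^r$ be a $(\log(4k),\epsilon')$-lossless condenser whose values the subroutine computes in time $f(n)$, where $f(n)=\Omega(n)$ (that is, $f(m)\ge a m$ for all $m\ge1$, for a constant $a>0$). Given $k,n,r,D$, real parameters $\eta,\nu>0$, and query access to the vectors $Mx$ and $(M\otimes B)x$ for an arbitrary $x\in\mathbb R^N$ that is not given to the algorithm, the algorithm, which may draw independent uniformly random seeds $t\in[D]$, always outputs a $k$-sparse $\tilde x\in\mathbb R^N$ (as a list of positions and values), and with probability at least $1-\eta$ over its random seeds $$\|\tilde x-x\|_1\le c\,\|x-H_k(x)\|_1+\nu\,\|x\|_1 .$$ In the worst case it draws $O\bigl(\log_+(\log_+(1/\nu)/\eta)\cdot\log_+(1/\nu)\bigr)$ seeds and performs $$O\bigl(2^r\cdot\log_+(\log_+(1/\nu)/\eta)\cdot\log_+(1/\nu)\cdot f(n)\bigr)$$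 arithmetic operations, where the constants in $O(\cdot)$ depend only on $a$. (For $\eta,\nu\le 1/2$ one has $\log_+=\log$ in these bounds.) -/

import Mathlib

open MeasureTheory

noncomputable section

namespace SparseRecovery

/-! ## Vectors, best sparse approximation, condensers, sketches -/

/-- The space `𝔽₂^m`; real vectors of length `N = 2^n` are functions `F2 n → ℝ`. -/
abbrev F2 (m : ℕ) : Type := Fin m → ZMod 2

/-- The `ℓ₁` norm. -/
def l1 {ι : Type*} [Fintype ι] (x : ι → ℝ) : ℝ := ∑ i, |x i|

/-- `x` has at most `k` nonzero coordinates. -/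
def IsSparse {ι : Type*} (k : ℕ) (x : ι → ℝ) : Prop :=
  (Function.support x).ncard ≤ k

theorem exists_top {ι : Type*} [Fintype ι] (x : ι → ℝ) (k : ℕ) (hk : k ≤ Fintype.card ι) :
    ∃ S : Finset ι, S.card = k ∧ ∀ i ∈ S, ∀ j, j ∉ S → |x j| ≤ |x i| := by
  classical
  induction k with
  | zero => exact ⟨∅, by simp⟩
  | succ m ih =>
    obtain ⟨S, hS, hmax⟩ := ih (by omega)
    have hne : (Finset.univ \ S).Nonempty := by
      rw [← Finset.card_pos, Finset.card_sdiff_of_subset (Finset.subset_univ S),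
        Finset.card_univ, hS]
      omega
    obtain ⟨a, ha, hamax⟩ := Finset.exists_max_image (Finset.univ \ S) (fun i => |x i|) hne
    have haS : a ∉ S := by simpa using ha
    refine ⟨insert a S, by simp [haS, hS], ?_⟩
    intro i hi j hj
    rw [Finset.mem_insert, not_or] at hj
    rcases Finset.mem_insert.1 hi with rfl | hi
    · exact hamax j (by simp [hj.2])
    · exact hmax i hi j hj.2

/-- A set of `k` coordinates (all of them when `k` exceeds their number) at which `x` is largest
in absolute value. -/
def topSet {ι : Type*} [Fintype ι] (k : ℕ) (x : ι → ℝ) : Finset ι :=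
  (exists_top x (min k (Fintype.card ι)) (min_le_right _ _)).choose

/-- `H_k(x)`: equal to `x` on the `k` largest (in absolute value) coordinates, zero elsewhere. -/
def headApprox {ι : Type*} [Fintype ι] (k : ℕ) (x : ι → ℝ) : ι → ℝ :=
  Set.indicator (topSet k x : Set ι) x

/-- Min-entropy (base `2`) of a distribution on a finite set. -/
def minEntropy {Ω : Type*} (p : PMF Ω) : ℝ :=
  ⨅ a : p.support, -Real.logb 2 (p a).toReal

/-- Statistical distance of two distributions on a finite set. -/
def statDist {Ω : Type*} [Fintype Ω] (p q : PMF Ω) : ℝ :=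
  (1 / 2) * ∑ a, |(p a).toReal - (q a).toReal|

/-- The distribution of `(Z, h(X, Z))` for independent `X` uniform on `S` and `Z` uniform on
`[D]`. -/
def seededOutput {n r D : ℕ} [NeZero D] (h : F2 n → Fin D → F2 r) (S : Finset (F2 n))
    (hS : S.Nonempty) : PMF (Fin D × F2 r) :=
  (PMF.uniformOfFinset S hS).bind fun a =>
    (PMF.uniformOfFintype (Fin D)).map fun z => (z, h a z)

/-- `(κ, ε)`-lossless condensers. -/
def IsLosslessCondenser {n r D : ℕ} [NeZero D] (κ ε : ℝ) (h : F2 n → Fin D → F2 r) : Prop :=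
  ∀ (S : Finset (F2 n)) (hS : S.Nonempty), (S.card : ℝ) ≤ (2 : ℝ) ^ κ →
    ∃ q : PMF (Fin D × F2 r),
      Real.logb 2 ((D : ℝ) * S.card) ≤ minEntropy q ∧ statDist (seededOutput h S hS) q ≤ ε

/-- Adjacency matrix of the bipartite graph associated with `h`: left vertex `a ∈ 𝔽₂^n` is joined
to the right vertex `(b, t)` iff `h(a, t) = b`. -/
def graphMatrix {n r D : ℕ} (h : F2 n → Fin D → F2 r) : Matrix (F2 r × Fin D) (F2 n) ℝ :=
  Matrix.of fun p a => if h a p.2 = p.1 then 1 else 0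

/-- The bit selection matrix: its entry at row `j` and column `i` is the `j`-th bit of `i`. -/
def bitMatrix (n : ℕ) : Matrix (Fin n) (F2 n) ℝ :=
  Matrix.of fun j i => ((i j).val : ℝ)

/-- Row-wise tensor product: row `(i, i')` is the coordinate-wise product of row `i` of `A` and
row `i'` of `A'`. -/
def rowTensor {α β γ : Type*} (A : Matrix α γ ℝ) (A' : Matrix β γ ℝ) : Matrix (α × β) γ ℝ :=
  Matrix.of fun p c => A p.1 c * A' p.2 c

/-- Binary encoding of a vector of bits as a natural number. -/
def encode {m : ℕ} (v : F2 m) : ℕ := ∑ i : Fin m, (v i).val * 2 ^ (i : ℕ)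

/-- The vector of the `m` lowest bits of a natural number. -/
def decode (m : ℕ) (w : ℕ) : F2 m := fun i => ((w / 2 ^ (i : ℕ) : ℕ) : ZMod 2)

/-! ## The machine model

A real RAM, programmed in a structured language. There are countably many named arrays of words
(natural numbers) and of real numbers, all initially zero apart from the input. Word operations
are addition, truncated subtraction, halving and comparison; real operations are the four field
operations and comparison. There is no conversion between reals and words. Each operation, memory
access, constant, test and assignment costs one step. -/

/-- Memory contents, and the number of random seeds drawn so far. -/
structure State where
  word : ℕ → ℕ → ℕ
  real : ℕ → ℕ → ℝ
  drawn : ℕ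

/-- Array `a` of words with entry `i` replaced by `w`. -/
def State.setWord (s : State) (a i w : ℕ) : State :=
  { s with word := Function.update s.word a (Function.update (s.word a) i w) }

/-- Array `a` of reals with entry `i` replaced by `v`. -/
def State.setReal (s : State) (a i : ℕ) (v : ℝ) : State :=
  { s with real := Function.update s.real a (Function.update (s.real a) i v) }

/-- The initial state: the input words and the input reals stand in the arrays with name `0`. -/
def State.init (ws : List ℕ) (rs : List ℝ) : State where
  word := fun a i => if a = 0 then ws.getD i 0 else 0
  real := fun a i => if a = 0 then rs.getD i 0 else 0
  drawn := 0

/-- Word expressions; `read a i` is entry `i` of the word array with name `a`. -/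
inductive WExp : Type
  | lit (c : ℕ)
  | read (a : ℕ) (i : WExp)
  | add (e₁ e₂ : WExp)
  | sub (e₁ e₂ : WExp)
  | half (e : WExp)

def WExp.eval (s : State) : WExp → ℕ
  | .lit c => c
  | .read a i => s.word a (i.eval s)
  | .add e₁ e₂ => e₁.eval s + e₂.eval s
  | .sub e₁ e₂ => e₁.eval s - e₂.eval s
  | .half e => e.eval s / 2

def WExp.cost : WExp → ℕ
  | .lit _ => 1
  | .read _ i => 1 + i.cost
  | .add e₁ e₂ => 1 + e₁.cost + e₂.cost
  | .sub e₁ e₂ => 1 + e₁.cost + e₂.cost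
  | .half e => 1 + e.cost

/-- Real expressions; `read a i` is entry `i` of the real array with name `a`. -/
inductive RExp : Type
  | lit (c : ℚ)
  | read (a : ℕ) (i : WExp)
  | add (e₁ e₂ : RExp)
  | sub (e₁ e₂ : RExp)
  | mul (e₁ e₂ : RExp)
  | div (e₁ e₂ : RExp)

def RExp.eval (s : State) : RExp → ℝ
  | .lit c => (c : ℝ)
  | .read a i => s.real a (i.eval s)
  | .add e₁ e₂ => e₁.eval s + e₂.eval s
  | .sub e₁ e₂ => e₁.eval s - e₂.eval s
  | .mul e₁ e₂ => e₁.eval s * e₂.eval s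
  | .div e₁ e₂ => e₁.eval s / e₂.eval s

def RExp.cost : RExp → ℕ
  | .lit _ => 1
  | .read _ i => 1 + i.cost
  | .add e₁ e₂ => 1 + e₁.cost + e₂.cost
  | .sub e₁ e₂ => 1 + e₁.cost + e₂.cost
  | .mul e₁ e₂ => 1 + e₁.cost + e₂.cost
  | .div e₁ e₂ => 1 + e₁.cost + e₂.cost

/-- Tests. -/
inductive Test : Type
  | leWord (e₁ e₂ : WExp)
  | leReal (e₁ e₂ : RExp)
  | neg (b : Test)
  | conj (b₁ b₂ : Test)

def Test.holds (s : State) : Test → Prop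
  | .leWord e₁ e₂ => e₁.eval s ≤ e₂.eval s
  | .leReal e₁ e₂ => e₁.eval s ≤ e₂.eval s
  | .neg b => ¬ b.holds s
  | .conj b₁ b₂ => b₁.holds s ∧ b₂.holds s

def Test.cost : Test → ℕ
  | .leWord e₁ e₂ => 1 + e₁.cost + e₂.cost
  | .leReal e₁ e₂ => 1 + e₁.cost + e₂.cost
  | .neg b => 1 + b.cost
  | .conj b₁ b₂ => 1 + b₁.cost + b₂.cost

/-- Programs, over a type `ι` of additional instructions. -/
inductive Program (ι : Type) : Type
  | skip
  | setWord (a : ℕ) (i e : WExp)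
  | setReal (a : ℕ) (i : WExp) (e : RExp)
  | special (c : ι)
  | seq (p₁ p₂ : Program ι)
  | ite (b : Test) (p₁ p₂ : Program ι)
  | loop (b : Test) (p : Program ι)

/-- `Exec H p s s' T`: started in state `s`, the program `p` halts in state `s'` after `T` steps.
`H` gives the effect and the cost of the additional instructions; `loop b p` is "while `b` do
`p`". -/
inductive Exec {ι : Type} (H : ι → State → State → ℕ → Prop) :
    Program ι → State → State → ℕ → Prop
  | skip (s : State) : Exec H .skip s s 1
  | setWord (a : ℕ) (i e : WExp) (s : State) :
      Exec H (.setWord a i e) s (s.setWord a (i.eval s) (e.eval s)) (1 + i.cost + e.cost)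
  | setReal (a : ℕ) (i : WExp) (e : RExp) (s : State) :
      Exec H (.setReal a i e) s (s.setReal a (i.eval s) (e.eval s)) (1 + i.cost + e.cost)
  | special (c : ι) (s s' : State) (T : ℕ) (hc : H c s s' T) : Exec H (.special c) s s' T
  | seq (p₁ p₂ : Program ι) (s s' s'' : State) (T₁ T₂ : ℕ)
      (h₁ : Exec H p₁ s s' T₁) (h₂ : Exec H p₂ s' s'' T₂) :
      Exec H (.seq p₁ p₂) s s'' (T₁ + T₂)
  | iteTrue (b : Test) (p₁ p₂ : Program ι) (s s' : State) (T : ℕ) (hb : b.holds s)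
      (h₁ : Exec H p₁ s s' T) : Exec H (.ite b p₁ p₂) s s' (1 + b.cost + T)
  | iteFalse (b : Test) (p₁ p₂ : Program ι) (s s' : State) (T : ℕ) (hb : ¬ b.holds s)
      (h₂ : Exec H p₂ s s' T) : Exec H (.ite b p₁ p₂) s s' (1 + b.cost + T)
  | loopDone (b : Test) (p : Program ι) (s : State) (hb : ¬ b.holds s) :
      Exec H (.loop b p) s s (1 + b.cost)
  | loopStep (b : Test) (p : Program ι) (s s' s'' : State) (T₁ T₂ : ℕ) (hb : b.holds s)
      (h₁ : Exec H p s s' T₁) (h₂ : Exec H (.loop b p) s' s'' T₂) :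
      Exec H (.loop b p) s s'' (1 + b.cost + T₁ + T₂)

/-- Runs of plain deterministic programs, which have no additional instructions. -/
abbrev PlainExec : Program Empty → State → State → ℕ → Prop :=
  Exec (fun c _ _ _ => c.elim)

/-- The plain program `Q` computes `h` in at most `T` steps: on input `n, k, r, D`, an element
`u ∈ 𝔽₂^n` and a seed `t ∈ [D]`, it halts within `T` steps with `h(u, t)` in entry `0` of the
word array with name `1`. -/
def ComputesWithin {n r D : ℕ} (Q : Program Empty) (k : ℕ) (h : F2 n → Fin D → F2 r)
    (T : ℕ) : Prop :=
  ∀ (u : F2 n) (t : Fin D), ∃ (s' : State) (T' : ℕ), T' ≤ T ∧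
    PlainExec Q (State.init [n, k, r, D, encode u, t] []) s' T' ∧ s'.word 1 0 = encode (h u t)

/-- The additional instructions of a recovery algorithm. In each, `a` and `i` name the array and
the entry that receive the result.
* `draw`: a fresh uniformly random seed from `[D]`;
* `query`: the entry `(j, t)` of the first sketch;
* `queryBit`: the entry `((j, t), b)` of the second sketch;
* `call`: the output of the subroutine on `u` and `t`. -/
inductive Instr : Type
  | draw (a : ℕ) (i : WExp)
  | query (a : ℕ) (i j t : WExp)
  | queryBit (a : ℕ) (i j t b : WExp)
  | call (a : ℕ) (i u t : WExp)

/-- The entry of the first sketch `y` at the position given by words (zero if there is none). -/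
def lookup {r D : ℕ} (y : F2 r × Fin D → ℝ) (j t : ℕ) : ℝ :=
  if ht : t < D then y (decode r j, ⟨t, ht⟩) else 0

/-- The entry of the second sketch `y` at the position given by words (zero if there is none). -/
def lookupBit {n r D : ℕ} (y : (F2 r × Fin D) × Fin n → ℝ) (j t b : ℕ) : ℝ :=
  if ht : t < D then
    if hb : b < n then y ((decode r j, ⟨t, ht⟩), ⟨b, hb⟩) else 0
  else 0

/-- Effect and cost of the additional instructions, for sketches `y` and `y'`, a subroutine `Q`
and the sequence `ω` of random seeds. A query or a draw is one step; a call of the subroutine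
costs all the steps that the subroutine makes. -/
inductive InstrStep {n r D : ℕ} (k : ℕ) (Q : Program Empty) (y : F2 r × Fin D → ℝ)
    (y' : (F2 r × Fin D) × Fin n → ℝ) (ω : ℕ → Fin D) : Instr → State → State → ℕ → Prop
  | draw (a : ℕ) (i : WExp) (s : State) :
      InstrStep k Q y y' ω (.draw a i) s
        { s.setWord a (i.eval s) (ω s.drawn) with drawn := s.drawn + 1 } (1 + i.cost)
  | query (a : ℕ) (i j t : WExp) (s : State) :
      InstrStep k Q y y' ω (.query a i j t) s
        (s.setReal a (i.eval s) (lookup y (j.eval s) (t.eval s)))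
        (1 + i.cost + j.cost + t.cost)
  | queryBit (a : ℕ) (i j t b : WExp) (s : State) :
      InstrStep k Q y y' ω (.queryBit a i j t b) s
        (s.setReal a (i.eval s) (lookupBit y' (j.eval s) (t.eval s) (b.eval s)))
        (1 + i.cost + j.cost + t.cost + b.cost)
  | call (a : ℕ) (i u t : WExp) (s s' : State) (T : ℕ)
      (hQ : PlainExec Q (State.init [n, k, r, D, u.eval s, t.eval s] []) s' T) :
      InstrStep k Q y y' ω (.call a i u t) s (s.setWord a (i.eval s) (s'.word 1 0))
        (1 + i.cost + u.cost + t.cost + T)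

/-- `Recovers P Q k h x η ν ω s T`: the algorithm made of the main program `P` and the subroutine
`Q`, on input `n, k, r, D` and `η, ν`, with query access to `M x` and `(M ⊗ B) x`, and with random
seeds `ω`, halts in state `s` after `T` steps. -/
def Recovers {n r D : ℕ} (P : Program Instr) (Q : Program Empty) (k : ℕ)
    (h : F2 n → Fin D → F2 r) (x : F2 n → ℝ) (η ν : ℝ) (ω : ℕ → Fin D) (s : State) (T : ℕ) :
    Prop :=
  Exec (InstrStep k Q ((graphMatrix h).mulVec x)
    ((rowTensor (graphMatrix h) (bitMatrix n)).mulVec x) ω)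
    P (State.init [n, k, r, D] [η, ν]) s T

/-- The output vector, in sparse representation: entry `0` of the word array `1` holds the number
of listed coordinates, the word array `2` their positions, the real array `1` their values. -/
def output (n : ℕ) (s : State) : F2 n → ℝ :=
  ∑ i ∈ Finset.range (s.word 1 0), Pi.single (decode n (s.word 2 i)) (s.real 1 i)

/-- The law of a sequence of independent uniformly random seeds from `[D]`. -/
def seedLaw (D : ℕ) [NeZero D] : Measure (ℕ → Fin D) :=
  Measure.infinitePi fun _ => (PMF.uniformOfFintype (Fin D)).toMeasure

/-- The base `2` logarithm, but at least `1`, as it is understood inside a bound `O(·)`. -/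
def log₁ (y : ℝ) : ℝ := max 1 (Real.logb 2 y)

end SparseRecovery

end

noncomputable section

namespace SparseRecovery

/-! ## Reasoning about programs -/

attribute [simp] WExp.eval RExp.eval Test.holds WExp.cost RExp.cost Test.cost

/-! The algorithm keeps a `k`-sparse approximation `x'` and improves it in blocks of seeds. Put `τ =
l1 (x - headApprox k x)`. Unless a block is unlucky, it replaces the error `E = l1 (x - x')` by at
most `E / 2 + 65 τ`. Starting from `x' = 0`, after `S` blocks with `2⁻ˢ ≤ ν` the error is at most `ν
‖x‖₁ + 130 τ`.

One seed. The sketch is linear, so the bins of the residual `z = x - x'` arise from those of `x` by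
subtracting the few entries of `x'`. If one entry has more than three quarters of the mass of its
bin, comparing the bin with its bit sums spells out the position of that entry (`found_eq`), and the
bin itself is a good estimate of its value. If there is no such entry, the whole mass of the bin is
comparable to the mass outside its largest entry. In both cases the error is a constant times the
mass lost in collisions (`l1_sub_estimate_le`).

Collisions. A lossless condenser is an expander: each set of at most `4k` elements has almost as
many neighbours as possible (`card_neighbours_ge`). Peeling off minima turns this statement on
cardinalities into one on weights (`sum_le_sum_sup`), so on average over the seeds the collision
mass is at most `2ε ‖z‖₁`. It is applied to the union of the supports of `headApprox k x` and `x'`,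
outside of which `z` has mass at most `τ`. By Markov's inequality at most one seed in 256 is bad.

One block. Among `2θ` seeds more than a quarter are bad with probability at most `2^(-2θ)`
(`card_bad_blocks_le`). Otherwise coordinate-wise approximate medians `w` of the estimates are close
to `z` (`l1_median_sub_le`), and cutting `x' + w` down to `k` nearly largest entries loses little
more than passing to `headApprox k x` would (`l1_sub_selected_le`). The memory before a block
depends only on earlier seeds, so the probability bound holds conditionally on these
(`seedLaw_block_le`), and a union bound over the `S` blocks suffices.

Running time. No step may cost `2^n`. An entry estimated by fewer than `θ` of the `2θ` seeds has
median zero, and a seed estimates at most `2^r` entries; hence a block adds at most `2 * 2^r`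
entries to the list (`Gathered.len_le`). Tables indexed by all positions are never cleared: each
block works in cells that are still zero. Medians and the selection threshold are found by bisection
in `n + 4` passes; an error `M / 2^(n+4)` per coordinate, with `M ≤ ‖z‖₁`, adds up to at most `‖z‖₁
/ 16` over all `2^n` coordinates. The factor `n` is absorbed by `f(n) = Ω(n)`, and `k ≤ 2 * 2^r`
again follows from expansion. -/

@[simp] theorem word_setWord (s : State) (a i w b : ℕ) :
    (s.setWord a i w).word b = if b = a then Function.update (s.word a) i w else s.word b := by
  by_cases h : b = a
  · subst h; simp [State.setWord]
  · simp [State.setWord, h]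

@[simp] theorem real_setReal (s : State) (a i : ℕ) (v : ℝ) (b : ℕ) :
    (s.setReal a i v).real b = if b = a then Function.update (s.real a) i v else s.real b := by
  by_cases h : b = a
  · subst h; simp [State.setReal]
  · simp [State.setReal, h]

@[simp] theorem real_setWord (s : State) (a i w : ℕ) : (s.setWord a i w).real = s.real := rfl

@[simp] theorem word_setReal (s : State) (a i : ℕ) (v : ℝ) : (s.setReal a i v).word = s.word := rfl

@[simp] theorem drawn_setWord (s : State) (a i w : ℕ) : (s.setWord a i w).drawn = s.drawn := rfl

@[simp] theorem drawn_setReal (s : State) (a i : ℕ) (v : ℝ) :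
    (s.setReal a i v).drawn = s.drawn := rfl

/-- The word array written by an instruction, if any. -/
def Instr.words : Instr → List ℕ
  | .draw a _ => [a]
  | .query _ _ _ _ => []
  | .queryBit _ _ _ _ _ => []
  | .call a _ _ _ => [a]

/-- The real array written by an instruction, if any. -/
def Instr.reals : Instr → List ℕ
  | .draw _ _ => []
  | .query a _ _ _ => [a]
  | .queryBit a _ _ _ _ => [a]
  | .call _ _ _ _ => []

/-- Whether an instruction draws a seed. -/
def Instr.draws : Instr → Bool
  | .draw _ _ => true
  | _ => false

/-- The word arrays that a program may write. -/
def Program.words : Program Instr → List ℕ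
  | .skip => []
  | .setWord a _ _ => [a]
  | .setReal _ _ _ => []
  | .special c => c.words
  | .seq p q => p.words ++ q.words
  | .ite _ p q => p.words ++ q.words
  | .loop _ p => p.words

/-- The real arrays that a program may write. -/
def Program.reals : Program Instr → List ℕ
  | .skip => []
  | .setWord _ _ _ => []
  | .setReal a _ _ => [a]
  | .special c => c.reals
  | .seq p q => p.reals ++ q.reals
  | .ite _ p q => p.reals ++ q.reals
  | .loop _ p => p.reals

/-- Whether a program may draw seeds. -/
def Program.draws : Program Instr → Bool
  | .skip => false
  | .setWord _ _ _ => false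
  | .setReal _ _ _ => false
  | .special c => c.draws
  | .seq p q => p.draws || q.draws
  | .ite _ p q => p.draws || q.draws
  | .loop _ p => p.draws

/-- The states `s` and `s'` agree on everything that is not written by a program with the given
lists of written arrays. -/
structure FrameOn (ws rs : List ℕ) (d : Bool) (s s' : State) : Prop where
  word_eq : ∀ a, a ∉ ws → s'.word a = s.word a
  real_eq : ∀ a, a ∉ rs → s'.real a = s.real a
  drawn_eq : d = false → s'.drawn = s.drawn

/-- The states `s` and `s'` agree on everything that `p` does not write. -/
abbrev Frame (p : Program Instr) (s s' : State) : Prop :=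
  FrameOn p.words p.reals p.draws s s'

theorem FrameOn.refl (ws rs : List ℕ) (d : Bool) (s : State) : FrameOn ws rs d s s :=
  ⟨fun _ _ => rfl, fun _ _ => rfl, fun _ => rfl⟩

theorem FrameOn.trans {ws rs : List ℕ} {d : Bool} {s s' s'' : State} (h : FrameOn ws rs d s s')
    (h' : FrameOn ws rs d s' s'') : FrameOn ws rs d s s'' :=
  ⟨fun a ha => (h'.word_eq a ha).trans (h.word_eq a ha),
    fun a ha => (h'.real_eq a ha).trans (h.real_eq a ha),
    fun hd => (h'.drawn_eq hd).trans (h.drawn_eq hd)⟩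

theorem FrameOn.mono {ws rs ws' rs' : List ℕ} {d d' : Bool} {s s' : State}
    (h : FrameOn ws rs d s s') (hw : ws ⊆ ws') (hr : rs ⊆ rs') (hd : d' = false → d = false) :
    FrameOn ws' rs' d' s s' :=
  ⟨fun a ha => h.word_eq a fun h' => ha (hw h'), fun a ha => h.real_eq a fun h' => ha (hr h'),
    fun h' => h.drawn_eq (hd h')⟩

theorem FrameOn.word {ws rs : List ℕ} {d : Bool} {s s' : State} (h : FrameOn ws rs d s s') (a : ℕ)
    (ha : a ∉ ws := by decide) : s'.word a = s.word a := h.word_eq a ha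

theorem FrameOn.real {ws rs : List ℕ} {d : Bool} {s s' : State} (h : FrameOn ws rs d s s') (a : ℕ)
    (ha : a ∉ rs := by decide) : s'.real a = s.real a := h.real_eq a ha

theorem FrameOn.drawn {ws rs : List ℕ} {d : Bool} {s s' : State} (h : FrameOn ws rs d s s')
    (hd : d = false := by decide) : s'.drawn = s.drawn := h.drawn_eq hd

/-- The additional instructions write only the arrays that they name. -/
class LocalInstr (H : Instr → State → State → ℕ → Prop) : Prop where
  frame : ∀ c s s' T, H c s s' T → FrameOn c.words c.reals c.draws s s'

instance {n r D k : ℕ} (Q : Program Empty) (y : F2 r × Fin D → ℝ)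
    (y' : (F2 r × Fin D) × Fin n → ℝ) (ω : ℕ → Fin D) : LocalInstr (InstrStep k Q y y' ω) where
  frame c s s' T h := by
    cases h <;> constructor <;> intros <;> simp_all [Instr.words, Instr.reals, Instr.draws]

variable {H : Instr → State → State → ℕ → Prop}

/-- The written arrays are over-approximated by syntactic lists, so that preservation of a named
array becomes a membership question settled by `decide`. -/
theorem Exec.frame [LocalInstr H] {p : Program Instr} {s s' : State} {T : ℕ}
    (h : Exec H p s s' T) : Frame p s s' := by
  induction h with
  | skip => exact .refl ..
  | setWord a i e s =>
    constructor <;> intros <;> simp_all [Program.words]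
  | setReal a i e s =>
    constructor <;> intros <;> simp_all [Program.reals]
  | special c s s' T hc => exact LocalInstr.frame c s s' T hc
  | seq p q s s' s'' T₁ T₂ _ _ ih₁ ih₂ =>
    refine FrameOn.trans (ih₁.mono ?_ ?_ ?_) (ih₂.mono ?_ ?_ ?_) <;>
      simp +contextual [Program.words, Program.reals, Program.draws]
  | iteTrue b p q s s' T hb _ ih =>
    refine ih.mono ?_ ?_ ?_ <;> simp +contextual [Program.words, Program.reals, Program.draws]
  | iteFalse b p q s s' T hb _ ih =>
    refine ih.mono ?_ ?_ ?_ <;> simp +contextual [Program.words, Program.reals, Program.draws]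
  | loopDone => exact .refl ..
  | loopStep b p s s' s'' T₁ T₂ hb _ _ ih₁ ih₂ => exact FrameOn.trans ih₁ ih₂

/-! ### Total correctness with time bounds -/

/-- Started in `s`, the program `p` halts within `B` steps in a state with property `Q`. -/
def Run (H : Instr → State → State → ℕ → Prop) (p : Program Instr) (s : State) (B : ℕ)
    (Q : State → Prop) : Prop :=
  ∃ s' T, Exec H p s s' T ∧ T ≤ B ∧ Q s'

theorem Run.mono {p : Program Instr} {s : State} {B B' : ℕ} {Q Q' : State → Prop}
    (h : Run H p s B Q) (hB : B ≤ B') (hQ : ∀ s', Q s' → Q' s') : Run H p s B' Q' := by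
  obtain ⟨s', T, h₁, h₂, h₃⟩ := h
  exact ⟨s', T, h₁, h₂.trans hB, hQ s' h₃⟩

theorem Run.frame [LocalInstr H] {p : Program Instr} {s : State} {B : ℕ} {Q : State → Prop}
    (h : Run H p s B Q) : Run H p s B fun s' => Frame p s s' ∧ Q s' := by
  obtain ⟨s', T, h₁, h₂, h₃⟩ := h
  exact ⟨s', T, h₁, h₂, h₁.frame, h₃⟩

theorem Run.seq {p q : Program Instr} {s : State} {B₁ B₂ : ℕ} {Q R : State → Prop}
    (h₁ : Run H p s B₁ R) (h₂ : ∀ s', R s' → Run H q s' B₂ Q) :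
    Run H (.seq p q) s (B₁ + B₂) Q := by
  obtain ⟨s', T, h₁, h₃, h₄⟩ := h₁
  obtain ⟨s'', T', h₅, h₆, h₇⟩ := h₂ s' h₄
  exact ⟨s'', T + T', .seq _ _ _ _ _ _ _ h₁ h₅, by omega, h₇⟩

/-- Sequential composition, with the frame of the first program. -/
theorem Run.seqF [LocalInstr H] {p q : Program Instr} {s : State} {B₁ B₂ : ℕ} {Q R : State → Prop}
    (h₁ : Run H p s B₁ R) (h₂ : ∀ s', Frame p s s' → R s' → Run H q s' B₂ Q) :
    Run H (.seq p q) s (B₁ + B₂) Q :=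
  h₁.frame.seq fun s' h => h₂ s' h.1 h.2

theorem Run.special {c : Instr} {s s' : State} {B T : ℕ} {Q : State → Prop} (h : H c s s' T)
    (hT : T ≤ B) (hQ : Q s') : Run H (.special c) s B Q :=
  ⟨s', T, .special _ _ _ _ h, hT, hQ⟩

/-- Induction on the number of passes that remain. Each intermediate state is compared by its frame
with the start of the loop, so an invariant need only mention what the body changes. -/
theorem Run.loop [LocalInstr H] {b : Test} {p : Program Instr} {s : State} {K B : ℕ}
    {I : ℕ → State → Prop} (h0 : I 0 s)
    (hstep : ∀ i < K, ∀ s', Frame p s s' → I i s' → b.holds s' ∧ Run H p s' B (I (i + 1)))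
    (hend : ∀ s', Frame p s s' → I K s' → ¬ b.holds s') :
    Run H (.loop b p) s (K * (B + 1 + b.cost) + 1 + b.cost) (I K) := by
  have key : ∀ m i s', i + m = K → Frame p s s' → I i s' →
      Run H (.loop b p) s' (m * (B + 1 + b.cost) + 1 + b.cost) (I K) := by
    intro m
    induction m with
    | zero =>
      intro i s' hi hf hI
      obtain rfl : i = K := by omega
      exact ⟨s', _, .loopDone _ _ _ (hend s' hf hI), by omega, hI⟩
    | succ m ih =>
      intro i s' hi hf hI
      obtain ⟨hb, s'', T, h₁, h₂, h₃⟩ := hstep i (by omega) s' hf hI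
      obtain ⟨s₃, T', h₄, h₅, h₆⟩ := ih (i + 1) s'' (by omega) (hf.trans h₁.frame) h₃
      refine ⟨s₃, _, .loopStep _ _ _ _ _ _ _ hb h₁ h₄, ?_, h₆⟩
      rw [Nat.succ_mul]
      omega
  exact key K 0 s (by omega) (.refl ..) h0

/-- The entry `0` of a word array, used as a variable. -/
abbrev WExp.var (a : ℕ) : WExp := .read a (.lit 0)

/-- The entry `0` of a real array, used as a variable. -/
abbrev RExp.var (a : ℕ) : RExp := .read a (.lit 0)

/-- `for v in 0..e do p`. -/
def forLoop (v : ℕ) (e : WExp) (p : Program Instr) : Program Instr :=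
  .seq (.setWord v (.lit 0) (.lit 0))
    (.loop (.leWord (.add (.var v) (.lit 1)) e)
      (.seq p (.setWord v (.lit 0) (.add (.var v) (.lit 1)))))

/-- A bound on the running time of `forLoop`. -/
def forCost (N B c : ℕ) : ℕ := N * (B + c + 12) + c + 9

/-- The body establishes the next invariant for the state in which the counter is already advanced.
The condition `hv` protects the counter, an ordinary array entry, from the body; `he` fixes the
bound, which is evaluated again at each test. -/
theorem Run.for [LocalInstr H] {v : ℕ} {e : WExp} {p : Program Instr} {s : State} {N B : ℕ}
    {I : ℕ → State → Prop} (hv : v ∉ p.words)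
    (he : ∀ s', Frame (forLoop v e p) s s' → e.eval s' = N)
    (h0 : I 0 (s.setWord v 0 0))
    (hstep : ∀ i < N, ∀ s', Frame (forLoop v e p) s s' → s'.word v 0 = i → I i s' →
      Run H p s' B fun s'' => I (i + 1) (s''.setWord v 0 (i + 1))) :
    Run H (forLoop v e p) s (forCost N B e.cost) (I N) := by
  have hfr0 : Frame (forLoop v e p) s (s.setWord v 0 0) := by
    constructor <;> intros <;> simp_all [forLoop, Program.words]
  have hfr : ∀ s', Frame (.seq p (.setWord v (.lit 0) (.add (.var v) (.lit 1))))
      (s.setWord v 0 0) s' → Frame (forLoop v e p) s s' := by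
    intro s' h
    refine FrameOn.trans hfr0 (h.mono ?_ ?_ ?_) <;>
      simp +contextual [forLoop, Program.words, Program.reals, Program.draws]
  -- The summand 6 pays for advancing the counter; the test `v + 1 ≤ e` expresses `v < e`.
  have main := Run.loop (H := H) (b := .leWord (.add (.var v) (.lit 1)) e)
    (p := .seq p (.setWord v (.lit 0) (.add (.var v) (.lit 1)))) (s := s.setWord v 0 0)
    (K := N) (B := B + 6) (I := fun i s' => s'.word v 0 = i ∧ I i s') ⟨by simp, h0⟩ ?_ ?_
  · obtain ⟨s', T, h₁, h₂, h₃⟩ := main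
    refine ⟨s', _, .seq _ _ _ _ _ _ _ (.setWord _ _ _ _) h₁, ?_, h₃.2⟩
    simp only [Test.cost, WExp.cost] at h₂ ⊢
    unfold forCost
    have e₁ : B + 6 + 1 + (1 + (1 + (1 + 1) + 1) + e.cost) = B + e.cost + 12 := by omega
    rw [e₁] at h₂
    omega
  · rintro i hi s' hf ⟨hvi, hI⟩
    refine ⟨by simp [hvi, he s' (hfr s' hf)]; omega, ?_⟩
    refine (Run.seqF (hstep i hi s' (hfr s' hf) hvi hI) (B₂ := 6) (R := fun s'' =>
      I (i + 1) (s''.setWord v 0 (i + 1))) fun s'' hf' hs'' => ?_)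
    refine ⟨_, _, .setWord _ _ _ _, by simp, ?_⟩
    have := congrFun (hf'.word_eq v hv) 0
    simpa [this, hvi] using hs''
  · rintro s' hf ⟨hvi, -⟩
    simp [hvi, he s' (hfr s' hf)]

/-! ### Loop-free programs -/

open Classical in
/-- The effect of a program without loops and additional instructions. -/
def Program.effect : Program Instr → State → State
  | .skip, s => s
  | .setWord a i e, s => s.setWord a (i.eval s) (e.eval s)
  | .setReal a i e, s => s.setReal a (i.eval s) (e.eval s)
  | .special _, s => s
  | .seq p q, s => q.effect (p.effect s)
  | .ite b p q, s => if b.holds s then p.effect s else q.effect s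
  | .loop _ _, s => s

/-- Whether a program has no loops and no additional instructions. -/
def Program.straight : Program Instr → Bool
  | .special _ => false
  | .seq p q => p.straight && q.straight
  | .ite _ p q => p.straight && q.straight
  | .loop _ _ => false
  | _ => true

/-- A bound on the running time of a program without loops and additional instructions. -/
def Program.steps : Program Instr → ℕ
  | .setWord _ i e => 1 + i.cost + e.cost
  | .setReal _ i e => 1 + i.cost + e.cost
  | .seq p q => p.steps + q.steps
  | .ite b p q => 1 + b.cost + (p.steps + q.steps)
  | _ => 1

theorem Program.exec_straight (p : Program Instr) (hp : p.straight = true) (s : State) :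
    ∃ T ≤ p.steps, Exec H p s (p.effect s) T := by
  induction p generalizing s with
  | skip => exact ⟨_, le_rfl, .skip _⟩
  | setWord a i e => exact ⟨_, le_rfl, .setWord _ _ _ _⟩
  | setReal a i e => exact ⟨_, le_rfl, .setReal _ _ _ _⟩
  | special c => simp [Program.straight] at hp
  | loop b p => simp [Program.straight] at hp
  | seq p q ihp ihq =>
    simp only [Program.straight, Bool.and_eq_true] at hp
    obtain ⟨T, hT, h⟩ := ihp hp.1 s
    obtain ⟨T', hT', h'⟩ := ihq hp.2 (p.effect s)
    exact ⟨T + T', by simp only [Program.steps]; omega, .seq _ _ _ _ _ _ _ h h'⟩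
  | ite b p q ihp ihq =>
    simp only [Program.straight, Bool.and_eq_true] at hp
    obtain ⟨T, hT, h⟩ := ihp hp.1 s
    obtain ⟨T', hT', h'⟩ := ihq hp.2 s
    by_cases hb : b.holds s
    · refine ⟨1 + b.cost + T, by simp only [Program.steps]; omega, ?_⟩
      simpa [Program.effect, hb] using Exec.iteTrue _ _ _ _ _ _ hb h
    · refine ⟨1 + b.cost + T', by simp only [Program.steps]; omega, ?_⟩
      simpa [Program.effect, hb] using Exec.iteFalse _ _ _ _ _ _ hb h'

/-- Loop-free code is verified by computing its effect. Since `Program.steps` charges both branches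
of a conditional, the time bound does not depend on the state. -/
theorem Run.straight {p : Program Instr} {s : State} {B : ℕ} {Q : State → Prop}
    (hQ : Q (p.effect s)) (hp : p.straight = true := by rfl) (hB : p.steps ≤ B := by decide) :
    Run H p s B Q := by
  obtain ⟨T, hT, h⟩ := p.exec_straight (H := H) hp s
  exact ⟨_, T, h, hT.trans hB, hQ⟩

/-! ## Dependence on the seeds -/

section Seeds

variable {n r D k : ℕ} {Q : Program Empty} {y : F2 r × Fin D → ℝ}
  {y' : (F2 r × Fin D) × Fin n → ℝ}

theorem Exec.drawn_le {ω : ℕ → Fin D} {p : Program Instr} {s s' : State} {T : ℕ}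
    (h : Exec (InstrStep k Q y y' ω) p s s' T) : s.drawn ≤ s'.drawn := by
  induction h with
  | special c s s' T hc => cases hc <;> simp
  | seq p q s s' s'' T₁ T₂ _ _ ih₁ ih₂ => exact ih₁.trans ih₂
  | loopStep b p s s' s'' T₁ T₂ hb _ _ ih₁ ih₂ => exact ih₁.trans ih₂
  | _ => simp_all

/-- A run depends only on the seeds that are drawn in it. -/
theorem Exec.congr_seeds {ω ω' : ℕ → Fin D} {p : Program Instr} {s s' : State} {T : ℕ}
    (h : Exec (InstrStep k Q y y' ω) p s s' T)
    (hω : ∀ i, s.drawn ≤ i → i < s'.drawn → ω i = ω' i) :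
    Exec (InstrStep k Q y y' ω') p s s' T := by
  induction h with
  | skip => exact .skip _
  | setWord => exact .setWord _ _ _ _
  | setReal => exact .setReal _ _ _ _
  | special c s s' T hc =>
    refine .special _ _ _ _ ?_
    cases hc with
    | draw a i s =>
      rw [hω s.drawn le_rfl (by simp)]
      exact .draw a i s
    | query a i j t s => exact .query a i j t s
    | queryBit a i j t b s => exact .queryBit a i j t b s
    | call a i u t s s' T hQ => exact .call a i u t s s' T hQ
  | seq p q s s' s'' T₁ T₂ h₁ h₂ ih₁ ih₂ =>
    have := h₁.drawn_le
    have := h₂.drawn_le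
    exact .seq _ _ _ _ _ _ _ (ih₁ fun i hi hi' => hω i hi (by omega))
      (ih₂ fun i hi hi' => hω i (by omega) hi')
  | iteTrue b p q s s' T hb _ ih => exact .iteTrue _ _ _ _ _ _ hb (ih hω)
  | iteFalse b p q s s' T hb _ ih => exact .iteFalse _ _ _ _ _ _ hb (ih hω)
  | loopDone b p s hb => exact .loopDone _ _ _ hb
  | loopStep b p s s' s'' T₁ T₂ hb h₁ h₂ ih₁ ih₂ =>
    have := h₁.drawn_le
    have := h₂.drawn_le
    exact .loopStep _ _ _ _ _ _ _ hb (ih₁ fun i hi hi' => hω i hi (by omega))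
      (ih₂ fun i hi hi' => hω i (by omega) hi')

end Seeds

/-! ## Hashing a vector into bins -/

section Bins

variable {n r D : ℕ} (h : F2 n → Fin D → F2 r) (z : F2 n → ℝ)

/-- The sum of the entries of `z` in bin `j`. -/
def binSum (t : Fin D) (j : F2 r) : ℝ := ∑ u, if h u t = j then z u else 0

/-- The sum of the entries of `z` in bin `j` whose position has bit `i` set. -/
def binBitSum (t : Fin D) (j : F2 r) (i : Fin n) : ℝ :=
  ∑ u, if h u t = j then z u * ((u i).val : ℝ) else 0

open Classical in
/-- The position read off from bin `j` bit by bit. -/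
def found (t : Fin D) (j : F2 r) : F2 n := fun i =>
  if binSum h z t j ^ 2 ≤ 4 * binBitSum h z t j i ^ 2 then 1 else 0

/-- The estimate of `z` from the bins for the seed `t`. -/
def estimate (t : Fin D) (u : F2 n) : ℝ :=
  if found h z t (h u t) = u then binSum h z t (h u t) else 0

variable {h z}

theorem abs_binSum_le (t : Fin D) (j : F2 r) :
    |binSum h z t j| ≤ ∑ u with h u t = j, |z u| := by
  rw [binSum, ← Finset.sum_filter]
  exact Finset.abs_sum_le_sum_abs _ _

/-- Let `σ` be the mass of the other entries in the bin. Bin and bit sums deviate by at most `σ`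
from what `p` alone would give. If the bit is 0, the bit sum is at most `σ` while the bin exceeds
`2σ`, so the test fails. If it is 1, twice the bit sum is at least `2|z p| - 2σ`, which beats `|z p|
+ σ` exactly because `|z p| > 3σ`. -/
theorem found_eq {t : Fin D} {j : F2 r} {p : F2 n} (hp : h p t = j)
    (hnoise : 3 * (∑ u with h u t = j, |z u| - |z p|) < |z p|) : found h z t j = p := by
  classical
  set B : Finset (F2 n) := Finset.univ.filter fun u => h u t = j with hB
  have hpB : p ∈ B := by simp [hB, hp]
  set σ := ∑ u ∈ B.erase p, |z u| with hσ
  have hs : ∑ u ∈ B, |z u| - |z p| = σ := by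
    rw [← Finset.add_sum_erase _ _ hpB]; ring
  rw [hs] at hnoise
  have hσ0 : 0 ≤ σ := Finset.sum_nonneg fun _ _ => abs_nonneg _
  have hy : |binSum h z t j - z p| ≤ σ := by
    rw [binSum, ← Finset.sum_filter, ← hB, ← Finset.add_sum_erase _ _ hpB, add_sub_cancel_left]
    exact Finset.abs_sum_le_sum_abs _ _
  have hbit : ∀ i, |binBitSum h z t j i - z p * ((p i).val : ℝ)| ≤ σ := by
    intro i
    rw [binBitSum, ← Finset.sum_filter, ← hB, ← Finset.add_sum_erase _ _ hpB, add_sub_cancel_left]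
    refine (Finset.abs_sum_le_sum_abs _ _).trans (Finset.sum_le_sum fun u _ => ?_)
    have h1 : ((u i).val : ℝ) ≤ 1 := by
      have := ZMod.val_lt (u i)
      exact_mod_cast (by omega : (u i).val ≤ 1)
    rw [abs_mul, abs_of_nonneg (by positivity : (0 : ℝ) ≤ ((u i).val : ℝ))]
    exact mul_le_of_le_one_right (abs_nonneg _) h1
  -- Squares replace absolute values because the machine has only field operations and comparisons.
  have e4 : ∀ b : ℝ, binSum h z t j ^ 2 ≤ 4 * b ^ 2 ↔ |binSum h z t j| ≤ 2 * |b| := by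
    intro b
    rw [show 4 * b ^ 2 = (2 * b) ^ 2 by ring, sq_le_sq, abs_mul, abs_two]
  funext i
  have hb := hbit i
  have ht := abs_sub_abs_le_abs_sub (z p) (binSum h z t j)
  have ht' := abs_sub_abs_le_abs_sub (binSum h z t j) (z p)
  rw [abs_sub_comm] at ht
  simp only [found, e4]
  have hv : (p i).val = 0 ∨ (p i).val = 1 := by
    have := ZMod.val_lt (p i)
    omega
  rcases hv with hv | hv
  · rw [hv] at hb
    rw [if_neg, (ZMod.val_eq_zero (p i)).1 hv]
    simp only [Nat.cast_zero, mul_zero, sub_zero] at hb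
    rw [not_le]
    linarith
  · rw [hv] at hb
    simp only [Nat.cast_one, mul_one] at hb
    have ht2 := abs_sub_abs_le_abs_sub (z p) (binBitSum h z t j i)
    rw [abs_sub_comm] at ht2
    rw [if_pos (by linarith)]
    apply ZMod.val_injective 2
    rw [hv]; rfl

/-- Only the one position read off from the bin can receive a nonzero estimate there. -/
theorem sum_abs_estimate_le (t : Fin D) (j : F2 r) :
    ∑ u with h u t = j, |estimate h z t u| ≤ |binSum h z t j| := by
  classical
  calc ∑ u with h u t = j, |estimate h z t u|
      = ∑ u with h u t = j, if u = found h z t j then |binSum h z t j| else 0 := by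
        refine Finset.sum_congr rfl fun u hu => ?_
        simp only [Finset.mem_filter, Finset.mem_univ, true_and] at hu
        rw [estimate, hu]
        by_cases hf : found h z t j = u
        · simp [hf]
        · have hf' : ¬ u = found h z t j := fun h' => hf h'.symm
          simp [hf, hf']
    _ ≤ |binSum h z t j| := by
        rw [Finset.sum_ite_eq']
        split_ifs <;> simp

/-- In each bin, the error of the estimate is bounded by the mass outside the largest entry. -/
theorem sum_abs_sub_estimate_le (S : Finset (F2 n)) (t : Fin D) (j : F2 r) :
    ∑ u with h u t = j, |z u - estimate h z t u| ≤
      8 * (∑ u with h u t = j, |z u| -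
        (((S.filter fun u => h u t = j).sup fun u => ‖z u‖₊ : NNReal) : ℝ)) := by
  classical
  set B : Finset (F2 n) := Finset.univ.filter fun u => h u t = j with hB
  set a : NNReal := (S.filter fun u => h u t = j).sup fun u => ‖z u‖₊ with ha
  have h2 : ∑ u ∈ B, |z u - estimate h z t u| ≤ 2 * ∑ u ∈ B, |z u| := by
    calc ∑ u ∈ B, |z u - estimate h z t u| ≤ ∑ u ∈ B, (|z u| + |estimate h z t u|) :=
          Finset.sum_le_sum fun u _ => abs_sub _ _
      _ ≤ _ := by
          rw [Finset.sum_add_distrib]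
          have := sum_abs_estimate_le (h := h) (z := z) t j
          have := abs_binSum_le (h := h) (z := z) t j
          linarith
  -- Origin of the factor 8: without a dominant entry the mass of the bin is at most 4 times the
  -- mass outside the maximum, and the error is at most twice the mass of the bin. With a dominant
  -- entry the position is found, and the factor 2 suffices.
  by_cases hlt : (a : ℝ) ≤ 3 * (∑ u ∈ B, |z u| - a)
  · linarith
  rw [not_le] at hlt
  -- If `S` misses the bin, then `a = 0` and the first case would have applied.
  have hne : (S.filter fun u => h u t = j).Nonempty := by
    by_contra hne
    rw [Finset.not_nonempty_iff_eq_empty] at hne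
    have ha0 : a = 0 := by rw [ha, hne]; simp
    rw [ha0] at hlt
    have : 0 ≤ ∑ u ∈ B, |z u| := Finset.sum_nonneg fun _ _ => abs_nonneg _
    simp at hlt
    linarith
  obtain ⟨p, hp, hpa⟩ := Finset.exists_mem_eq_sup _ hne fun u => ‖z u‖₊
  have hpj : h p t = j := (Finset.mem_filter.1 hp).2
  have hpB : p ∈ B := by simp [hB, hpj]
  have hza : (a : ℝ) = |z p| := by rw [ha, hpa]; simp
  rw [hza] at hlt ⊢
  have hf := found_eq hpj hlt
  have hs : ∑ u ∈ B, |z u| - |z p| = ∑ u ∈ B.erase p, |z u| := by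
    rw [← Finset.add_sum_erase _ _ hpB]; ring
  have hσ0 : 0 ≤ ∑ u ∈ B.erase p, |z u| := Finset.sum_nonneg fun _ _ => abs_nonneg _
  rw [hs, ← Finset.add_sum_erase _ _ hpB]
  have e1 : ∑ u ∈ B.erase p, |z u - estimate h z t u| = ∑ u ∈ B.erase p, |z u| := by
    refine Finset.sum_congr rfl fun u hu => ?_
    have huj : h u t = j := by simpa [hB] using (Finset.mem_erase.1 hu).2
    rw [estimate, huj, hf, if_neg (Finset.mem_erase.1 hu).1.symm, sub_zero]
  have e2 : |z p - estimate h z t p| ≤ ∑ u ∈ B.erase p, |z u| := by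
    rw [estimate, hpj, if_pos hf, abs_sub_comm, binSum, ← Finset.sum_filter, ← hB,
      ← Finset.add_sum_erase _ _ hpB, add_sub_cancel_left]
    exact Finset.abs_sum_le_sum_abs _ _
  linarith

theorem sum_bins {α : Type*} [AddCommMonoid α] (t : Fin D) (g : F2 n → α) (S : Finset (F2 n)) :
    ∑ j, ∑ u ∈ S with h u t = j, g u = ∑ u ∈ S, g u := by
  classical
  exact Finset.sum_fiberwise S (fun u => h u t) g

/-- The mass of `z` that is not the largest entry of `S` in its bin. -/
def noise (h : F2 n → Fin D → F2 r) (S : Finset (F2 n)) (z : F2 n → ℝ) (t : Fin D) : ℝ :=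
  ∑ u ∈ S, |z u| - ∑ j, (((S.filter fun u => h u t = j).sup fun u => ‖z u‖₊ : NNReal) : ℝ)

theorem l1_sub_estimate_le (S : Finset (F2 n)) (t : Fin D) :
    l1 (z - estimate h z t) ≤ 8 * (∑ u ∈ Sᶜ, |z u| + noise h S z t) := by
  have h1 : l1 (z - estimate h z t) = ∑ j, ∑ u with h u t = j, |z u - estimate h z t u| :=
    (sum_bins t _ _).symm
  have h2 : ∑ u, |z u| = ∑ j, ∑ u with h u t = j, |z u| := (sum_bins t _ _).symm
  have h3 : ∑ u ∈ S, |z u| + ∑ u ∈ Sᶜ, |z u| = ∑ u, |z u| := Finset.sum_add_sum_compl S _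
  rw [h1, noise, add_sub, add_comm, h3, h2, ← Finset.sum_sub_distrib, Finset.mul_sum]
  exact Finset.sum_le_sum fun j _ => sum_abs_sub_estimate_le S t j

end Bins

/-! ## Condensers lose little mass in collisions -/

section Condensers

variable {n r D : ℕ} {h : F2 n → Fin D → F2 r}

/-- The neighbourhood of `S` in the bipartite graph of `h`. -/
def neighbours (h : F2 n → Fin D → F2 r) (S : Finset (F2 n)) : Finset (Fin D × F2 r) :=
  (S ×ˢ Finset.univ).image fun p => (p.2, h p.1 p.2)

theorem card_neighbours_eq_sum (S : Finset (F2 n)) :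
    (neighbours h S).card =
      ∑ t, ∑ j, if (S.filter fun u => h u t = j).Nonempty then 1 else 0 := by
  classical
  rw [← Fintype.sum_prod_type', Finset.sum_boole, Nat.cast_id]
  congr 1
  ext ⟨t, j⟩
  simp only [neighbours, Finset.mem_image, Finset.mem_product, Finset.mem_univ, and_true,
    Prod.exists, Prod.mk.injEq, Finset.mem_filter, true_and, Finset.Nonempty]
  constructor
  · rintro ⟨u, t', hu, rfl, rfl⟩; exact ⟨u, hu, rfl⟩
  · rintro ⟨u, hu, rfl⟩; exact ⟨u, t, hu, rfl, rfl⟩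

theorem toReal_apply_le_of_le_minEntropy {Ω : Type*} [Fintype Ω] {q : PMF Ω} {m : ℝ} (hm : 0 < m)
    (hq : Real.logb 2 m ≤ minEntropy q) (a : Ω) : (q a).toReal ≤ 1 / m := by
  by_cases ha : a ∈ q.support
  · have hpos : 0 < (q a).toReal :=
      ENNReal.toReal_pos ((PMF.mem_support_iff _ _).1 ha) (q.apply_ne_top a)
    have h1 : minEntropy q ≤ -Real.logb 2 (q a).toReal :=
      ciInf_le (f := fun a : q.support => -Real.logb 2 (q a).toReal)
        (Set.finite_range _).bddBelow ⟨a, ha⟩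
    rw [← Real.logb_inv] at h1
    have h2 := (Real.logb_le_logb (b := 2) (by norm_num) hm (by positivity)).1 (hq.trans h1)
    rw [one_div]
    exact (le_inv_comm₀ hm hpos).1 h2
  · rw [PMF.mem_support_iff, not_not] at ha
    rw [ha]; simp; positivity

theorem sum_toReal_pmf {Ω : Type*} [Fintype Ω] (q : PMF Ω) : ∑ a, (q a).toReal = 1 := by
  rw [← ENNReal.toReal_sum fun a _ => q.apply_ne_top a, ← tsum_fintype (L := .unconditional _),
    q.tsum_coe, ENNReal.toReal_one]

/-- A layer-cake argument by induction on `S.card`. Subtracting the minimal weight `a p` leaves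
weights supported on `S.erase p`. The removed constant layer contributes `a p` once for every
nonempty bin, hence `a p` times the number of neighbours of `S`, which the expansion hypothesis
bounds from below. -/
theorem sum_le_sum_sup {γ : NNReal} (S : Finset (F2 n))
    (hS : ∀ S' ⊆ S, γ * ((D : NNReal) * S'.card) ≤ (neighbours h S').card) (a : F2 n → NNReal) :
    γ * ((D : NNReal) * ∑ u ∈ S, a u) ≤ ∑ t, ∑ j, (S.filter fun u => h u t = j).sup a := by
  classical
  induction hc : S.card generalizing S a with
  | zero => simp [Finset.card_eq_zero.1 hc]
  | succ c ih =>
    have hne : S.Nonempty := Finset.card_pos.1 (by omega)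
    obtain ⟨p, hp, hmin⟩ := Finset.exists_min_image S a hne
    set a' : F2 n → NNReal := fun u => a u - a p with ha'
    have haa : ∀ u ∈ S, a u = a' u + a p := fun u hu => (tsub_add_cancel_of_le (hmin u hu)).symm
    have hp0 : a' p = 0 := by simp [ha']
    have ih' := ih (S.erase p) (fun S' h' => hS S' (h'.trans (Finset.erase_subset _ _))) a'
      (by rw [Finset.card_erase_of_mem hp, hc]; rfl)
    have hsum : ∑ u ∈ S, a u = ∑ u ∈ S.erase p, a' u + S.card * a p := by
      rw [Finset.sum_congr rfl haa, Finset.sum_add_distrib, Finset.sum_const, nsmul_eq_mul,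
        ← Finset.add_sum_erase _ _ hp, hp0, zero_add]
    have hsup : ∀ t j, ((S.erase p).filter fun u => h u t = j).sup a' +
        (if (S.filter fun u => h u t = j).Nonempty then 1 else 0) * a p ≤
        (S.filter fun u => h u t = j).sup a := by
      intro t j
      split_ifs with hn
      · rw [one_mul]
        -- If `p` was alone in its bin, the first summand is a supremum over the empty set, and only
        -- the constant `a p` must be covered.
        rcases ((S.erase p).filter fun u => h u t = j).eq_empty_or_nonempty with he | he
        · rw [he, Finset.sup_empty, bot_eq_zero, zero_add]
          obtain ⟨u, hu⟩ := hn
          exact (hmin u (Finset.mem_filter.1 hu).1).trans (Finset.le_sup (f := a) hu)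
        · obtain ⟨u, hu, hu'⟩ := Finset.exists_mem_eq_sup _ he a'
          have huS : u ∈ S := Finset.mem_of_mem_erase (Finset.mem_filter.1 hu).1
          rw [hu', ← haa u huS]
          exact Finset.le_sup (f := a) (Finset.mem_filter.2 ⟨huS, (Finset.mem_filter.1 hu).2⟩)
      · rw [Finset.not_nonempty_iff_eq_empty] at hn
        have : ((S.erase p).filter fun u => h u t = j) = ∅ := by
          rw [← Finset.subset_empty, ← hn]
          exact Finset.filter_subset_filter _ (Finset.erase_subset _ _)
        rw [this]
        simp
    calc γ * ((D : NNReal) * ∑ u ∈ S, a u)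
        = γ * ((D : NNReal) * ∑ u ∈ S.erase p, a' u) + γ * ((D : NNReal) * S.card) * a p := by
          rw [hsum]; ring
      _ ≤ ∑ t, ∑ j, ((S.erase p).filter fun u => h u t = j).sup a' +
            (neighbours h S).card * a p := by
          gcongr
          exact hS S subset_rfl
      _ = ∑ t, ∑ j, (((S.erase p).filter fun u => h u t = j).sup a' +
            (if (S.filter fun u => h u t = j).Nonempty then 1 else 0) * a p) := by
          rw [card_neighbours_eq_sum]
          push_cast
          simp only [Finset.sum_add_distrib, Finset.sum_mul]
      _ ≤ _ := Finset.sum_le_sum fun t _ => Finset.sum_le_sum fun j _ => hsup t j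

theorem noise_nonneg (S : Finset (F2 n)) (z : F2 n → ℝ) (t : Fin D) : 0 ≤ noise h S z t := by
  classical
  rw [noise, sub_nonneg, ← sum_bins (h := h) t]
  refine Finset.sum_le_sum fun j _ => ?_
  have : (S.filter fun u => h u t = j).sup (fun u => ‖z u‖₊) ≤
      ∑ u ∈ S with h u t = j, ‖z u‖₊ :=
    Finset.sup_le fun u hu => Finset.single_le_sum (f := fun u => ‖z u‖₊) (fun _ _ => zero_le) hu
  have := NNReal.coe_le_coe.2 this
  push_cast at this
  simpa using this

variable [NeZero D]

/-- The output law lives on the neighbours of `S`, so the nearby distribution `q` has mass at least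
`1 - 2 * ε` there. Min-entropy caps each atom of `q` at `1 / (D * S.card)`, hence many atoms are
needed. -/
theorem card_neighbours_ge {κ ε : ℝ} (hh : IsLosslessCondenser κ ε h) (S : Finset (F2 n))
    (hS : (S.card : ℝ) ≤ (2 : ℝ) ^ κ) :
    (1 - 2 * ε) * ((D : ℝ) * S.card) ≤ (neighbours h S).card := by
  classical
  rcases S.eq_empty_or_nonempty with rfl | hne
  · simp
  obtain ⟨q, hq, hd⟩ := hh S hne hS
  set p := seededOutput h S hne with hp
  have hDS : (0 : ℝ) < (D : ℝ) * S.card := by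
    have := hne.card_pos
    have := NeZero.pos D
    positivity
  have hout : ∀ a ∉ neighbours h S, p a = 0 := by
    intro a ha
    by_contra hpa
    have hmem : a ∈ p.support := (PMF.mem_support_iff _ _).2 hpa
    rw [hp, seededOutput, PMF.mem_support_bind_iff] at hmem
    obtain ⟨u, hu, hmem⟩ := hmem
    rw [PMF.mem_support_map_iff] at hmem
    obtain ⟨t, -, rfl⟩ := hmem
    rw [PMF.mem_support_uniformOfFinset_iff] at hu
    exact ha (Finset.mem_image.2 ⟨(u, t), by simp [hu], rfl⟩)
  -- The mass of `q` off the neighbours is bounded by the full `ℓ₁` distance, which is twice the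
  -- statistical distance.
  have h1 : ∑ a ∈ (neighbours h S)ᶜ, (q a).toReal ≤ 2 * ε := by
    calc ∑ a ∈ (neighbours h S)ᶜ, (q a).toReal
        ≤ ∑ a ∈ (neighbours h S)ᶜ, |(p a).toReal - (q a).toReal| := by
          refine Finset.sum_le_sum fun a ha => ?_
          rw [hout a (Finset.mem_compl.1 ha)]
          simp
      _ ≤ ∑ a, |(p a).toReal - (q a).toReal| :=
          Finset.sum_le_univ_sum_of_nonneg fun _ => abs_nonneg _
      _ ≤ 2 * ε := by
          rw [statDist] at hd
          linarith
  have h2 : ∑ a ∈ neighbours h S, (q a).toReal ≤ (neighbours h S).card * (1 / ((D : ℝ) * S.card)) := by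
    rw [← nsmul_eq_mul]
    exact Finset.sum_le_card_nsmul _ _ _ fun a _ => toReal_apply_le_of_le_minEntropy hDS hq a
  have h3 := Finset.sum_add_sum_compl (neighbours h S) fun a => (q a).toReal
  rw [sum_toReal_pmf] at h3
  have h4 : 1 - 2 * ε ≤ (neighbours h S).card * (1 / ((D : ℝ) * S.card)) := by linarith
  rwa [mul_one_div, le_div_iff₀ hDS] at h4

/-- The bin maxima together carry at least the fraction `1 - 2 * ε` of `D` copies of the mass on
`S`; the noise is the rest. -/
theorem sum_noise_le {κ ε : ℝ} (hε0 : 0 ≤ ε) (hε : ε ≤ 1 / 2) (hh : IsLosslessCondenser κ ε h)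
    (S : Finset (F2 n)) (hS : (S.card : ℝ) ≤ (2 : ℝ) ^ κ) (z : F2 n → ℝ) :
    ∑ t, noise h S z t ≤ 2 * ε * (D * l1 z) := by
  have h0 : 0 ≤ 1 - 2 * ε := by linarith
  obtain ⟨γ, hγ⟩ : ∃ γ : NNReal, (γ : ℝ) = 1 - 2 * ε := ⟨⟨_, h0⟩, rfl⟩
  have key := sum_le_sum_sup (h := h) (γ := γ) S (fun S' hS' => by
    rw [← NNReal.coe_le_coe]
    push_cast
    rw [hγ]
    refine card_neighbours_ge hh S' (le_trans ?_ hS)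
    exact_mod_cast Finset.card_le_card hS') fun u => ‖z u‖₊
  rw [← NNReal.coe_le_coe] at key
  simp only [NNReal.coe_mul, NNReal.coe_sum, NNReal.coe_natCast, coe_nnnorm,
    Real.norm_eq_abs, hγ] at key
  have hle : ∑ u ∈ S, |z u| ≤ l1 z := Finset.sum_le_univ_sum_of_nonneg fun _ => abs_nonneg _
  simp only [noise]
  rw [Finset.sum_sub_distrib, Finset.sum_const, Finset.card_univ, Fintype.card_fin, nsmul_eq_mul]
  have h3 : 2 * ε * (D * ∑ u ∈ S, |z u|) ≤ 2 * ε * (D * l1 z) := by gcongr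
  linarith

/-- Few seeds have a noise that is large compared to the norm of the vector. -/
theorem card_noise_gt_le {κ ε β : ℝ} (hε0 : 0 ≤ ε) (hε : ε ≤ 1 / 2) (hβ : 0 < β)
    (hh : IsLosslessCondenser κ ε h)
    (S : Finset (F2 n)) (hS : (S.card : ℝ) ≤ (2 : ℝ) ^ κ) (z : F2 n → ℝ) :
    ((Finset.univ.filter fun t => β * l1 z < noise h S z t).card : ℝ) ≤ 2 * ε / β * D := by
  have hl : 0 ≤ l1 z := Finset.sum_nonneg fun _ _ => abs_nonneg _
  rcases hl.eq_or_lt with hz | hz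
  -- Markov's inequality below cancels `l1 z`, so a vanishing vector is treated apart.
  · have hn : ∀ t, noise h S z t ≤ 0 := by
      intro t
      have h1 : ∑ u ∈ S, |z u| ≤ l1 z := Finset.sum_le_univ_sum_of_nonneg fun _ => abs_nonneg _
      rw [noise]
      have : 0 ≤ ∑ j, (((S.filter fun u => h u t = j).sup fun u => ‖z u‖₊ : NNReal) : ℝ) :=
        Finset.sum_nonneg fun _ _ => NNReal.coe_nonneg _
      linarith
    rw [Finset.filter_false_of_mem (fun t _ => by rw [← hz]; simpa using hn t)]
    simp only [Finset.card_empty, Nat.cast_zero]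
    positivity
  · have h1 := sum_noise_le hε0 hε hh S hS z
    have h2 : (Finset.univ.filter fun t => β * l1 z < noise h S z t).card * (β * l1 z) ≤
        ∑ t, noise h S z t := by
      rw [← nsmul_eq_mul]
      refine (Finset.card_nsmul_le_sum _ _ _ fun t ht => ?_).trans
        (Finset.sum_le_univ_sum_of_nonneg fun t => noise_nonneg S z t)
      exact (Finset.mem_filter.1 ht).2.le
    have h3 := h2.trans h1
    rw [div_mul_eq_mul_div, le_div_iff₀ hβ]
    refine le_of_mul_le_mul_right ?_ hz
    linarith

/-- Used for the running time: handling the current vector must cost only `O(2 ^ r)` list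
operations. A set of `k` elements has at least `D * k / 2` of the `D * 2 ^ r` right vertices as
neighbours. -/
theorem card_le_two_mul_two_pow {ε : ℝ} {k : ℕ} (hε : ε ≤ 1 / 4) (hk : 1 ≤ k)
    (hkn : k ≤ 2 ^ n) (hh : IsLosslessCondenser (Real.logb 2 (4 * (k : ℝ))) ε h) :
    k ≤ 2 * 2 ^ r := by
  obtain ⟨S, -, hS⟩ := Finset.exists_subset_card_eq
    (s := (Finset.univ : Finset (F2 n))) (n := k) (by simpa [ZMod.card] using hkn)
  have hk0 : (0 : ℝ) < k := by exact_mod_cast hk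
  have h1 := card_neighbours_ge hh S (by
    rw [hS, Real.rpow_logb (by norm_num) (by norm_num) (by positivity)]; linarith)
  have h2 : (neighbours h S).card ≤ D * 2 ^ r := by
    refine (Finset.card_le_univ _).trans ?_
    simp [ZMod.card]
  have hD : (0 : ℝ) < D := by exact_mod_cast NeZero.pos D
  have h3 : (D : ℝ) * ((1 - 2 * ε) * k) ≤ D * 2 ^ r := by
    calc (D : ℝ) * ((1 - 2 * ε) * k) = (1 - 2 * ε) * ((D : ℝ) * S.card) := by rw [hS]; ring
      _ ≤ (neighbours h S).card := h1
      _ ≤ D * 2 ^ r := by exact_mod_cast h2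
  have h4 := le_of_mul_le_mul_left h3 hD
  have h5 : (1 / 2 : ℝ) * k ≤ (1 - 2 * ε) * k := by gcongr; linarith
  have h6 : (k : ℝ) ≤ 2 * 2 ^ r := by linarith
  exact_mod_cast h6

end Condensers

/-! ## Coordinate-wise approximate medians and selection of large entries -/

section Robust

variable {ι : Type*} [Fintype ι]

theorem l1_nonneg (x : ι → ℝ) : 0 ≤ l1 x := Finset.sum_nonneg fun _ _ => abs_nonneg _

theorem l1_add_le (x y : ι → ℝ) : l1 (x + y) ≤ l1 x + l1 y := by
  rw [l1, l1, l1, ← Finset.sum_add_distrib]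
  exact Finset.sum_le_sum fun _ _ => abs_add_le _ _

theorem l1_sub_comm (x y : ι → ℝ) : l1 (x - y) = l1 (y - x) :=
  Finset.sum_congr rfl fun _ _ => abs_sub_comm _ _

theorem l1_sub_le (x y z : ι → ℝ) : l1 (x - z) ≤ l1 (x - y) + l1 (y - z) := by
  rw [← sub_add_sub_cancel x y z]
  exact l1_add_le _ _

/-- If `w` is in every coordinate at least as close to `z` (up to `δ`) as half of the vectors
`v i`, and three quarters of these are `R`-close to `z`, then `w` is close to `z`. -/
theorem l1_median_sub_le {W : ℕ} (hW : 0 < W) (v : Fin W → ι → ℝ) (w z : ι → ℝ) (δ R : ℝ)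
    (hw : ∀ u, W ≤ 2 * (Finset.univ.filter fun i => |w u - z u| ≤ |v i u - z u| + δ).card)
    (G : Finset (Fin W)) (hG : 4 * (Gᶜ).card ≤ W) (hR : ∀ i ∈ G, l1 (z - v i) ≤ R) :
    l1 (w - z) ≤ 4 * R + δ * Fintype.card ι := by
  classical
  have hWr : (0 : ℝ) < W := by exact_mod_cast hW
  have h1 : ∀ u, (W : ℝ) / 4 * (|w u - z u| - δ) ≤ ∑ i ∈ G, |z u - v i u| := by
    intro u
    by_cases hn : |w u - z u| - δ ≤ 0
    · refine le_trans ?_ (Finset.sum_nonneg fun _ _ => abs_nonneg _)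
      exact mul_nonpos_of_nonneg_of_nonpos (by positivity) hn
    rw [not_le] at hn
    set A := Finset.univ.filter fun i => |w u - z u| ≤ |v i u - z u| + δ with hA
    -- At least half of the indices witness the error of `w u` and at most a quarter are outside
    -- `G`, so a quarter are good witnesses. Each charges the error of `w u` to that of a good
    -- estimate.
    have hcard : W ≤ 4 * (A ∩ G).card := by
      have h2 := hw u
      have h3 : A.card ≤ (A ∩ G).card + (Gᶜ).card := by
        rw [← Finset.card_inter_add_card_sdiff A G]
        gcongr
        intro i hi
        simp only [Finset.mem_sdiff] at hi
        simpa using hi.2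
      change W ≤ 2 * A.card at h2
      omega
    have hcard' : (W : ℝ) / 4 ≤ (A ∩ G).card := by
      have : (W : ℝ) ≤ 4 * (A ∩ G).card := by exact_mod_cast hcard
      linarith
    calc (W : ℝ) / 4 * (|w u - z u| - δ) ≤ (A ∩ G).card * (|w u - z u| - δ) := by gcongr
      _ = ∑ i ∈ A ∩ G, (|w u - z u| - δ) := by rw [Finset.sum_const, nsmul_eq_mul]
      _ ≤ ∑ i ∈ A ∩ G, |z u - v i u| := by
          refine Finset.sum_le_sum fun i hi => ?_
          have := (Finset.mem_filter.1 (Finset.mem_inter.1 hi).1).2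
          rw [abs_sub_comm (z u)]
          linarith
      _ ≤ ∑ i ∈ G, |z u - v i u| :=
          Finset.sum_le_sum_of_subset_of_nonneg Finset.inter_subset_right
            fun _ _ _ => abs_nonneg _
  -- Nonnegativity of `R` comes only from a member of `G`; an empty `G` is excluded at the end since
  -- its complement would be too large.
  have h2 : (W : ℝ) / 4 * (l1 (w - z) - δ * Fintype.card ι) ≤ W * R ∨ G.card = 0 := by
    rcases Nat.eq_zero_or_pos G.card with hG0 | hG0
    · exact Or.inr hG0
    left
    obtain ⟨i₀, hi₀⟩ := Finset.card_pos.1 hG0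
    have hR0 : 0 ≤ R := (l1_nonneg _).trans (hR i₀ hi₀)
    calc (W : ℝ) / 4 * (l1 (w - z) - δ * Fintype.card ι)
        = ∑ u, (W : ℝ) / 4 * (|w u - z u| - δ) := by
          rw [← Finset.mul_sum, Finset.sum_sub_distrib, Finset.sum_const, nsmul_eq_mul,
            Finset.card_univ, mul_comm δ]
          rfl
      _ ≤ ∑ u, ∑ i ∈ G, |z u - v i u| := Finset.sum_le_sum fun u _ => h1 u
      _ = ∑ i ∈ G, l1 (z - v i) := Finset.sum_comm
      _ ≤ G.card * R := by
          rw [← nsmul_eq_mul]; exact Finset.sum_le_card_nsmul _ _ _ hR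
      _ ≤ W * R := by
          gcongr
          exact (Finset.card_le_univ _).trans (by simp)
  rcases h2 with h2 | h2
  · have : (W : ℝ) / 4 * (l1 (w - z) - δ * Fintype.card ι) ≤ W / 4 * (4 * R) := by linarith
    have := le_of_mul_le_mul_left this (by positivity)
    linarith
  · have : (Gᶜ).card = W := by
      rw [Finset.card_eq_zero.1 h2]; simp
    omega

/-- Keeping entries that are, up to `δ`, the largest ones, is nearly optimal among all sparse
approximations. -/
theorem l1_sub_selected_le {k : ℕ} (v v' y : ι → ℝ) (K : Finset ι) (δ : ℝ) (hδ : 0 ≤ δ)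
    (hin : ∀ u ∈ K, v' u = v u) (hout : ∀ u ∉ K, v' u = 0) (hy : IsSparse k y)
    (hK : (∀ u ∉ K, v u = 0) ∨
      (K.card = k ∧ ∀ u ∈ K, ∀ u' ∉ K, |v u'| ≤ |v u| + δ)) :
    l1 (v - v') ≤ l1 (v - y) + k * δ := by
  classical
  have h1 : l1 (v - v') = ∑ u ∈ Kᶜ, |v u| := by
    rw [l1, ← Finset.sum_add_sum_compl K, Finset.sum_eq_zero, zero_add]
    · refine Finset.sum_congr rfl fun u hu => ?_
      simp [hout u (Finset.mem_compl.1 hu)]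
    · intro u hu
      simp [hin u hu]
  rcases hK with hK | ⟨hKc, hK⟩
  · rw [h1, Finset.sum_eq_zero fun u hu => by rw [hK u (Finset.mem_compl.1 hu), abs_zero]]
    have := l1_nonneg (v - y)
    positivity
  set Y : Finset ι := Finset.univ.filter fun u => y u ≠ 0 with hY
  have hYc : Y.card ≤ k := by
    rw [IsSparse, Set.ncard_eq_toFinset_card'] at hy
    convert hy using 2
    ext u; simp [hY]
  have h2 : ∑ u ∈ Yᶜ, |v u| ≤ l1 (v - y) := by
    rw [l1, ← Finset.sum_add_sum_compl Y]
    have : ∑ u ∈ Yᶜ, |v u| = ∑ u ∈ Yᶜ, |(v - y) u| := by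
      refine Finset.sum_congr rfl fun u hu => ?_
      have : y u = 0 := by simpa [hY] using hu
      simp [this]
    rw [this]
    have : 0 ≤ ∑ u ∈ Y, |(v - y) u| := Finset.sum_nonneg fun _ _ => abs_nonneg _
    linarith
  -- Exchange argument: since `Y` is no larger than `K`, the entries of `Y` missed by `K` inject
  -- into the entries of `K` outside `Y`, each of which is at least as large up to `δ`.
  have hcard : (Y \ K).card ≤ (K \ Y).card := by
    have := Finset.card_sdiff_add_card_inter Y K
    have h' := Finset.card_sdiff_add_card_inter K Y
    rw [Finset.inter_comm] at h'
    omega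
  obtain ⟨K', hK', hK'c⟩ := Finset.exists_subset_card_eq hcard
  have e : (Y \ K).card = K'.card := hK'c.symm
  have h3 : ∑ u ∈ Y \ K, |v u| ≤ ∑ u ∈ K \ Y, |v u| + k * δ := by
    let σ := Finset.equivOfCardEq e
    calc ∑ u ∈ Y \ K, |v u| = ∑ u : (Y \ K : Finset ι), |v u| := (Finset.sum_coe_sort _ _).symm
      _ ≤ ∑ u : (Y \ K : Finset ι), (|v (σ u)| + δ) := by
          refine Finset.sum_le_sum fun u _ => hK _ ?_ _ ?_
          · exact (Finset.mem_sdiff.1 (hK' (σ u).2)).1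
          · exact (Finset.mem_sdiff.1 u.2).2
      _ = ∑ u : K', |v u| + (Y \ K).card * δ := by
          rw [Finset.sum_add_distrib, Finset.sum_const, nsmul_eq_mul, Finset.card_univ,
            Fintype.card_coe, Equiv.sum_comp σ fun u : K' => |v u|]
      _ ≤ ∑ u ∈ K \ Y, |v u| + k * δ := by
          rw [Finset.sum_coe_sort K' fun u => |v u|]
          have hc : (Y \ K).card ≤ k := (Finset.card_le_card Finset.sdiff_subset).trans hYc
          gcongr
  have h4 : ∑ u ∈ Kᶜ, |v u| = ∑ u ∈ Y \ K, |v u| + ∑ u ∈ Kᶜ ∩ Yᶜ, |v u| := by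
    rw [← Finset.sum_inter_add_sum_sdiff Kᶜ Y]
    congr 2
    · ext u; simp [and_comm]
    · ext u; simp
  have h5 : ∑ u ∈ Yᶜ, |v u| = ∑ u ∈ K \ Y, |v u| + ∑ u ∈ Kᶜ ∩ Yᶜ, |v u| := by
    rw [← Finset.sum_inter_add_sum_sdiff Yᶜ K]
    congr 2
    · ext u; simp [and_comm]
    · ext u; simp [and_comm]
  linarith

end Robust

/-! ## One step of the recovery -/

section Progress

theorem ncard_support {ι : Type*} [Fintype ι] [DecidableEq ι] (x : ι → ℝ) :
    (Function.support x).ncard = (Finset.univ.filter fun u => x u ≠ 0).card := by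
  rw [← Set.ncard_coe_finset]
  congr 1
  ext u; simp

theorem isSparse_headApprox {ι : Type*} [Fintype ι] (k : ℕ) (x : ι → ℝ) :
    IsSparse k (headApprox k x) := by
  have hc := (exists_top x (min k (Fintype.card ι)) (min_le_right _ _)).choose_spec.1
  refine (Set.ncard_le_ncard (t := (topSet k x : Set ι)) ?_ (Finset.finite_toSet _)).trans ?_
  · exact Set.support_indicator_subset
  · rw [Set.ncard_coe_finset]
    exact hc.le.trans (min_le_left _ _)

variable {n r D k : ℕ} {h : F2 n → Fin D → F2 r}

/-- For most seeds the estimate of the residual is good. -/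
theorem card_bad_seeds_le [NeZero D] (hk : 1 ≤ k)
    (hh : IsLosslessCondenser (Real.logb 2 (4 * (k : ℝ))) (1 / 2 ^ 18) h) (x x' : F2 n → ℝ)
    (hx' : IsSparse k x') :
    256 * (Finset.univ.filter fun t => ¬ l1 (x - x' - estimate h (x - x') t) ≤
      l1 (x - x') / 64 + 8 * l1 (x - headApprox k x)).card ≤ D := by
  classical
  -- On the complement of this set both `headApprox k x` and `x'` vanish, so the residual there is
  -- the tail of `x`. Its size is at most `2k`, within the range of the condenser.
  set S : Finset (F2 n) := Finset.univ.filter (fun u => headApprox k x u ≠ 0) ∪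
    Finset.univ.filter (fun u => x' u ≠ 0) with hSdef
  have hS : S.card ≤ 2 * k := by
    have h1 := isSparse_headApprox k x
    rw [IsSparse, ncard_support] at h1 hx'
    exact (Finset.card_union_le _ _).trans (by omega)
  have hk0 : (0 : ℝ) < k := by exact_mod_cast hk
  have hS' : (S.card : ℝ) ≤ (2 : ℝ) ^ Real.logb 2 (4 * (k : ℝ)) := by
    rw [Real.rpow_logb (by norm_num) (by norm_num) (by positivity)]
    have : (S.card : ℝ) ≤ 2 * k := by exact_mod_cast hS
    linarith
  -- With this `β` one has `8 * β = 1/64`, the contraction wanted, and `2 * ε / β = 2 * 2⁻¹⁸ * 2⁹ =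
  -- 1/256`, the fraction of bad seeds.
  have h2 := card_noise_gt_le (β := 1 / 2 ^ 9) (by norm_num) (by norm_num) (by norm_num) hh S hS'
    (x - x')
  have h3 : ∑ u ∈ Sᶜ, |(x - x') u| ≤ l1 (x - headApprox k x) := by
    rw [Finset.sum_congr rfl (g := fun u => |(x - headApprox k x) u|)]
    · exact Finset.sum_le_univ_sum_of_nonneg fun _ => abs_nonneg _
    · intro u hu
      simp only [hSdef, Finset.compl_union, Finset.mem_inter, Finset.mem_compl, Finset.mem_filter,
        Finset.mem_univ, true_and, not_not] at hu
      simp [hu.1, hu.2]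
  have h4 : (Finset.univ.filter fun t => ¬ l1 (x - x' - estimate h (x - x') t) ≤
      l1 (x - x') / 64 + 8 * l1 (x - headApprox k x)).card ≤
      (Finset.univ.filter fun t => 1 / 2 ^ 9 * l1 (x - x') < noise h S (x - x') t).card := by
    refine Finset.card_le_card fun t ht => ?_
    simp only [Finset.mem_filter, Finset.mem_univ, true_and] at ht ⊢
    by_contra hn
    have := l1_sub_estimate_le (h := h) (z := x - x') S t
    apply ht
    linarith
  have h5 : (256 : ℝ) * (Finset.univ.filter fun t => ¬ l1 (x - x' - estimate h (x - x') t) ≤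
      l1 (x - x') / 64 + 8 * l1 (x - headApprox k x)).card ≤ D := by
    have : ((Finset.univ.filter fun t => ¬ l1 (x - x' - estimate h (x - x') t) ≤
      l1 (x - x') / 64 + 8 * l1 (x - headApprox k x)).card : ℝ) ≤
      (Finset.univ.filter fun t => 1 / 2 ^ 9 * l1 (x - x') < noise h S (x - x') t).card := by
      exact_mod_cast h4
    norm_num at h2
    linarith
  exact_mod_cast h5

/-- The improvement of the error in a block of seeds. `w` is an approximate coordinate-wise median
of the estimates, `x''` consists of approximately largest entries of `x' + w`. -/
theorem l1_sub_le_of_block {W : ℕ} (hW : 0 < W) (hkn : k ≤ 2 ^ n) (x x' w x'' : F2 n → ℝ)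
    (t : Fin W → Fin D) (M : ℝ) (hM0 : 0 ≤ M) (hM : M ≤ l1 (x - x'))
    (hbad : 4 * (Finset.univ.filter fun i => ¬ l1 (x - x' - estimate h (x - x') (t i)) ≤
      l1 (x - x') / 64 + 8 * l1 (x - headApprox k x)).card ≤ W)
    (hw : ∀ u, W ≤ 2 * (Finset.univ.filter fun i => |w u - (x - x') u| ≤
      |estimate h (x - x') (t i) u - (x - x') u| + 2 * M / 2 ^ (n + 4)).card)
    (K : Finset (F2 n)) (hin : ∀ u ∈ K, x'' u = (x' + w) u) (hout : ∀ u ∉ K, x'' u = 0)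
    (hK : (∀ u ∉ K, (x' + w) u = 0) ∨
      (K.card = k ∧ ∀ u ∈ K, ∀ u' ∉ K, |(x' + w) u'| ≤ |(x' + w) u| + M / 2 ^ (n + 4))) :
    l1 (x - x'') ≤ l1 (x - x') / 2 + 65 * l1 (x - headApprox k x) := by
  classical
  set E := l1 (x - x')
  set τ := l1 (x - headApprox k x)
  -- Budget: the medians err by `4 * (E/64 + 8τ) + M/8 ≤ 3E/16 + 32τ`. Selection costs this once
  -- more, plus `τ` and `M/16`. The total is at most `7E/16 + 65τ`.
  have h1 := l1_median_sub_le hW (fun i => estimate h (x - x') (t i)) w (x - x') _ (E / 64 + 8 * τ)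
    hw (Finset.univ.filter fun i => l1 (x - x' - estimate h (x - x') (t i)) ≤ E / 64 + 8 * τ)
    (by rw [Finset.compl_filter]; exact hbad) fun i hi => (Finset.mem_filter.1 hi).2
  have h2 := l1_sub_selected_le (x' + w) x'' (headApprox k x) K _ (by positivity) hin hout
    (isSparse_headApprox k x) hK
  have hp : (0 : ℝ) < 2 ^ n := by positivity
  have hk' : (k : ℝ) ≤ 2 ^ n := by exact_mod_cast hkn
  have e1 : 2 * M / 2 ^ (n + 4) * (Fintype.card (F2 n) : ℝ) = M / 8 := by
    have : (Fintype.card (F2 n) : ℝ) = 2 ^ n := by simp [ZMod.card]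
    rw [this, pow_add]
    field_simp
    ring
  have e2 : k * (M / 2 ^ (n + 4)) ≤ M / 16 := by
    calc k * (M / 2 ^ (n + 4)) ≤ 2 ^ n * (M / 2 ^ (n + 4)) := by gcongr
      _ = M / 16 := by rw [pow_add]; field_simp; norm_num
  rw [e1] at h1
  have h3 : l1 (x - (x' + w)) = l1 (w - (x - x')) := by
    rw [l1_sub_comm w, sub_sub]
  have h4 := l1_sub_le x (x' + w) x''
  have h5 := l1_sub_le (x' + w) x (headApprox k x)
  rw [l1_sub_comm (x' + w) x] at h5
  change l1 (x' + w - headApprox k x) ≤ _ + τ at h5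
  linarith

end Progress

/-! ## Binary encodings -/

theorem encode_succ {m : ℕ} (v : F2 (m + 1)) :
    encode v = (v 0).val + 2 * encode fun i => v i.succ := by
  simp only [encode, Fin.sum_univ_succ, Finset.mul_sum, Fin.val_zero, pow_zero, mul_one,
    Fin.val_succ, pow_succ]
  congr 1
  exact Finset.sum_congr rfl fun i _ => by ring

theorem encode_lt {m : ℕ} (v : F2 m) : encode v < 2 ^ m := by
  induction m with
  | zero => simp [encode]
  | succ m ih =>
    have h1 := ih fun i => v i.succ
    have h2 : (v 0).val < 2 := ZMod.val_lt (v 0)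
    rw [encode_succ, pow_succ]
    omega

theorem decode_encode {m : ℕ} (v : F2 m) : decode m (encode v) = v := by
  induction m with
  | zero => exact Subsingleton.elim _ _
  | succ m ih =>
    have h0 : (v 0).val < 2 := ZMod.val_lt (v 0)
    funext i
    refine Fin.cases ?_ (fun i => ?_) i
    · simp [decode, encode_succ, show (2 : ZMod 2) = 0 from rfl]
    · have h1 := congrFun (ih fun i => v i.succ) i
      simp only [decode] at h1 ⊢
      rw [encode_succ, Fin.val_succ, pow_succ', ← Nat.div_div_eq_div_mul,
        show ((v 0).val + 2 * encode fun i => v i.succ) / 2 = encode fun i => v i.succ by omega]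
      exact h1

theorem encode_decode {m w : ℕ} (hw : w < 2 ^ m) : encode (decode m w) = w := by
  induction m generalizing w with
  | zero => simp [encode]; omega
  | succ m ih =>
    have h1 : (fun i : Fin m => decode (m + 1) w i.succ) = decode m (w / 2) := by
      funext i
      simp only [decode, Fin.val_succ, pow_succ']
      rw [Nat.div_div_eq_div_mul]
    rw [encode_succ, h1, ih (by rw [pow_succ] at hw; omega)]
    simp only [decode, Fin.val_zero, pow_zero, Nat.div_one, ZMod.val_natCast]
    omega

theorem encode_injective {m : ℕ} : Function.Injective (encode : F2 m → ℕ) :=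
  Function.LeftInverse.injective decode_encode

theorem encode_eq_iff {m w : ℕ} (hw : w < 2 ^ m) (v : F2 m) : encode v = w ↔ v = decode m w :=
  ⟨fun h => by rw [← h, decode_encode], fun h => by rw [h, encode_decode hw]⟩

theorem decode_inj {m w w' : ℕ} (hw : w < 2 ^ m) (hw' : w' < 2 ^ m)
    (h : decode m w = decode m w') : w = w' := by
  rw [← encode_decode hw, h, encode_decode hw']

theorem val_decode {m : ℕ} (w : ℕ) (i : Fin m) :
    (decode m w i).val = w / 2 ^ (i : ℕ) % 2 := by
  rw [decode, ZMod.val_natCast]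

/-! ## Memory layout -/

notation "wCnt" => 1
notation "wPos" => 2
notation "wBins" => 10
notation "wSize" => 11
notation "wPass" => 12
notation "wBlocks" => 13
notation "wHalf" => 14
notation "wWidth" => 15
notation "wSeed" => 16
notation "wB" => 20
notation "wI" => 21
notation "wJ" => 22
notation "wE" => 23
notation "wBit" => 24
notation "wQ" => 25
notation "wQi" => 26
notation "wTBase" => 30
notation "wRow" => 31
notation "wFirst" => 32
notation "wOff" => 33
notation "wU" => 34
notation "wPow" => 35
notation "wBin" => 36
notation "wRem" => 37
notation "wCount" => 38
notation "wLen" => 39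
notation "wTouch" => 40
notation "wList" => 41
notation "wItems" => 42
notation "wKappa" => 43
notation "rVal" => 1
notation "rY" => 10
notation "rBit" => 11
notation "rEst" => 12
notation "rVec" => 13
notation "rTmp" => 14
notation "rMax" => 15
notation "rLo" => 16
notation "rHi" => 17
notation "rMid" => 18
notation "rNum" => 19
notation "rFrac" => 20

infixr:60 " ;; " => Program.seq

/-- Assignment to a word variable. -/
abbrev letW (a : ℕ) (e : WExp) : Program Instr := .setWord a (.lit 0) e

/-- Assignment to a real variable. -/
abbrev letR (a : ℕ) (e : RExp) : Program Instr := .setReal a (.lit 0) e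

/-- Replace the word variable `a` by the sum of it and `e`. -/
abbrev incW (a : ℕ) (e : WExp) : Program Instr := letW a (.add (.var a) e)

variable {H : Instr → State → State → ℕ → Prop} [LocalInstr H]

/-! ## Bisection for a quantile -/

/-- Bisection of the interval from `rLo` to `rHi`: the lower end is moved to the middle if at
least `wKappa` of the first `wItems` entries of `rTmp` are not below the middle. -/
def bisect : Program Instr :=
  forLoop wQ (.var wPass)
    (letR rMid (.div (.add (.var rLo) (.var rHi)) (.lit 2)) ;;
     letW wCount (.lit 0) ;;
     forLoop wQi (.var wItems)
       (.ite (.leReal (.var rMid) (.read rTmp (.var wQi))) (incW wCount (.lit 1)) .skip) ;;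
     .ite (.leWord (.var wKappa) (.var wCount)) (letR rLo (.var rMid)) (letR rHi (.var rMid)))

open Classical in
/-- The number of the first `m` entries of `g` that are at least `b`. -/
def countGe (g : ℕ → ℝ) (m : ℕ) (b : ℝ) : ℕ := ((Finset.range m).filter fun i => b ≤ g i).card

theorem countGe_succ (g : ℕ → ℝ) (m : ℕ) (b : ℝ) :
    countGe g (m + 1) b = countGe g m b + if b ≤ g m then 1 else 0 := by
  classical
  rw [countGe, countGe, Finset.range_add_one, Finset.filter_insert]
  split_ifs
  · rw [Finset.card_insert_of_notMem (by simp)]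
  · simp

/-- The result of a bisection of `[lo₀, hi₀]` with `p` passes. -/
structure Bisected (g : ℕ → ℝ) (m κ p : ℕ) (lo₀ hi₀ lo hi : ℝ) : Prop where
  width : hi - lo = (hi₀ - lo₀) / 2 ^ p
  lo_ge : lo₀ ≤ lo
  hi_le : hi ≤ hi₀
  lo_count : lo = lo₀ ∨ κ ≤ countGe g m lo
  hi_count : hi = hi₀ ∨ countGe g m hi < κ

/-- Only an end that has moved carries information on counts. An end left at its initial value is
handled by each application, through the choice of an interval that contains the data up to
tolerable exceptions. -/
theorem run_bisect (s : State) (hlo : s.real rLo 0 ≤ s.real rHi 0) :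
    Run H bisect s (forCost (s.word wPass 0) (forCost (s.word wItems 0) 30 2 + 40) 2) fun s' =>
      Bisected (s.real rTmp) (s.word wItems 0) (s.word wKappa 0) (s.word wPass 0)
        (s.real rLo 0) (s.real rHi 0) (s'.real rLo 0) (s'.real rHi 0) := by
  refine Run.for (I := fun p s' =>
    Bisected (s.real rTmp) (s.word wItems 0) (s.word wKappa 0) p
        (s.real rLo 0) (s.real rHi 0) (s'.real rLo 0) (s'.real rHi 0)) (by decide) ?_ ?_ ?_
  · intro s' hf
    simp [hf.word wPass]
  · constructor <;> simp
  intro p hp s' hf hv hI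
  refine (Run.seqF (B₁ := 10) (R := fun t => t.real rMid 0 = (s'.real rLo 0 + s'.real rHi 0) / 2)
    (Run.straight (by simp [Program.effect])) (B₂ := forCost (s.word wItems 0) 30 2 + 30)
    fun s₁ hf₁ h₁ => ?_).mono (by omega) fun _ h => h
  refine (Run.seqF (B₁ := 5) (R := fun t => t.word wCount 0 = 0)
    (Run.straight (by simp [Program.effect])) (B₂ := forCost (s.word wItems 0) 30 2 + 25)
    fun s₂ hf₂ h₂ => ?_).mono (by omega) fun _ h => h
  refine Run.seqF (B₁ := forCost (s.word wItems 0) 30 2) (R := fun t =>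
      t.word wCount 0 = countGe (s.real rTmp) (s.word wItems 0) (s₁.real rMid 0))
    (Run.for (I := fun i t => t.word wCount 0 = countGe (s.real rTmp) i (s₁.real rMid 0))
      (by decide) ?_ ?_ ?_)
    (B₂ := 25) fun s₃ hf₃ h₃ => ?_
  · intro t ht
    simp [ht.word wItems, hf₂.word wItems, hf₁.word wItems, hf.word wItems]
  · simp [h₂, countGe]
  · intro i hi t ht hvt hIt
    have e1 : t.real rMid = s₁.real rMid := by rw [ht.real rMid, hf₂.real rMid]
    have e2 : t.real rTmp = s.real rTmp := by
      rw [ht.real rTmp, hf₂.real rTmp, hf₁.real rTmp, hf.real rTmp]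
    refine Run.straight ?_
    simp only [Program.effect, Test.holds, RExp.eval, WExp.eval, e1, e2, hvt, countGe_succ]
    split_ifs <;> simp [hIt]
  · have e1 : s₃.real rMid 0 = (s'.real rLo 0 + s'.real rHi 0) / 2 := by
      rw [hf₃.real rMid, hf₂.real rMid, h₁]
    have e2 : s₃.real rLo = s'.real rLo := by
      rw [hf₃.real rLo, hf₂.real rLo, hf₁.real rLo]
    have e3 : s₃.real rHi = s'.real rHi := by
      rw [hf₃.real rHi, hf₂.real rHi, hf₁.real rHi]
    have e4 : s₃.word wKappa = s.word wKappa := by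
      rw [hf₃.word wKappa, hf₂.word wKappa, hf₁.word wKappa, hf.word wKappa]
    rw [h₁] at h₃
    have hw : s'.real rLo 0 ≤ s'.real rHi 0 := by
      have h5 := hI.width
      have : 0 ≤ (s.real rHi 0 - s.real rLo 0) / 2 ^ p := by
        have : 0 ≤ s.real rHi 0 - s.real rLo 0 := by linarith
        positivity
      linarith
    have hwid := hI.width
    have hl := hI.lo_ge
    have hh := hI.hi_le
    refine Run.straight ?_
    simp only [Program.effect, Test.holds, RExp.eval, WExp.eval, e4, h₃]
    split_ifs with hc
    · constructor
      · simp only [real_setWord, real_setReal, e1, e3]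
        simp [pow_succ, ← div_div, ← hwid]; ring
      · simp [e1]; linarith
      · simp [e3, hh]
      · right; simpa [e1] using hc
      · simpa [e3] using hI.hi_count
    · constructor
      · simp only [real_setWord, real_setReal, e1, e2]
        simp [pow_succ, ← div_div, ← hwid]; ring
      · simp [e2, hl]
      · simp [e1]; linarith
      · simpa [e2] using hI.lo_count
      · right; simpa [e1] using hc

/-! ## Access to the sketches and to the condenser -/

/-- The additional instructions for the sketches of `x`. -/
abbrev Sem {n r D : ℕ} (k : ℕ) (Q : Program Empty) (h : F2 n → Fin D → F2 r) (x : F2 n → ℝ)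
    (ω : ℕ → Fin D) : Instr → State → State → ℕ → Prop :=
  InstrStep k Q ((graphMatrix h).mulVec x) ((rowTensor (graphMatrix h) (bitMatrix n)).mulVec x) ω

section Access

variable {n r D k : ℕ} {Q : Program Empty} {h : F2 n → Fin D → F2 r} {x : F2 n → ℝ}
  {ω : ℕ → Fin D}

theorem lookup_eq (t : Fin D) (j : ℕ) :
    lookup ((graphMatrix h).mulVec x) j t = binSum h x t (decode r j) := by
  rw [lookup, dif_pos t.2, binSum]
  simp [graphMatrix, Matrix.mulVec, dotProduct]

theorem lookupBit_eq (t : Fin D) (j : ℕ) (i : Fin n) :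
    lookupBit ((rowTensor (graphMatrix h) (bitMatrix n)).mulVec x) j t i =
      binBitSum h x t (decode r j) i := by
  rw [lookupBit, dif_pos t.2, dif_pos i.2, binBitSum]
  simp [graphMatrix, rowTensor, bitMatrix, Matrix.mulVec, dotProduct, mul_comm]

theorem run_call {F : ℕ} (hQ : ComputesWithin Q k h F) {s : State} {a : ℕ} {i u t : WExp}
    (u₀ : F2 n) (t₀ : Fin D) (hu : u.eval s = encode u₀) (ht : t.eval s = t₀) :
    Run (Sem k Q h x ω) (.special (.call a i u t)) s (1 + i.cost + u.cost + t.cost + F)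
      fun s' => s' = s.setWord a (i.eval s) (encode (h u₀ t₀)) := by
  obtain ⟨s', T, hT, he, hs'⟩ := hQ u₀ t₀
  rw [← hu, ← ht] at he
  exact Run.special (.call a i u t s s' T he) (by omega) (by rw [hs'])

theorem binSum_sub_single (z : F2 n → ℝ) (u : F2 n) (v : ℝ) (t : Fin D) (j : F2 r) :
    binSum h (z - Pi.single u v) t j = binSum h z t j - if h u t = j then v else 0 := by
  classical
  have e : (if h u t = j then v else 0) =
      ∑ w, if w = u then (if h u t = j then v else 0) else 0 := by simp
  rw [eq_sub_iff_add_eq, e, binSum, binSum, ← Finset.sum_add_distrib]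
  refine Finset.sum_congr rfl fun w _ => ?_
  by_cases hw : w = u
  · subst hw
    by_cases h' : h w t = j <;> simp [h']
  · simp [hw]

theorem binBitSum_sub_single (z : F2 n → ℝ) (u : F2 n) (v : ℝ) (t : Fin D) (j : F2 r)
    (i : Fin n) :
    binBitSum h (z - Pi.single u v) t j i =
      binBitSum h z t j i - if h u t = j ∧ (u i).val = 1 then v else 0 := by
  -- A bit sum is the bin sum of the vector masked by that bit, so the rule for bin sums applies.
  have e : ∀ z : F2 n → ℝ, binBitSum h z t j i =
      binSum h (fun u => z u * ((u i).val : ℝ)) t j := fun _ => rfl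
  have e2 : (fun w => (z - Pi.single u v : F2 n → ℝ) w * ((w i).val : ℝ)) =
      (fun w => z w * ((w i).val : ℝ)) - Pi.single u (v * ((u i).val : ℝ)) := by
    funext w
    by_cases hw : w = u
    · subst hw; simp; ring
    · simp [hw]
  rw [e, e2, binSum_sub_single, ← e]
  have : (u i).val < 2 := ZMod.val_lt (u i)
  obtain h0 | h1 : (u i).val = 0 ∨ (u i).val = 1 := by omega
  · simp [h0]
  · simp [h1]

end Access

/-! ### Bins of the residual in memory -/

/-- The vector with the listed positions and values. -/
def listVec (n : ℕ) (m : ℕ) (pos : ℕ → ℕ) (val : ℕ → ℝ) : F2 n → ℝ :=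
  ∑ i ∈ Finset.range m, Pi.single (decode n (pos i)) (val i)

theorem sub_listVec_succ {n : ℕ} (x : F2 n → ℝ) (m : ℕ) (pos : ℕ → ℕ) (val : ℕ → ℝ) :
    x - listVec n (m + 1) pos val =
      x - listVec n m pos val - Pi.single (decode n (pos m)) (val m) := by
  rw [listVec, listVec, Finset.sum_range_succ, sub_sub]

/-- The contents of the memory that do not change after the preparations. -/
structure Env (n k r θ : ℕ) (s : State) : Prop where
  n_eq : s.word 0 0 = n
  k_eq : s.word 0 1 = k
  bins : s.word wBins 0 = 2 ^ r
  size : s.word wSize 0 = 2 ^ n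
  pass : s.word wPass 0 = n + 4
  half : s.word wHalf 0 = θ
  width : s.word wWidth 0 = 2 * θ

theorem Env.mono {n k r θ : ℕ} {s s' : State} (he : Env n k r θ s) {ws rs : List ℕ} {d : Bool}
    (hf : FrameOn ws rs d s s')
    (hw : ∀ a ∈ [0, wBins, wSize, wPass, wHalf, wWidth], a ∉ ws := by decide) :
    Env n k r θ s' := by
  constructor
  · rw [hf.word_eq 0 (hw _ (by simp)), he.n_eq]
  · rw [hf.word_eq 0 (hw _ (by simp)), he.k_eq]
  · rw [hf.word_eq _ (hw wBins (by simp)), he.bins]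
  · rw [hf.word_eq _ (hw wSize (by simp)), he.size]
  · rw [hf.word_eq _ (hw wPass (by simp)), he.pass]
  · rw [hf.word_eq _ (hw wHalf (by simp)), he.half]
  · rw [hf.word_eq _ (hw wWidth (by simp)), he.width]

/-- `a` and `b` hold the bins of `z` for the seed `t`. -/
structure HoldsBins {n r D : ℕ} (h : F2 n → Fin D → F2 r) (z : F2 n → ℝ) (t : Fin D)
    (a b : ℕ → ℝ) : Prop where
  sum_eq : ∀ j < 2 ^ r, a j = binSum h z t (decode r j)
  bit_eq : ∀ (i : Fin n), ∀ j < 2 ^ r, b (i * 2 ^ r + j) = binBitSum h z t (decode r j) i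

/-- Read the bins of the sketched vector for the seed in `wSeed`. -/
def loadBins : Program Instr :=
  forLoop wJ (.var wBins) (.special (.query rY (.var wJ) (.var wJ) (.var wSeed))) ;;
  letW wOff (.lit 0) ;;
  forLoop wBit (.read 0 (.lit 0))
    (forLoop wJ (.var wBins)
      (.special (.queryBit rBit (.add (.var wOff) (.var wJ)) (.var wJ) (.var wSeed)
        (.var wBit))) ;;
     incW wOff (.var wBins))

/-- Subtract the listed vector from the bins. -/
def subtractList : Program Instr :=
  forLoop wE (.var wCnt)
    (letW wU (.read wPos (.var wE)) ;;
     .special (.call wBin (.lit 0) (.var wU) (.var wSeed)) ;;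
     .setReal rY (.var wBin) (.sub (.read rY (.var wBin)) (.read rVal (.var wE))) ;;
     letW wRem (.var wU) ;;
     letW wOff (.lit 0) ;;
     forLoop wBit (.read 0 (.lit 0))
      (.ite (.leWord (.add (.add (.half (.var wRem)) (.half (.var wRem))) (.lit 1)) (.var wRem))
        (.setReal rBit (.add (.var wOff) (.var wBin))
          (.sub (.read rBit (.add (.var wOff) (.var wBin))) (.read rVal (.var wE)))) .skip ;;
       letW wRem (.half (.var wRem)) ;;
       incW wOff (.var wBins)))

/-- Decode the content of bin `wJ`. -/
def searchBin : Program Instr :=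
  letW wU (.lit 0) ;; letW wPow (.lit 1) ;; letW wOff (.lit 0) ;;
  forLoop wBit (.read 0 (.lit 0))
    (.ite (.leReal (.mul (.read rY (.var wJ)) (.read rY (.var wJ)))
        (.mul (.lit 4) (.mul (.read rBit (.add (.var wOff) (.var wJ)))
          (.read rBit (.add (.var wOff) (.var wJ))))))
      (incW wU (.var wPow)) .skip ;;
     incW wPow (.var wPow) ;;
     incW wOff (.var wBins))

theorem mul_add_inj {R i j i' j' : ℕ} (hj : j < R) (hj' : j' < R) :
    i * R + j = i' * R + j' ↔ i = i' ∧ j = j' := by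
  constructor
  · intro e
    have h1 : (i * R + j) / R = (i' * R + j') / R := by rw [e]
    have hR : 0 < R := by omega
    rw [add_comm, Nat.add_mul_div_right _ _ hR, Nat.div_eq_of_lt hj, add_comm (i' * R),
      Nat.add_mul_div_right _ _ hR, Nat.div_eq_of_lt hj'] at h1
    have : i = i' := by omega
    subst this
    exact ⟨rfl, by omega⟩
  · rintro ⟨rfl, rfl⟩; rfl

section Bins

variable {n r D k θ : ℕ} {Q : Program Empty} {h : F2 n → Fin D → F2 r} {x : F2 n → ℝ}
  {ω : ℕ → Fin D}

/-- The bit sums form a table with cell `i * 2 ^ r + j` for bit `i` and bin `j`. Words cannot be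
multiplied, so the row offset is carried along by repeated addition. -/
theorem run_loadBins {s : State} (he : Env n k r θ s) (t : Fin D) (ht : s.word wSeed 0 = t) :
    Run (Sem k Q h x ω) loadBins s
      (forCost (2 ^ r) 10 2 + (5 + forCost n (forCost (2 ^ r) 20 2 + 10) 2))
      fun s' => HoldsBins h x t (s'.real rY) (s'.real rBit) := by
  refine Run.seqF (R := fun s' => ∀ j < 2 ^ r, s'.real rY j = binSum h x t (decode r j))
    (Run.for (I := fun m s' => ∀ j < m, s'.real rY j = binSum h x t (decode r j))
      (by decide) ?_ ?_ ?_) fun s₁ hf₁ h₁ => ?_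
  · intro s' hf
    simp [hf.word wBins, he.bins]
  · simp
  · intro m hm s' hf hv hI
    refine Run.special (.query _ _ _ _ _) (by decide) ?_
    intro j hj
    simp only [WExp.eval, hv, hf.word wSeed, ht, lookup_eq, real_setWord, real_setReal, if_true,
      Function.update_apply]
    split_ifs with hjm
    · rw [hjm]
    · exact hI j (by omega)
  have ht₁ : s₁.word wSeed 0 = t := by rw [hf₁.word wSeed, ht]
  refine Run.seqF (B₁ := 5) (R := fun t => t.word wOff 0 = 0)
    (Run.straight (by simp [Program.effect])) fun s₂ hf₂ h₂ => ?_
  have ht₂ : s₂.word wSeed 0 = t := by rw [hf₂.word wSeed, ht₁]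
  have he₂ : Env n k r θ s₂ := (he.mono hf₁).mono hf₂
  have e₂ : s₂.real rY = s₁.real rY := hf₂.real rY
  rw [← e₂] at h₁
  refine (Run.for (I := fun m s' => s'.word wOff 0 = m * 2 ^ r ∧ ∀ (i : Fin n), (i : ℕ) < m →
      ∀ j < 2 ^ r, s'.real rBit (i * 2 ^ r + j) = binBitSum h x t (decode r j) i)
    (by decide) ?_ ?_ ?_).frame.mono le_rfl ?_
  · intro s' hf
    simp [hf.word 0, he₂.n_eq]
  · simp [h₂]
  · rintro m hm s' hf hv ⟨hoff, hI⟩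
    refine Run.seqF (R := fun s' => (∀ (i : Fin n), (i : ℕ) < m →
      ∀ j < 2 ^ r, s'.real rBit (i * 2 ^ r + j) = binBitSum h x t (decode r j) i) ∧
      ∀ j < 2 ^ r, s'.real rBit (m * 2 ^ r + j) = binBitSum h x t (decode r j) ⟨m, hm⟩)
      (Run.for (I := fun l s' => (∀ (i : Fin n), (i : ℕ) < m →
      ∀ j < 2 ^ r, s'.real rBit (i * 2 ^ r + j) = binBitSum h x t (decode r j) i) ∧
      ∀ j < l, s'.real rBit (m * 2 ^ r + j) = binBitSum h x t (decode r j) ⟨m, hm⟩)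
      (by decide) ?_ ?_ ?_) fun s₃ hf₃ h₃ => ?_
    · intro s' hf'
      simp [hf'.word wBins, hf.word wBins, he₂.bins]
    · exact ⟨hI, by simp⟩
    · rintro l hl s₃ hf₃ hv₃ ⟨hI₃, hI₃'⟩
      refine Run.special (.queryBit _ _ _ _ _ _) (by decide) ?_
      simp only [WExp.eval, hv₃, hf₃.word wSeed, hf.word wSeed, ht₂, hf₃.word wOff, hoff,
        hf₃.word wBit, hv, lookupBit_eq t l ⟨m, hm⟩, real_setWord, real_setReal, if_true,
        Function.update_apply]
      constructor
      · intro i hi j hj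
        rw [if_neg, hI₃ i hi j hj]
        rw [mul_add_inj hj hl]
        omega
      · intro j hj
        split_ifs with hjl
        · rw [show j = l by omega]
        · exact hI₃' j (by omega)
    · refine Run.straight ?_
      simp only [Program.effect, WExp.eval]
      refine ⟨?_, ?_⟩
      · simp [hf₃.word wOff, hoff, hf₃.word wBins, hf.word wBins, he₂.bins, add_mul]
      · intro i hi j hj
        simp only [real_setWord]
        rcases Nat.lt_succ_iff_lt_or_eq.1 hi with h' | h'
        · exact h₃.1 i h' j hj
        · subst h'; exact h₃.2 j hj
  · rintro s' ⟨hf, -, hI⟩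
    refine ⟨fun j hj => ?_, fun i j hj => hI i i.2 j hj⟩
    rw [hf.real rY, h₁ j hj]

/-- Parity expressed with halving, addition and comparison, the word operations at hand. -/
theorem half_odd_iff (w : ℕ) : w / 2 + w / 2 + 1 ≤ w ↔ w % 2 = 1 := by omega

/-- By linearity each listed entry is removed separately: one call of the subroutine names its bin,
and repeated halving of the position shows which bit sums contain it. Positions must be below `2 ^
n` for the word to agree with the element it encodes. -/
theorem run_subtractList {F : ℕ} (hQ : ComputesWithin Q k h F) {s : State} (he : Env n k r θ s)
    (t : Fin D) (ht : s.word wSeed 0 = t) (hpos : ∀ e < s.word wCnt 0, s.word wPos e < 2 ^ n)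
    (hb : HoldsBins h x t (s.real rY) (s.real rBit)) :
    Run (Sem k Q h x ω) subtractList s
      (forCost (s.word wCnt 0) (F + forCost n 60 2 + 50) 2)
      fun s' => HoldsBins h (x - listVec n (s.word wCnt 0) (s.word wPos) (s.real rVal)) t
        (s'.real rY) (s'.real rBit) := by
  refine (Run.for (I := fun m s' =>
    HoldsBins h (x - listVec n m (s.word wPos) (s.real rVal)) t
        (s'.real rY) (s'.real rBit)) (by decide) ?_ ?_ ?_)
  · intro s' hf
    simp [hf.word wCnt]
  · simpa [listVec] using hb
  intro m hm s' hf hv hI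
  set z := x - listVec n m (s.word wPos) (s.real rVal) with hz
  set u := decode n (s.word wPos m) with hu
  have hum : encode u = s.word wPos m := encode_decode (hpos m hm)
  have het := he.mono hf
  refine (Run.seqF (B₁ := 10) (B₂ := F + forCost n 60 2 + 40) (R := fun t => t.word wU 0 = encode u)
    (Run.straight (by simp [Program.effect, hv, hf.word wPos, hum])) fun s₁ hf₁ h₁ => ?_).mono
    (by omega) fun _ h => h
  have ht₁ : s₁.word wSeed 0 = t := by rw [hf₁.word wSeed, hf.word wSeed, ht]
  refine (Run.seqF (B₁ := 1 + 1 + 2 + 2 + F) (B₂ := forCost n 60 2 + 34)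
    (run_call hQ u t (by simp [h₁]) (by simp [ht₁])) fun s₂ hf₂ h₂ => ?_).mono
    (by omega) fun _ h => h
  have hw₂ : s₂.word wBin 0 = encode (h u t) := by simp [h₂]
  have hE : s₂.word wE 0 = m := by rw [hf₂.word wE, hf₁.word wE, hv]
  have hY : s₂.real rY = s'.real rY := by rw [hf₂.real rY, hf₁.real rY]
  have hV : s₂.real rVal = s.real rVal := by rw [hf₂.real rVal, hf₁.real rVal, hf.real rVal]
  refine (Run.seqF (B₁ := 12) (B₂ := forCost n 60 2 + 22)
    (R := fun a => ∀ j < 2 ^ r, a.real rY j =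
      binSum h (x - listVec n (m + 1) (s.word wPos) (s.real rVal)) t (decode r j))
    (Run.straight ?_) fun s₃ hf₃ h₃ => ?_).mono (by omega) fun _ h => h
  · intro j hj
    simp only [Program.effect, WExp.eval, RExp.eval, hw₂, hE, hY, hV, real_setReal, if_true,
      Function.update_apply]
    rw [sub_listVec_succ, ← hz, ← hu, binSum_sub_single, hI.sum_eq j hj,
      -- The program changes the single cell `encode (h u t)`; encoding and decoding identify it
      -- with the single bin from which the entry must be subtracted.
      hI.sum_eq _ (encode_lt _), decode_encode]
    by_cases hj' : j = encode (h u t)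
    · rw [if_pos hj', hj', decode_encode, if_pos rfl]
    · rw [if_neg hj', if_neg, sub_zero]
      intro h'
      exact hj' (by rw [h', encode_decode hj])
  refine (Run.seqF (B₁ := 6) (B₂ := forCost n 60 2 + 16) (R := fun t => t.word wRem 0 = encode u)
    (Run.straight (by simp [Program.effect, hf₃.word wU, hf₂.word wU, h₁])) fun s₄ hf₄ h₄ => ?_).mono
    (by omega) fun _ h => h
  refine (Run.seqF (B₁ := 5) (B₂ := forCost n 60 2 + 11) (R := fun t => t.word wOff 0 = 0)
    (Run.straight (by simp [Program.effect])) fun s₅ hf₅ h₅ => ?_).mono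
    (by omega) fun _ h => h
  have het₅ : Env n k r θ s₅ := ((((het.mono hf₁).mono hf₂).mono hf₃).mono hf₄).mono hf₅
  have hbit₅ : s₅.real rBit = s'.real rBit := by
    rw [hf₅.real rBit, hf₄.real rBit, hf₃.real rBit, hf₂.real rBit, hf₁.real rBit]
  have hE₅ : s₅.word wE 0 = m := by
    rw [hf₅.word wE, hf₄.word wE, hf₃.word wE, hE]
  have hV₅ : s₅.real rVal = s.real rVal := by
    rw [hf₅.real rVal, hf₄.real rVal, hf₃.real rVal, hV]
  have hw₅ : s₅.word wBin 0 = encode (h u t) := by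
    rw [hf₅.word wBin, hf₄.word wBin, hf₃.word wBin, hw₂]
  have hY₅ : s₅.real rY = s₃.real rY := by rw [hf₅.real rY, hf₄.real rY]
  refine (Run.for (N := n) (B := 60) (I := fun l a => a.word wOff 0 = l * 2 ^ r ∧
      a.word wRem 0 = encode u / 2 ^ l ∧
      ∀ (i : Fin n), ∀ j < 2 ^ r, a.real rBit (i * 2 ^ r + j) =
        binBitSum h z t (decode r j) i -
          if (i : ℕ) < l ∧ h u t = decode r j ∧ (u i).val = 1 then s.real rVal m else 0)
    (by decide) ?_ ?_ ?_).frame.mono (by simp) ?_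
  · intro a hfa
    simp [hfa.word 0, het₅.n_eq]
  · refine ⟨by simp [h₅], by simp [hf₅.word wRem, h₄], fun i j hj => ?_⟩
    simp [hbit₅, hI.bit_eq i j hj]
  · rintro l hl a hfa hva ⟨hoff, hrem, hIa⟩
    have hbl : (u ⟨l, hl⟩).val = encode u / 2 ^ l % 2 := by
      rw [hum, hu, val_decode]
    refine Run.straight ?_
    simp only [Program.effect, WExp.eval, RExp.eval, Test.holds, hrem, hoff, hfa.word wBin, hw₅,
      hfa.word wE, hE₅, hfa.real rVal, hV₅, half_odd_iff, ← hbl]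
    refine ⟨?_, ?_, ?_⟩
    · split_ifs <;> simp [hoff, hfa.word wBins, het₅.bins, add_mul]
    · split_ifs <;> simp [hrem, pow_succ, Nat.div_div_eq_div_mul]
    · intro i j hj
      have hi := hIa i j hj
      by_cases hc : (u ⟨l, hl⟩).val = 1
      · have hi2 := hIa ⟨l, hl⟩ (encode (h u t)) (encode_lt _)
        simp only [hc, if_true, real_setWord, real_setReal, Function.update_apply,
          mul_add_inj hj (encode_lt (h u t)), hi]
        simp only [lt_irrefl, false_and, if_false, sub_zero] at hi2
        rw [hi2]
        by_cases hil : (i : ℕ) = l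
        · have hil' : i = ⟨l, hl⟩ := Fin.ext hil
          subst hil'
          by_cases hj' : j = encode (h u t)
          · simp [hj', decode_encode, hc]
          · have : h u t ≠ decode r j := fun h' => hj' (by rw [h', encode_decode hj])
            simp [hj', this]
        · have : ((i : ℕ) < l + 1) ↔ (i : ℕ) < l := by omega
          simp [hil, this]
      · rw [if_neg hc]
        simp only [real_setWord, hi]
        have : ((i : ℕ) < l + 1 ∧ h u t = decode r j ∧ (u i).val = 1) ↔
            ((i : ℕ) < l ∧ h u t = decode r j ∧ (u i).val = 1) := by
          constructor
          · rintro ⟨h1, h2, h3⟩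
            refine ⟨?_, h2, h3⟩
            rcases Nat.lt_succ_iff_lt_or_eq.1 h1 with h' | h'
            · exact h'
            · subst h'; exact absurd h3 hc
          · rintro ⟨h1, h2⟩; exact ⟨by omega, h2⟩
        simp only [this]
  · rintro a ⟨hfa, -, -, hIa⟩
    refine ⟨fun j hj => ?_, fun i j hj => ?_⟩
    · simp only [real_setWord]
      rw [hfa.real rY, hY₅, h₃ j hj]
    · simp only [real_setWord]
      rw [hIa i j hj, sub_listVec_succ, ← hz, ← hu, binBitSum_sub_single]
      simp [i.2]

theorem run_searchBin {s : State} (he : Env n k r θ s) {z : F2 n → ℝ}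
    (t : Fin D) (hb : HoldsBins h z t (s.real rY) (s.real rBit)) {j : ℕ} (hj : j < 2 ^ r)
    (hJ : s.word wJ 0 = j) :
    Run (Sem k Q h x ω) searchBin s (15 + forCost n 60 2)
      fun s' => s'.word wU 0 = encode (found h z t (decode r j)) := by
  classical
  set v := found h z t (decode r j) with hv
  refine (Run.seqF (B₁ := 5) (B₂ := 10 + forCost n 60 2) (R := fun a => a.word wU 0 = 0)
    (Run.straight (by simp [Program.effect])) fun s₁ hf₁ h₁ => ?_).mono
    (by omega) fun _ h => h
  refine (Run.seqF (B₁ := 5) (B₂ := 5 + forCost n 60 2) (R := fun a => a.word wPow 0 = 1)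
    (Run.straight (by simp [Program.effect])) fun s₂ hf₂ h₂ => ?_).mono
    (by omega) fun _ h => h
  refine (Run.seqF (B₁ := 5) (B₂ := forCost n 60 2) (R := fun a => a.word wOff 0 = 0)
    (Run.straight (by simp [Program.effect])) fun s₃ hf₃ h₃ => ?_).mono
    (by omega) fun _ h => h
  have he₃ : Env n k r θ s₃ := ((he.mono hf₁).mono hf₂).mono hf₃
  have eY : s₃.real rY = s.real rY := by rw [hf₃.real rY, hf₂.real rY, hf₁.real rY]
  have eB : s₃.real rBit = s.real rBit := by rw [hf₃.real rBit, hf₂.real rBit, hf₁.real rBit]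
  have eJ : s₃.word wJ 0 = j := by rw [hf₃.word wJ, hf₂.word wJ, hf₁.word wJ, hJ]
  have eU : s₃.word wU 0 = 0 := by rw [hf₃.word wU, hf₂.word wU, h₁]
  have eP : s₃.word wPow 0 = 1 := by rw [hf₃.word wPow, h₂]
  refine (Run.for (N := n) (B := 60) (I := fun l a => a.word wOff 0 = l * 2 ^ r ∧ a.word wPow 0 = 2 ^ l ∧
      a.word wU 0 = ∑ i ∈ Finset.range l, if hi : i < n then (v ⟨i, hi⟩).val * 2 ^ i else 0)
    (by decide) ?_ ?_ ?_).mono (by simp) ?_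
  · intro a hfa
    simp [hfa.word 0, he₃.n_eq]
  · simp [h₃, eU, eP]
  · rintro l hl a hfa hva ⟨hoff, hpow, hU⟩
    refine Run.straight ?_
    have hbit := hb.bit_eq ⟨l, hl⟩ j hj
    have hsum := hb.sum_eq j hj
    simp only at hbit
    -- The test of the program, written with products, is the defining test of `found` for bit `l`.
    have hiff : binSum h z t (decode r j) * binSum h z t (decode r j) ≤
        4 * (binBitSum h z t (decode r j) ⟨l, hl⟩ * binBitSum h z t (decode r j) ⟨l, hl⟩) ↔
        (v ⟨l, hl⟩).val = 1 := by
      rw [hv]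
      simp only [found]
      rw [← sq, ← sq]
      split_ifs with hc
      · simp only [hc, true_iff]; rfl
      · simp [hc]
    simp only [Program.effect, WExp.eval, RExp.eval, Test.holds, hoff, hpow, hfa.word wJ, eJ,
      hfa.real rY, eY, hfa.real rBit, eB, hsum, hbit, Rat.cast_ofNat, hiff]
    rw [Finset.sum_range_succ, ← hU, dif_pos hl]
    have hlt : (v ⟨l, hl⟩).val < 2 := ZMod.val_lt _
    split_ifs with hc
    · simp [hoff, hpow, hfa.word wBins, he₃.bins, add_mul, pow_succ, hc, mul_two]
    · have hc0 : (v ⟨l, hl⟩).val = 0 := by omega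
      rw [hc0]
      simp [hoff, hpow, hfa.word wBins, he₃.bins, add_mul, pow_succ, mul_two]
  · rintro a ⟨-, -, hU⟩
    rw [hU, encode, Finset.sum_range]
    simp

end Bins

/-! ## Gathering the estimates of a block of seeds -/

/-- Store the content of bin `wJ` as estimate of the entry `wU`, and put `wU` on the list of
positions when it is estimated for the `wHalf`-th time. -/
def storeEstimate : Program Instr :=
  .setReal rEst (.add (.var wRow) (.var wU)) (.read rY (.var wJ)) ;;
  .setWord wTouch (.add (.var wTBase) (.var wU))
    (.add (.read wTouch (.add (.var wTBase) (.var wU))) (.lit 1)) ;;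
  .ite (.conj (.leWord (.read wTouch (.add (.var wTBase) (.var wU))) (.var wHalf))
      (.leWord (.var wHalf) (.read wTouch (.add (.var wTBase) (.var wU)))))
    (.setWord wList (.var wLen) (.var wU) ;; .setReal rVec (.var wLen) (.lit 0) ;;
      incW wLen (.lit 1)) .skip

/-- Replace `rMax` by the absolute value of the content of bin `wJ` if that is larger. -/
def updateMax : Program Instr :=
  .ite (.leReal (.read rY (.var wJ)) (.var rMax)) .skip (letR rMax (.read rY (.var wJ))) ;;
  .ite (.leReal (.sub (.lit 0) (.read rY (.var wJ))) (.var rMax)) .skip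
    (letR rMax (.sub (.lit 0) (.read rY (.var wJ))))

/-- Process the bins of a seed. -/
def gatherBins : Program Instr :=
  forLoop wJ (.var wBins)
    (searchBin ;;
     .special (.call wBin (.lit 0) (.var wU) (.var wSeed)) ;;
     updateMax ;;
     .ite (.conj (.leWord (.var wBin) (.var wJ)) (.leWord (.var wJ) (.var wBin)))
       storeEstimate .skip)

/-- Process a block of seeds. -/
def gatherBlock : Program Instr :=
  forLoop wI (.var wWidth)
    (.special (.draw wSeed (.lit 0)) ;; loadBins ;; subtractList ;; gatherBins ;;
     incW wRow (.var wSize))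

section Gather

variable {n r D k θ : ℕ} {Q : Program Empty} {h : F2 n → Fin D → F2 r} {x : F2 n → ℝ}
  {ω : ℕ → Fin D}

/-- The estimate for the seed `t` assigns a value to the entry `u`. -/
def Hits (h : F2 n → Fin D → F2 r) (z : F2 n → ℝ) (t : Fin D) (u : F2 n) : Prop :=
  found h z t (h u t) = u

open Classical in
/-- The number of estimates that assign a value to the entry `u`, among the first `a` seeds and
the first `b` bins of the next one. -/
def hitCount (h : F2 n → Fin D → F2 r) (z : F2 n → ℝ) (t : ℕ → Fin D) (a b : ℕ) (u : F2 n) : ℕ :=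
  (∑ i ∈ Finset.range a, if Hits h z (t i) u then 1 else 0) +
    if Hits h z (t a) u ∧ encode (h u (t a)) < b then 1 else 0

/-- Bin `h u (t i)` of seed `i` is among the first `a` seeds or the first `b` bins of the next
seed. -/
def Done (h : F2 n → Fin D → F2 r) (t : ℕ → Fin D) (a b i : ℕ) (u : F2 n) : Prop :=
  i < a ∨ i = a ∧ encode (h u (t i)) < b

open Classical in
/-- The state of the memory after the first `a` seeds and the first `b` bins of the next one. -/
structure Gathered (h : F2 n → Fin D → F2 r) (z : F2 n → ℝ) (t : ℕ → Fin D) (θ first tb m : ℕ)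
    (pos : ℕ → ℕ) (val : ℕ → ℝ) (a b : ℕ) (s : State) : Prop where
  row : s.word wRow 0 = first + a * 2 ^ n
  tbase : s.word wTBase 0 = tb
  est : ∀ i u, s.real rEst (first + i * 2 ^ n + encode u) =
    if Done h t a b i u then estimate h z (t i) u else 0
  touch : ∀ u, s.word wTouch (tb + encode u) =
    (if ∃ e < m, pos e = encode u then 2 * θ + 1 else 0) + hitCount h z t a b u
  fresh : ∀ c, tb + 2 ^ n ≤ c → s.word wTouch c = 0
  len_ge : m ≤ s.word wLen 0
  list_lt : ∀ e < s.word wLen 0, s.word wList e < 2 ^ n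
  list_inj : ∀ e < s.word wLen 0, ∀ e' < s.word wLen 0, s.word wList e = s.word wList e' → e = e'
  list_old : ∀ e < m, s.word wList e = pos e
  vec : ∀ e < s.word wLen 0, s.real rVec e = if e < m then val e else 0
  list_new : ∀ u, (∃ e < s.word wLen 0, s.word wList e = encode u) ↔
    ((∃ e < m, pos e = encode u) ∨ θ ≤ hitCount h z t a b u)
  max_nonneg : 0 ≤ s.real rMax 0
  max_le : s.real rMax 0 ≤ l1 z
  le_max : ∀ i u, Done h t a b i u → |estimate h z (t i) u| ≤ s.real rMax 0

theorem abs_binSum_le_l1 (z : F2 n → ℝ) (t : Fin D) (j : F2 r) : |binSum h z t j| ≤ l1 z :=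
  (abs_binSum_le t j).trans (Finset.sum_le_univ_sum_of_nonneg fun _ => abs_nonneg _)

theorem done_succ {t : ℕ → Fin D} {a b i : ℕ} {u : F2 n} :
    Done h t a (b + 1) i u ↔ Done h t a b i u ∨ (i = a ∧ encode (h u (t i)) = b) := by
  unfold Done
  constructor
  · rintro (h1 | ⟨h1, h2⟩)
    · exact Or.inl (Or.inl h1)
    · rcases Nat.lt_succ_iff_lt_or_eq.1 h2 with h3 | h3
      · exact Or.inl (Or.inr ⟨h1, h3⟩)
      · exact Or.inr ⟨h1, h3⟩
  · rintro ((h1 | ⟨h1, h2⟩) | ⟨h1, h2⟩)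
    · exact Or.inl h1
    · exact Or.inr ⟨h1, by omega⟩
    · exact Or.inr ⟨h1, by omega⟩

/-- Bin numbers are below `2 ^ r`, so having passed all bins of seed `a` is the same as standing at
the start of seed `a + 1`. -/
theorem done_next {t : ℕ → Fin D} {a i : ℕ} {u : F2 n} :
    Done h t (a + 1) 0 i u ↔ Done h t a (2 ^ r) i u := by
  unfold Done
  have := encode_lt (h u (t i))
  constructor
  · rintro (h1 | ⟨h1, h2⟩)
    · by_cases hi : i < a
      · exact Or.inl hi
      · exact Or.inr ⟨by omega, this⟩
    · omega
  · rintro (h1 | ⟨h1, -⟩)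
    · exact Or.inl (by omega)
    · exact Or.inl (by omega)

open Classical in
theorem hitCount_succ (h : F2 n → Fin D → F2 r) (z : F2 n → ℝ) (t : ℕ → Fin D) (a b : ℕ)
    (u : F2 n) :
    hitCount h z t a (b + 1) u =
      hitCount h z t a b u + if Hits h z (t a) u ∧ encode (h u (t a)) = b then 1 else 0 := by
  unfold hitCount
  by_cases h1 : Hits h z (t a) u
  · rcases lt_trichotomy (encode (h u (t a))) b with h2 | h2 | h2
    · have h3 : encode (h u (t a)) < b + 1 := by omega
      have h4 : encode (h u (t a)) ≠ b := by omega
      simp [h1, h2, h3, h4]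
    · simp [h1, h2]
    · have h3 : ¬ encode (h u (t a)) < b + 1 := by omega
      have h4 : encode (h u (t a)) ≠ b := by omega
      have h5 : ¬ encode (h u (t a)) < b := by omega
      simp [h1, h3, h4, h5]
  · simp [h1]

theorem hitCount_next (h : F2 n → Fin D → F2 r) (z : F2 n → ℝ) (t : ℕ → Fin D) (a : ℕ)
    (u : F2 n) :
    hitCount h z t (a + 1) 0 u = hitCount h z t a (2 ^ r) u := by
  have := encode_lt (h u (t a))
  rw [hitCount, hitCount, Finset.sum_range_succ]
  by_cases h1 : Hits h z (t a) u <;> simp [h1, this]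

variable {z : F2 n → ℝ} {t : ℕ → Fin D} {first tb m : ℕ} {pos : ℕ → ℕ} {val : ℕ → ℝ} {a b : ℕ}

/-- A bin in which no estimate is found. -/
theorem Gathered.skip {s : State} (hg : Gathered h z t θ first tb m pos val a b s)
    (hne : ∀ u, encode (h u (t a)) = b → ¬ Hits h z (t a) u) :
    Gathered h z t θ first tb m pos val a (b + 1) s := by
  classical
  have hc : ∀ u, hitCount h z t a (b + 1) u = hitCount h z t a b u := by
    intro u
    rw [hitCount_succ, if_neg, add_zero]
    rintro ⟨h1, h2⟩
    exact hne u h2 h1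
  have hz : ∀ u, encode (h u (t a)) = b → estimate h z (t a) u = 0 := by
    intro u hu
    have := hne u hu
    rw [Hits] at this
    rw [estimate, if_neg this]
  refine { hg with est := ?_, touch := ?_, list_new := ?_, le_max := ?_ }
  · intro i u
    rw [hg.est, done_succ]
    by_cases h1 : Done h t a b i u
    · simp [h1]
    by_cases h2 : i = a ∧ encode (h u (t i)) = b
    · obtain ⟨rfl, h2⟩ := h2
      simp [h2, hz u h2]
    · simp [h1, h2]
  · intro u; rw [hg.touch, hc]
  · intro u; rw [hg.list_new, hc]
  · intro i u hd
    rcases done_succ.1 hd with h1 | ⟨rfl, h2⟩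
    · exact hg.le_max i u h1
    · rw [hz u h2, abs_zero]; exact hg.max_nonneg

/-- What `storeEstimate` changes. -/
theorem Gathered.store {s : State} (hg : Gathered h z t θ first tb m pos val a b s)
    (he : Env n k r θ s) (u₀ : F2 n)
    (hu₀ : s.word wU 0 = encode u₀) (hb : encode (h u₀ (t a)) = b) (hJ : s.word wJ 0 = b)
    (hY : s.real rY b = binSum h z (t a) (decode r b)) (hhit : Hits h z (t a) u₀)
    (hmax : |binSum h z (t a) (decode r b)| ≤ s.real rMax 0) :
    Gathered h z t θ first tb m pos val a (b + 1) (storeEstimate.effect s) := by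
  classical
  have hbin : h u₀ (t a) = decode r b := by rw [← hb, decode_encode]
  have hest : estimate h z (t a) u₀ = binSum h z (t a) (decode r b) := by
    rw [Hits] at hhit
    rw [estimate, if_pos hhit, hbin]
  -- A bin spells out at most one position, so this step raises the counter of `u₀` and of no other
  -- entry.
  have huniq : ∀ u, Hits h z (t a) u ∧ encode (h u (t a)) = b ↔ u = u₀ := by
    intro u
    constructor
    · rintro ⟨h1, h2⟩
      rw [Hits] at h1 hhit
      rw [← h1, ← hhit, hbin, ← h2, decode_encode]
    · rintro rfl; exact ⟨hhit, hb⟩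
  have hc : ∀ u, hitCount h z t a (b + 1) u = hitCount h z t a b u + if u = u₀ then 1 else 0 := by
    intro u
    rw [hitCount_succ, if_congr (huniq u) rfl rfl]
  have hcu : hitCount h z t a (b + 1) u₀ = hitCount h z t a b u₀ + 1 := by simp [hc]
  set s₁ : State := (s.setReal rEst (first + a * 2 ^ n + encode u₀)
    (binSum h z (t a) (decode r b))).setWord wTouch (tb + encode u₀)
      (s.word wTouch (tb + encode u₀) + 1) with hs₁
  have heff : storeEstimate.effect s =
      if s.word wTouch (tb + encode u₀) + 1 = θ then
        ((s₁.setWord wList (s.word wLen 0) (encode u₀)).setReal rVec (s.word wLen 0) 0).setWord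
          wLen 0 (s.word wLen 0 + 1)
      else s₁ := by
    simp only [hs₁, le_antisymm_iff]
    simp [storeEstimate, Program.effect, hu₀, hJ, hY, hg.row, hg.tbase, he.half]
  have hE : ∀ i u, s₁.real rEst (first + i * 2 ^ n + encode u) =
      if Done h t a (b + 1) i u then estimate h z (t i) u else 0 := by
    intro i u
    have hinj : first + i * 2 ^ n + encode u = first + a * 2 ^ n + encode u₀ ↔ i = a ∧ u = u₀ := by
      rw [add_assoc, add_assoc, Nat.add_left_cancel_iff, mul_add_inj (encode_lt _) (encode_lt _),
        encode_injective.eq_iff]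
    simp only [hs₁, real_setWord, real_setReal, if_true, Function.update_apply, hinj, done_succ]
    by_cases h1 : i = a ∧ u = u₀
    · obtain ⟨rfl, rfl⟩ := h1
      simp [hb, hest]
    · rw [if_neg h1, hg.est]
      by_cases h2 : Done h t a b i u
      · simp [h2]
      by_cases h3 : i = a ∧ encode (h u (t i)) = b
      · obtain ⟨rfl, h3⟩ := h3
        have h4 : ¬ Hits h z (t i) u := fun h5 => h1 ⟨rfl, (huniq u).1 ⟨h5, h3⟩⟩
        rw [Hits] at h4
        simp [h2, h3, estimate, h4]
      · simp [h2, h3]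
  have hT : ∀ u, s₁.word wTouch (tb + encode u) =
      (if ∃ e < m, pos e = encode u then 2 * θ + 1 else 0) + hitCount h z t a (b + 1) u := by
    intro u
    simp only [hs₁, word_setWord, if_true, Function.update_apply, Nat.add_left_cancel_iff,
      encode_injective.eq_iff, word_setReal]
    rw [hc, hg.touch, hg.touch]
    by_cases h1 : u = u₀
    · subst h1; simp only [if_true]; ring
    · simp only [if_neg h1]; ring
  have hF : ∀ c, tb + 2 ^ n ≤ c → s₁.word wTouch c = 0 := by
    intro c hc'
    have := encode_lt u₀
    simp only [hs₁, word_setWord, if_true, Function.update_apply, word_setReal]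
    rw [if_neg (by omega), hg.fresh c hc']
  have hM : ∀ i u, Done h t a (b + 1) i u → |estimate h z (t i) u| ≤ s.real rMax 0 := by
    intro i u hd
    rcases done_succ.1 hd with h1 | ⟨rfl, h2⟩
    · exact hg.le_max i u h1
    · rw [estimate]
      split_ifs
      · rw [← h2, decode_encode] at hmax; exact hmax
      · rw [abs_zero]; exact hg.max_nonneg
  have htu := hg.touch u₀
  by_cases hθ : s.word wTouch (tb + encode u₀) + 1 = θ
  · rw [heff, if_pos hθ]
    -- Counters of old entries start at `2 * θ + 1`, beyond `θ`, so they never trigger a second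
    -- listing.
    have hnot : ¬ ∃ e < m, pos e = encode u₀ := by
      intro h'
      rw [if_pos h'] at htu
      omega
    rw [if_neg hnot, zero_add] at htu
    have hnl : ¬ ∃ e < s.word wLen 0, s.word wList e = encode u₀ := by
      rw [hg.list_new]
      rintro (h' | h')
      · exact hnot h'
      · omega
    push Not at hnl
    have hml := hg.len_ge
    constructor
    · simpa [hs₁] using hg.row
    · simpa [hs₁] using hg.tbase
    · intro i u; simpa using hE i u
    · intro u; simpa using hT u
    · intro c hc'; simpa using hF c hc'
    · simp; omega
    · intro e hle
      simp [hs₁, Function.update_apply] at hle ⊢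
      split_ifs with h1
      · exact encode_lt _
      · exact hg.list_lt e (by omega)
    · intro e hle e' hle'
      simp [hs₁, Function.update_apply] at hle hle' ⊢
      split_ifs with h1 h2 h2
      · omega
      · intro h3; exact absurd h3.symm (hnl e' (by omega))
      · intro h3; exact absurd h3 (hnl e (by omega))
      · exact hg.list_inj e (by omega) e' (by omega)
    · intro e hle
      simp [hs₁, Function.update_apply]
      rw [if_neg (by omega), hg.list_old e hle]
    · intro e hle
      simp [hs₁, Function.update_apply] at hle ⊢
      split_ifs with h1 h2 h2
      · omega
      · rfl
      · rw [hg.vec e (by omega), if_pos h2]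
      · rw [hg.vec e (by omega), if_neg h2]
    · intro u
      have hn := hg.list_new u
      rw [hc]
      by_cases h1 : u = u₀
      · subst h1
        simp only [if_true]
        constructor
        · intro _; right; omega
        · intro _
          exact ⟨s.word wLen 0, by simp, by simp⟩
      · rw [if_neg h1, add_zero, ← hn]
        constructor
        · rintro ⟨e, h2, h3⟩
          simp [hs₁, Function.update_apply] at h2 h3
          split_ifs at h3 with h4
          · exact absurd (encode_injective h3).symm h1
          · exact ⟨e, by omega, h3⟩
        · rintro ⟨e, h2, h3⟩
          refine ⟨e, by simp; omega, ?_⟩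
          simp [hs₁, Function.update_apply]
          rw [if_neg (by omega), h3]
    · simpa [hs₁] using hg.max_nonneg
    · simpa [hs₁] using hg.max_le
    · intro i u hd; simpa [hs₁] using hM i u hd
  · rw [heff, if_neg hθ]
    constructor
    · simpa [hs₁] using hg.row
    · simpa [hs₁] using hg.tbase
    · exact hE
    · exact hT
    · exact hF
    · simpa [hs₁] using hg.len_ge
    · simpa [hs₁] using hg.list_lt
    · simpa [hs₁] using hg.list_inj
    · simpa [hs₁] using hg.list_old
    · simpa [hs₁] using hg.vec
    · intro u
      have hn := hg.list_new u
      have e1 : s₁.word wLen = s.word wLen := by simp [hs₁]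
      have e2 : s₁.word wList = s.word wList := by simp [hs₁]
      rw [e1, e2, hn, hc]
      by_cases h1 : u = u₀
      · subst h1
        by_cases h2 : ∃ e < m, pos e = encode u
        · simp [h2]
        · rw [if_neg h2] at htu
          simp only [h2, false_or, if_true]
          omega
      · simp [h1]
    · simpa [hs₁] using hg.max_nonneg
    · simpa [hs₁] using hg.max_le
    · intro i u hd; simpa [hs₁] using hM i u hd

theorem Gathered.of_frame {s s' : State} (hg : Gathered h z t θ first tb m pos val a b s)
    {ws rs : List ℕ} {d : Bool} (hf : FrameOn ws rs d s s')
    (hmax : s.real rMax 0 ≤ s'.real rMax 0) (hmax' : s'.real rMax 0 ≤ l1 z)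
    (hw : ∀ a ∈ [wRow, wTBase, wTouch, wLen, wList], a ∉ ws := by decide)
    (hr : ∀ a ∈ [rEst, rVec], a ∉ rs := by decide) :
    Gathered h z t θ first tb m pos val a b s' := by
  have e1 := hf.word_eq wRow (hw _ (by simp))
  have e2 := hf.word_eq wTBase (hw _ (by simp))
  have e3 := hf.word_eq wTouch (hw _ (by simp))
  have e4 := hf.word_eq wLen (hw _ (by simp))
  have e5 := hf.word_eq wList (hw _ (by simp))
  have e6 := hf.real_eq rEst (hr _ (by simp))
  have e7 := hf.real_eq rVec (hr _ (by simp))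
  constructor
  · rw [e1]; exact hg.row
  · rw [e2]; exact hg.tbase
  · rw [e6]; exact hg.est
  · rw [e3]; exact hg.touch
  · rw [e3]; exact hg.fresh
  · rw [e4]; exact hg.len_ge
  · rw [e4, e5]; exact hg.list_lt
  · rw [e4, e5]; exact hg.list_inj
  · rw [e5]; exact hg.list_old
  · rw [e4, e7]; exact hg.vec
  · rw [e4, e5]; exact hg.list_new
  · exact hg.max_nonneg.trans hmax
  · exact hmax'
  · exact fun i u hd => (hg.le_max i u hd).trans hmax

/-- The last clause says that the maximum grows no more than it must, which keeps `rMax` below `l1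
z`. -/
theorem run_updateMax {s : State} {y : ℝ} (hy : s.real rY (s.word wJ 0) = y) :
    Run (Sem k Q h x ω) updateMax s 60 fun s' =>
      s.real rMax 0 ≤ s'.real rMax 0 ∧ |y| ≤ s'.real rMax 0 ∧
        (∀ B, s.real rMax 0 ≤ B → |y| ≤ B → s'.real rMax 0 ≤ B) := by
  refine Run.straight ?_
  simp only [updateMax, Program.effect, Test.holds, RExp.eval, WExp.eval, hy, Rat.cast_zero,
    zero_sub]
  by_cases h1 : y ≤ s.real rMax 0
  · by_cases h2 : -y ≤ s.real rMax 0
    · simp only [h1, h2, if_true, hy]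
      exact ⟨le_rfl, abs_le'.2 ⟨h1, h2⟩, fun _ h _ => h⟩
    · rw [not_le] at h2
      simp [h1, h2.not_ge, hy]
      refine ⟨h2.le, abs_le'.2 ⟨by linarith, le_rfl⟩, fun B _ hB => (neg_le_abs y).trans hB⟩
  · rw [not_le] at h1
    by_cases h2 : -y ≤ y
    · simp [h1.not_ge, h2, hy]
      exact ⟨h1.le, abs_le'.2 ⟨le_rfl, h2⟩, fun B _ hB => (le_abs_self y).trans hB⟩
    · rw [not_le] at h2
      simp [h1.not_ge, h2.not_ge, hy]
      exact ⟨by linarith, abs_le'.2 ⟨h2.le, le_rfl⟩, fun B _ hB => (neg_le_abs y).trans hB⟩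

/-- A bin is used only if the subroutine sends the decoded position back to it; exactly then the
position is a hit. The conclusion anticipates the later advance of `wRow`, so that it can already
speak of the next seed. -/
theorem run_gatherBins {F : ℕ} (hQ : ComputesWithin Q k h F) {s : State} (he : Env n k r θ s)
    (hg : Gathered h z t θ first tb m pos val a 0 s) (ht : s.word wSeed 0 = t a)
    (hb : HoldsBins h z (t a) (s.real rY) (s.real rBit)) :
    Run (Sem k Q h x ω) gatherBins s (forCost (2 ^ r) (F + forCost n 60 2 + 200) 2)
      fun s' => Gathered h z t θ first tb m pos val (a + 1) 0
        (s'.setWord wRow 0 (s'.word wRow 0 + 2 ^ n)) := by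
  refine (Run.for (N := 2 ^ r) (B := F + forCost n 60 2 + 200)
    (I := fun j s' => Gathered h z t θ first tb m pos val a j s')
    (by decide) ?_ ?_ ?_).mono (by simp) ?_
  · intro s' hf
    simp [hf.word wBins, he.bins]
  · refine hg.of_frame (ws := [wJ]) (rs := []) (d := false) ⟨?_, ?_, ?_⟩ ?_ ?_ <;>
      simp +contextual [hg.max_le]
  · intro j hj s' hf hv hI
    have he' := he.mono hf
    have eY : s'.real rY = s.real rY := hf.real rY
    have eB : s'.real rBit = s.real rBit := hf.real rBit
    have ht' : s'.word wSeed 0 = t a := by rw [hf.word wSeed, ht]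
    rw [← eY, ← eB] at hb
    set u := found h z (t a) (decode r j) with hu
    refine (Run.seqF (B₁ := 15 + forCost n 60 2) (B₂ := F + 185)
      (run_searchBin he' (t a) hb hj hv) fun s₁ hf₁ h₁ => ?_).mono (by omega) fun _ h => h
    rw [← hu] at h₁
    refine (Run.seqF (B₁ := 1 + 1 + 2 + 2 + F) (B₂ := 179)
      (run_call hQ u (t a) (by simp [h₁]) (by simp [hf₁.word wSeed, ht'])) fun s₂ hf₂ h₂ => ?_).mono
      (by omega) fun _ h => h
    have hw₂ : s₂.word wBin 0 = encode (h u (t a)) := by simp [h₂]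
    have eJ₂ : s₂.word wJ 0 = j := by rw [hf₂.word wJ, hf₁.word wJ, hv]
    have eY₂ : s₂.real rY j = binSum h z (t a) (decode r j) := by
      rw [hf₂.real rY, hf₁.real rY, hb.sum_eq j hj]
    have eM₂ : s₂.real rMax = s'.real rMax := by rw [hf₂.real rMax, hf₁.real rMax]
    have hg₂ := (hI.of_frame hf₁ (by rw [hf₁.real rMax]) (by rw [hf₁.real rMax]; exact hI.max_le))
    have hg₂ := (hg₂.of_frame hf₂ (by rw [hf₂.real rMax]) (by rw [hf₂.real rMax]; exact hg₂.max_le))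
    refine (Run.seqF (B₁ := 60) (B₂ := 119) (run_updateMax (by rw [eJ₂, eY₂])) fun s₃ hf₃ h₃ => ?_)
    have hg₃ := hg₂.of_frame hf₃ h₃.1
      (h₃.2.2 _ hg₂.max_le (abs_binSum_le_l1 z (t a) (decode r j)))
    have hw₃ : s₃.word wBin 0 = encode (h u (t a)) := by rw [hf₃.word wBin, hw₂]
    have eJ₃ : s₃.word wJ 0 = j := by rw [hf₃.word wJ, eJ₂]
    have eU₃ : s₃.word wU 0 = encode u := by rw [hf₃.word wU, hf₂.word wU, h₁]
    have eY₃ : s₃.real rY j = binSum h z (t a) (decode r j) := by rw [hf₃.real rY, eY₂]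
    refine Run.straight ?_
    have key : Gathered h z t θ first tb m pos val a (j + 1)
        ((Program.ite (.conj (.leWord (.var wBin) (.var wJ)) (.leWord (.var wJ) (.var wBin)))
          storeEstimate .skip).effect s₃) := by
      rw [Program.effect]
      simp only [Test.holds, WExp.eval, hw₃, eJ₃, ← le_antisymm_iff]
      split_ifs with hc
      · refine hg₃.store (((he'.mono hf₁).mono hf₂).mono hf₃) u eU₃ hc eJ₃ eY₃ ?_ h₃.2.1
        rw [Hits, hu]
        rw [encode_eq_iff hj] at hc
        rw [hc]
      · refine hg₃.skip fun v hv' hh => hc ?_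
        rw [Hits, (encode_eq_iff hj _).1 hv', ← hu] at hh
        rw [hh, hv']
    refine key.of_frame (ws := [wJ]) (rs := []) (d := false) ⟨?_, ?_, ?_⟩ ?_ ?_ <;>
      simp +contextual [key.max_le]
  · intro s' hg'
    refine ⟨?_, ?_, ?_, ?_, ?_, ?_, ?_, ?_, ?_, ?_, ?_, ?_, ?_, ?_⟩
    · simp [hg'.row]; ring
    · simpa using hg'.tbase
    · intro i u
      have h1 := hg'.est i u
      by_cases h2 : Done h t a (2 ^ r) i u
      · simpa [h2, done_next.2 h2] using h1
      · have h3 : ¬ Done h t (a + 1) 0 i u := fun h3 => h2 (done_next.1 h3)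
        simpa [h2, h3] using h1
    · simpa [hitCount_next] using hg'.touch
    · simpa using hg'.fresh
    · simpa using hg'.len_ge
    · simpa using hg'.list_lt
    · simpa using hg'.list_inj
    · simpa using hg'.list_old
    · simpa using hg'.vec
    · simpa [hitCount_next] using hg'.list_new
    · simpa using hg'.max_nonneg
    · simpa using hg'.max_le
    · simpa [done_next] using hg'.le_max

/-- A bound on the running time of `gatherBlock`. -/
def gatherCost (n r θ m F : ℕ) : ℕ :=
  forCost (2 * θ) ((forCost (2 ^ r) 10 2 + (5 + forCost n (forCost (2 ^ r) 20 2 + 10) 2)) +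
    forCost m (F + forCost n 60 2 + 50) 2 +
    forCost (2 ^ r) (F + forCost n 60 2 + 200) 2 + 20) 2

/-- The listed vector is frozen during a block, so all `2 * θ` seeds estimate the same residual `z`.
-/
theorem run_gatherBlock {F : ℕ} (hQ : ComputesWithin Q k h F) {s : State} (he : Env n k r θ s)
    (hpos : ∀ e < s.word wCnt 0, s.word wPos e < 2 ^ n)
    (hz : z = x - listVec n (s.word wCnt 0) (s.word wPos) (s.real rVal))
    (ht : ∀ i < 2 * θ, t i = ω (s.drawn + i))
    (hg : Gathered h z t θ first tb m pos val 0 0 s) :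
    Run (Sem k Q h x ω) gatherBlock s (gatherCost n r θ (s.word wCnt 0) F)
      fun s' => Gathered h z t θ first tb m pos val (2 * θ) 0 s' ∧
        s'.drawn = s.drawn + 2 * θ := by
  refine (Run.for (N := 2 * θ)
    (I := fun i s' => Gathered h z t θ first tb m pos val i 0 s' ∧ s'.drawn = s.drawn + i)
    (by decide) ?_ ?_ ?_)
  · intro s' hf
    simp [hf.word wWidth, he.width]
  · refine ⟨hg.of_frame (ws := [wI]) (rs := []) (d := false) ⟨?_, ?_, ?_⟩ ?_ ?_, ?_⟩ <;>
      simp +contextual [hg.max_le]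
  · rintro i hi s' hf hv ⟨hI, hd⟩
    have he' := he.mono hf
    refine (Run.seqF (B₁ := 2)
      (B₂ := (forCost (2 ^ r) 10 2 + (5 + forCost n (forCost (2 ^ r) 20 2 + 10) 2)) +
    forCost (s.word wCnt 0) (F + forCost n 60 2 + 50) 2 +
    forCost (2 ^ r) (F + forCost n 60 2 + 200) 2 + 18)
      (R := fun a => a.word wSeed 0 = t i ∧ a.drawn = s.drawn + (i + 1))
      (Run.special (.draw _ _ _) (by simp) ?_) fun s₁ hf₁ h₁ => ?_).mono (by omega) fun _ h => h
    · simp [hd, ht i hi, add_assoc]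
    refine (Run.seqF (B₁ := forCost (2 ^ r) 10 2 + (5 + forCost n (forCost (2 ^ r) 20 2 + 10) 2))
      (B₂ := forCost (s.word wCnt 0) (F + forCost n 60 2 + 50) 2 +
    forCost (2 ^ r) (F + forCost n 60 2 + 200) 2 + 18)
      (run_loadBins (he'.mono hf₁) (t i) h₁.1) fun s₂ hf₂ h₂ => ?_).mono (by omega) fun _ h => h
    have e1 : s₂.word wCnt = s.word wCnt := by rw [hf₂.word wCnt, hf₁.word wCnt, hf.word wCnt]
    have e2 : s₂.word wPos = s.word wPos := by rw [hf₂.word wPos, hf₁.word wPos, hf.word wPos]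
    have e3 : s₂.real rVal = s.real rVal := by rw [hf₂.real rVal, hf₁.real rVal, hf.real rVal]
    have ht₂ : s₂.word wSeed 0 = t i := by rw [hf₂.word wSeed, h₁.1]
    have hrun := run_subtractList (ω := ω) hQ ((he'.mono hf₁).mono hf₂) (t i) ht₂
      (by rw [e1, e2]; exact hpos) h₂
    rw [e1, e2, e3, ← hz] at hrun
    refine (Run.seqF (B₂ := forCost (2 ^ r) (F + forCost n 60 2 + 200) 2 + 18)
      hrun fun s₃ hf₃ h₃ => ?_).mono (by omega) fun _ h => h
    have he₃ := ((he'.mono hf₁).mono hf₂).mono hf₃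
    have hg₁ := hI.of_frame hf₁ (by rw [hf₁.real rMax]) (by rw [hf₁.real rMax]; exact hI.max_le)
    have hg₂ := hg₁.of_frame hf₂ (by rw [hf₂.real rMax]) (by rw [hf₂.real rMax]; exact hg₁.max_le)
    have hg₃ := hg₂.of_frame hf₃ (by rw [hf₃.real rMax]) (by rw [hf₃.real rMax]; exact hg₂.max_le)
    refine (Run.seqF (B₂ := 18) (run_gatherBins hQ he₃ hg₃
      (by rw [hf₃.word wSeed, ht₂]) h₃) fun s₄ hf₄ h₄ => ?_)
    have he₄ := he₃.mono hf₄
    refine Run.straight ?_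
    simp only [Program.effect, WExp.eval, he₄.size]
    refine ⟨h₄.of_frame (ws := [wI]) (rs := []) (d := false) ⟨?_, ?_, ?_⟩ ?_ ?_, ?_⟩
    · simp +contextual
    · simp
    · simp
    · simp
    · simpa using h₄.max_le
    · simp only [drawn_setWord]
      rw [hf₄.drawn, hf₃.drawn, hf₂.drawn, h₁.2]

end Gather

/-! ## Processing a block of seeds -/

/-- Put the positions of the current vector on the list. -/
def startBlock : Program Instr :=
  letW wFirst (.var wRow) ;; letR rMax (.lit 0) ;;
  forLoop wE (.var wCnt)
    (.setWord wList (.var wE) (.read wPos (.var wE)) ;;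
     .setReal rVec (.var wE) (.read rVal (.var wE)) ;;
     .setWord wTouch (.add (.var wTBase) (.read wPos (.var wE))) (.add (.var wWidth) (.lit 1))) ;;
  letW wLen (.var wCnt)

/-- Add to the listed entries approximate medians of their estimates. -/
def addMedians : Program Instr :=
  forLoop wE (.var wLen)
    (letW wOff (.add (.var wFirst) (.read wList (.var wE))) ;;
     forLoop wI (.var wWidth)
      (.setReal rTmp (.var wI) (.read rEst (.var wOff)) ;; incW wOff (.var wSize)) ;;
     (letW wItems (.var wWidth) ;; letW wKappa (.var wHalf) ;;
      letR rLo (.sub (.lit 0) (.var rMax)) ;; letR rHi (.var rMax)) ;;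
     bisect ;;
     .setReal rVec (.var wE) (.add (.read rVec (.var wE)) (.var rLo)))

/-- Append the listed entry `wE` to the current vector. -/
def appendEntry : Program Instr :=
  .setWord wPos (.var wCnt) (.read wList (.var wE)) ;;
  .setReal rVal (.var wCnt) (.read rVec (.var wE)) ;;
  incW wCnt (.lit 1)

/-- Form the new current vector from large entries among the listed ones. -/
def selectEntries : Program Instr :=
  forLoop wE (.var wLen)
    (.ite (.leReal (.lit 0) (.read rVec (.var wE)))
      (.setReal rTmp (.var wE) (.read rVec (.var wE)))
      (.setReal rTmp (.var wE) (.sub (.lit 0) (.read rVec (.var wE))))) ;;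
  (letW wItems (.var wLen) ;; letW wKappa (.add (.read 0 (.lit 1)) (.lit 1)) ;;
   letR rLo (.lit 0) ;; letR rHi (.var rMax)) ;;
  bisect ;;
  letW wCnt (.lit 0) ;;
  forLoop wE (.var wLen)
    (.ite (.leReal (.read rTmp (.var wE)) (.var rHi)) .skip appendEntry) ;;
  forLoop wE (.var wLen)
    (.ite (.conj (.conj (.leReal (.var rLo) (.read rTmp (.var wE)))
        (.leReal (.read rTmp (.var wE)) (.var rHi))) (.neg (.leWord (.read 0 (.lit 1)) (.var wCnt))))
      appendEntry .skip)

/-- Improve the current vector by means of a block of seeds. -/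
def improve : Program Instr :=
  startBlock ;; gatherBlock ;; addMedians ;; selectEntries ;; incW wTBase (.var wSize)

section Block

variable {n r D k θ : ℕ} {Q : Program Empty} {h : F2 n → Fin D → F2 r} {x : F2 n → ℝ}
  {ω : ℕ → Fin D}

/-- The state of the memory between the blocks. -/
structure Ready (n k r θ : ℕ) (s : State) : Prop where
  env : Env n k r θ s
  cnt_le : s.word wCnt 0 ≤ k
  pos_lt : ∀ e < s.word wCnt 0, s.word wPos e < 2 ^ n
  pos_inj : ∀ e < s.word wCnt 0, ∀ e' < s.word wCnt 0, s.word wPos e = s.word wPos e' → e = e'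
  fresh_touch : ∀ c, s.word wTBase 0 ≤ c → s.word wTouch c = 0
  fresh_est : ∀ c, s.word wRow 0 ≤ c → s.real rEst c = 0

/-- Entries of the current vector are listed from the outset, whatever their number of hits, and are
marked so that they are not listed again. For all other positions zero counters and estimates come
from the untouched cells guaranteed by `Ready`. -/
theorem run_startBlock {H : Instr → State → State → ℕ → Prop} [LocalInstr H]
    {s : State} (hs : Ready n k r θ s) (hθ : 1 ≤ θ) (z : F2 n → ℝ)
    (t : ℕ → Fin D) :
    Run H startBlock s (10 + forCost (s.word wCnt 0) 40 2 + 10)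
      fun s' => Gathered h z t θ (s.word wRow 0) (s.word wTBase 0) (s.word wCnt 0)
        (s.word wPos) (s.real rVal) 0 0 s' ∧ s'.word wFirst 0 = s.word wRow 0 := by
  classical
  have he := hs.env
  refine (Run.seqF (B₁ := 5) (B₂ := 5 + (forCost (s.word wCnt 0) 40 2 + 10))
    (R := fun a => a.word wFirst 0 = s.word wRow 0)
    (Run.straight (by simp [Program.effect])) fun s₁ hf₁ h₁ => ?_).mono (by omega) fun _ h => h
  refine (Run.seqF (B₁ := 5) (B₂ := forCost (s.word wCnt 0) 40 2 + 10)
    (R := fun a => a.real rMax 0 = 0)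
    (Run.straight (by simp [Program.effect])) fun s₂ hf₂ h₂ => ?_)
  refine (Run.seqF (B₁ := forCost (s.word wCnt 0) 40 2) (B₂ := 10) (R := fun a =>
      (∀ e < s.word wCnt 0, a.word wList e = s.word wPos e) ∧
      (∀ e < s.word wCnt 0, a.real rVec e = s.real rVal e) ∧
      ∀ c, a.word wTouch (s.word wTBase 0 + c) =
        if ∃ e < s.word wCnt 0, s.word wPos e = c then 2 * θ + 1 else 0)
    (Run.for (I := fun m a => (∀ e < m, a.word wList e = s.word wPos e) ∧
      (∀ e < m, a.real rVec e = s.real rVal e) ∧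
      ∀ c, a.word wTouch (s.word wTBase 0 + c) =
        if ∃ e < m, s.word wPos e = c then 2 * θ + 1 else 0)
      (by decide) ?_ ?_ ?_)
    fun s₃ hf₃ h₃ => ?_)
  · intro a hfa
    simp [hfa.word wCnt, hf₂.word wCnt, hf₁.word wCnt]
  · refine ⟨by simp, by simp, fun c => ?_⟩
    simp [hf₂.word wTouch, hf₁.word wTouch, hs.fresh_touch]
  · rintro m hm a hfa hva ⟨hI₁, hI₂, hI₃⟩
    have ep : a.word wPos = s.word wPos := by rw [hfa.word wPos, hf₂.word wPos, hf₁.word wPos]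
    have ev : a.real rVal = s.real rVal := by rw [hfa.real rVal, hf₂.real rVal, hf₁.real rVal]
    have eb : a.word wTBase = s.word wTBase := by
      rw [hfa.word wTBase, hf₂.word wTBase, hf₁.word wTBase]
    have ew : a.word wWidth 0 = 2 * θ := by
      rw [hfa.word wWidth, hf₂.word wWidth, hf₁.word wWidth, he.width]
    refine Run.straight ⟨?_, ?_, ?_⟩
    · intro e hem
      simp only [Program.effect, WExp.eval, RExp.eval, hva, ep]
      simp [Function.update_apply, ep]
      split_ifs with h'
      · rw [h']
      · exact hI₁ e (by omega)
    · intro e hem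
      simp only [Program.effect, WExp.eval, RExp.eval, hva, ep]
      simp [Function.update_apply, ev, hva]
      split_ifs with h'
      · rw [h']
      · exact hI₂ e (by omega)
    · intro c
      have hc := hI₃ c
      simp only [Program.effect, WExp.eval, RExp.eval, hva, ep]
      simp [Function.update_apply, eb, ew, hva, ep]
      by_cases h' : c = s.word wPos m
      · have : ∃ e ≤ m, s.word wPos e = c := ⟨m, le_rfl, h'.symm⟩
        rw [if_pos h', if_pos this]
      · have : (∃ e ≤ m, s.word wPos e = c) ↔ ∃ e < m, s.word wPos e = c := by
          constructor
          · rintro ⟨e, h1, h2⟩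
            refine ⟨e, ?_, h2⟩
            rcases h1.lt_or_eq with h3 | h3
            · exact h3
            · subst h3; exact absurd h2.symm h'
          · rintro ⟨e, h1, h2⟩; exact ⟨e, by omega, h2⟩
        rw [if_neg h', hc]
        by_cases h5 : ∃ e < m, s.word wPos e = c
        · rw [if_pos h5, if_pos (this.2 h5)]
        · rw [if_neg h5, if_neg (fun h6 => h5 (this.1 h6))]
  · obtain ⟨hL, hV, hT⟩ := h₃
    have ec : s₃.word wCnt 0 = s.word wCnt 0 := by rw [hf₃.word wCnt, hf₂.word wCnt, hf₁.word wCnt]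
    have eb : s₃.word wTBase 0 = s.word wTBase 0 := by
      rw [hf₃.word wTBase, hf₂.word wTBase, hf₁.word wTBase]
    have er : s₃.word wRow 0 = s.word wRow 0 := by
      rw [hf₃.word wRow, hf₂.word wRow, hf₁.word wRow]
    have ee : s₃.real rEst = s.real rEst := by rw [hf₃.real rEst, hf₂.real rEst, hf₁.real rEst]
    have ef : s₃.word wFirst 0 = s.word wRow 0 := by rw [hf₃.word wFirst, hf₂.word wFirst, h₁]
    have em : s₃.real rMax 0 = 0 := by rw [hf₃.real rMax, h₂]
    have hd : ∀ i (u : F2 n), ¬ Done h t 0 0 i u := by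
      intro i u; simp [Done]
    have hh : ∀ u : F2 n, hitCount h z t 0 0 u = 0 := by
      intro u; simp [hitCount]
    refine Run.straight ⟨?_, by simp [Program.effect, ef]⟩
    have hlen : ((letW wLen (.var wCnt)).effect s₃).word wLen 0 = s.word wCnt 0 := by
      simp [Program.effect, ec]
    have hlist : ((letW wLen (.var wCnt)).effect s₃).word wList = s₃.word wList := by
      simp [Program.effect]
    constructor
    · simp [Program.effect, er]
    · simp [Program.effect, eb]
    · intro i u
      rw [if_neg (hd i u)]
      simp only [Program.effect, real_setWord, ee]
      exact hs.fresh_est _ (by omega)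
    · intro u
      simp only [Program.effect, word_setWord, hh, add_zero]
      exact hT (encode u)
    · intro c hc
      have := hT (c - s.word wTBase 0)
      rw [Nat.add_sub_cancel' ((Nat.le_add_right _ _).trans hc), if_neg] at this
      · simpa [Program.effect] using this
      · rintro ⟨e, h4, h5⟩
        have := hs.pos_lt e h4
        omega
    · exact hlen.ge
    · intro e hle
      rw [hlen] at hle
      rw [hlist, hL e hle]
      exact hs.pos_lt e hle
    · intro e hle e' hle'
      rw [hlen] at hle hle'
      rw [hlist, hL e hle, hL e' hle']
      exact hs.pos_inj e hle e' hle'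
    · intro e hle
      rw [hlist, hL e hle]
    · intro e hle
      rw [hlen] at hle
      rw [if_pos hle]
      simpa [Program.effect] using hV e hle
    · intro u
      rw [hlen, hlist, hh]
      constructor
      · rintro ⟨e, h4, h5⟩
        exact Or.inl ⟨e, h4, by rw [← hL e h4, h5]⟩
      · rintro (⟨e, h4, h5⟩ | h4)
        · exact ⟨e, h4, by rw [hL e h4, h5]⟩
        -- No hit has occurred yet, so `1 ≤ θ` keeps every other entry off the list.
        · omega
    · simp [Program.effect, em]
    · simpa [Program.effect, em] using l1_nonneg z
    · intro i u hdu; exact absurd hdu (hd i u)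

/-! ### Approximate medians of the estimates -/

open Classical in
theorem countGe_compl (g : ℕ → ℝ) (m : ℕ) (b : ℝ) :
    countGe g m b + ((Finset.range m).filter fun i => g i < b).card = m := by
  have := Finset.card_filter_add_card_filter_not (s := Finset.range m) fun i => b ≤ g i
  simp only [not_le, Finset.card_range] at this
  exact this

open Classical in
/-- Bisection finds approximate medians. -/
theorem Bisected.median {g : ℕ → ℝ} {p : ℕ} {M lo hi : ℝ}
    (hb : Bisected g (2 * θ) θ p (-M) M lo hi) (hg : ∀ i < 2 * θ, |g i| ≤ M) (hM : 0 ≤ M) (z : ℝ) :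
    |lo| ≤ M ∧
    2 * θ ≤ 2 * (Finset.univ.filter fun i : Fin (2 * θ) =>
      |lo - z| ≤ |g i - z| + 2 * M / 2 ^ p).card := by
  have hw := hb.width
  rw [show M - -M = 2 * M by ring] at hw
  have hδ : 0 ≤ 2 * M / 2 ^ p := by positivity
  refine ⟨abs_le.2 ⟨hb.lo_ge, by linarith [hb.hi_le]⟩, ?_⟩
  have hcard : ∀ P : ℕ → Prop, (∀ i, P i → |lo - z| ≤ |g i - z| + 2 * M / 2 ^ p) →
      θ ≤ ((Finset.range (2 * θ)).filter P).card →
      2 * θ ≤ 2 * (Finset.univ.filter fun i : Fin (2 * θ) =>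
      |lo - z| ≤ |g i - z| + 2 * M / 2 ^ p).card := by
    intro P hP hc
    have h1 : (Finset.univ.filter fun i : Fin (2 * θ) => P i).card =
        ((Finset.range (2 * θ)).filter P).card := by
      rw [Finset.card_filter, Finset.card_filter, Finset.sum_range]
    have h2 : (Finset.univ.filter fun i : Fin (2 * θ) => P i).card ≤
        (Finset.univ.filter fun i : Fin (2 * θ) => |lo - z| ≤ |g i - z| + 2 * M / 2 ^ p).card :=
      Finset.card_le_card fun i hi => by
        simp only [Finset.mem_filter, Finset.mem_univ, true_and] at hi ⊢
        exact hP i hi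
    omega
  -- If `z ≤ lo`, the at least `θ` values from `lo` upwards are no closer to `z` than `lo` is. If
  -- `lo < z`, at least `θ` values are at most `hi`; these are no closer than `hi`, and the width
  -- `hi - lo` is the permitted slack.
  rcases le_or_gt z lo with hz | hz
  · refine hcard (fun i => lo ≤ g i) (fun i hi => ?_) ?_
    · rw [abs_of_nonneg (by linarith)]
      linarith [le_abs_self (g i - z)]
    · rcases hb.lo_count with h1 | h1
      · rw [Finset.filter_true_of_mem, Finset.card_range]
        · omega
        · intro i hi
          have := abs_le.1 (hg i (Finset.mem_range.1 hi))
          rw [h1]; exact this.1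
      · exact h1
  · refine hcard (fun i => g i ≤ hi) (fun i hi => ?_) ?_
    · rw [abs_of_neg (by linarith)]
      linarith [neg_abs_le (g i - z)]
    · rcases hb.hi_count with h1 | h1
      · rw [Finset.filter_true_of_mem, Finset.card_range]
        · omega
        · intro i hi
          have := abs_le.1 (hg i (Finset.mem_range.1 hi))
          rw [h1]; exact this.2
      · have h2 := countGe_compl g (2 * θ) hi
        have h3 : ((Finset.range (2 * θ)).filter fun i => g i < hi).card ≤
            ((Finset.range (2 * θ)).filter fun i => g i ≤ hi).card :=
          Finset.card_le_card fun i hi => by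
            simp only [Finset.mem_filter] at hi ⊢
            exact ⟨hi.1, hi.2.le⟩
        omega

open Classical in
-- For a listed entry the `2 * θ` estimates are read from the table with stride `2 ^ n`; seeds that
-- miss the entry contribute the zero still in their cell. All of them lie in `[-M, M]` for `M` the
-- value of `rMax`, so bisection with rank `θ` yields an approximate median.
theorem run_addMedians {H : Instr → State → State → ℕ → Prop} [LocalInstr H]
    {s : State} (he : Env n k r θ s) {z : F2 n → ℝ} {t : ℕ → Fin D} {first tb m : ℕ}
    {pos : ℕ → ℕ} {val : ℕ → ℝ}
    (hg : Gathered h z t θ first tb m pos val (2 * θ) 0 s) (hfirst : s.word wFirst 0 = first) :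
    Run H addMedians s
      (forCost (s.word wLen 0)
        (forCost (2 * θ) 20 2 + forCost (n + 4) (forCost (2 * θ) 30 2 + 40) 2 + 50) 2)
      fun s' => ∀ e < s.word wLen 0, |s'.real rVec e - s.real rVec e| ≤ s.real rMax 0 ∧
        2 * θ ≤ 2 * (Finset.univ.filter fun i : Fin (2 * θ) =>
          |s'.real rVec e - s.real rVec e - z (decode n (s.word wList e))| ≤
            |estimate h z (t i) (decode n (s.word wList e)) - z (decode n (s.word wList e))| +
              2 * s.real rMax 0 / 2 ^ (n + 4)).card := by
  refine (Run.for (I := fun l s' => (∀ e < l, |s'.real rVec e - s.real rVec e| ≤ s.real rMax 0 ∧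
        2 * θ ≤ 2 * (Finset.univ.filter fun i : Fin (2 * θ) =>
          |s'.real rVec e - s.real rVec e - z (decode n (s.word wList e))| ≤
            |estimate h z (t i) (decode n (s.word wList e)) - z (decode n (s.word wList e))| +
              2 * s.real rMax 0 / 2 ^ (n + 4)).card) ∧
        ∀ e, l ≤ e → s'.real rVec e = s.real rVec e)
    (by decide) ?_ ?_ ?_).mono le_rfl fun s' hs' => hs'.1
  · intro s' hf; simp [hf.word wLen]
  · simp
  rintro l hl s' hf hv ⟨hI, hI'⟩
  have he' := he.mono hf
  set u := decode n (s.word wList l) with hu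
  have hul : encode u = s.word wList l := encode_decode (hg.list_lt l hl)
  have hest : ∀ i < 2 * θ, s.real rEst (first + i * 2 ^ n + encode u) = estimate h z (t i) u := by
    intro i hi
    have hd : Done h t (2 * θ) 0 i u := Or.inl hi
    rw [hg.est, if_pos hd]
  refine (Run.seqF (B₁ := 10) (B₂ := forCost (2 * θ) 20 2 +
      forCost (n + 4) (forCost (2 * θ) 30 2 + 40) 2 + 40)
    (R := fun a => a.word wOff 0 = first + encode u)
    (Run.straight ?_) fun s₁ hf₁ h₁ => ?_).mono (by omega) fun _ h => h
  · simp [Program.effect, hf.word wFirst, hfirst, hv, hf.word wList, hul]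
  have he₁ := he'.mono hf₁
  refine (Run.seqF (B₁ := forCost (2 * θ) 20 2) (B₂ :=
      forCost (n + 4) (forCost (2 * θ) 30 2 + 40) 2 + 40)
    (R := fun a => ∀ i < 2 * θ, a.real rTmp i = estimate h z (t i) u)
    ((Run.for (N := 2 * θ) (B := 20) (I := fun i a => a.word wOff 0 = first + i * 2 ^ n + encode u ∧
      ∀ i' < i, a.real rTmp i' = estimate h z (t i') u)
      (by decide) ?_ ?_ ?_).mono (by simp) fun a ha => ha.2) fun s₂ hf₂ h₂ => ?_).mono
    (by omega) fun _ h => h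
  · intro a hfa; simp [hfa.word wWidth, he₁.width]
  · simp [h₁]
  · rintro i hi a hfa hva ⟨hoff, hIa⟩
    have ee : a.real rEst = s.real rEst := by rw [hfa.real rEst, hf₁.real rEst, hf.real rEst]
    refine Run.straight ⟨?_, ?_⟩
    · simp [Program.effect, hoff, hfa.word wSize, he₁.size]; ring
    · intro i' hi'
      simp only [Program.effect, WExp.eval, RExp.eval, hva, hoff, ee, hest i hi, real_setWord,
        real_setReal, if_true, Function.update_apply]
      split_ifs with h'
      · rw [h']
      · exact hIa i' (by omega)
  have he₂ := he₁.mono hf₂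
  have eM₂ : s₂.real rMax = s.real rMax := by rw [hf₂.real rMax, hf₁.real rMax, hf.real rMax]
  refine (Run.seqF (B₁ := 25) (B₂ := forCost (n + 4) (forCost (2 * θ) 30 2 + 40) 2 + 15)
    (R := fun a => a.word wItems 0 = 2 * θ ∧ a.word wKappa 0 = θ ∧
      a.real rLo 0 = -s.real rMax 0 ∧ a.real rHi 0 = s.real rMax 0)
    (Run.straight ?_) fun s₃ hf₃ h₃ => ?_).mono (by omega) fun _ h => h
  · simp [Program.effect, he₂.width, he₂.half, eM₂]
  obtain ⟨hit, hka, hlo, hhi⟩ := h₃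
  have he₃ := he₂.mono hf₃
  have hrun := run_bisect (H := H) s₃ (by rw [hlo, hhi]; linarith [hg.max_nonneg])
  rw [he₃.pass, hit, hka, hlo, hhi] at hrun
  refine Run.seqF (B₂ := 15) hrun fun s₄ hf₄ h₄ => ?_
  have eT : s₃.real rTmp = s₂.real rTmp := hf₃.real rTmp
  have hmed := h₄.median (fun i hi => by
    rw [eT, h₂ i hi]
    exact hg.le_max i u (Or.inl hi)) hg.max_nonneg (z u)
  have eV : s₄.real rVec = s'.real rVec := by
    rw [hf₄.real rVec, hf₃.real rVec, hf₂.real rVec, hf₁.real rVec]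
  have eE : s₄.word wE 0 = l := by
    rw [hf₄.word wE, hf₃.word wE, hf₂.word wE, hf₁.word wE, hv]
  have hset : ∀ e, ((Program.setReal rVec (.var wE)
      (.add (.read rVec (.var wE)) (.var rLo))).effect s₄).real rVec e =
      if e = l then s.real rVec l + s₄.real rLo 0 else s'.real rVec e := by
    intro e
    simp [Program.effect, eV, eE, Function.update_apply, hI' l le_rfl]
  refine Run.straight ⟨?_, ?_⟩
  · intro e hel
    simp only [real_setWord, hset]
    split_ifs with h'
    · subst h'
      rw [add_sub_cancel_left]
      refine ⟨hmed.1, hmed.2.trans (le_of_eq ?_)⟩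
      congr 3
      funext i
      rw [eT, h₂ i i.2]
    · exact hI e (by omega)
  · intro e hel
    simp only [real_setWord, hset]
    rw [if_neg (by omega)]
    exact hI' e (by omega)

end Block

/-! ### Selection of nearly largest entries -/

section Select

variable {n k r θ : ℕ}

/-- The current vector consists of the listed entries with indices in `A`. -/
structure Selected (n : ℕ) (lst : ℕ → ℕ) (vec : ℕ → ℝ) (A : Finset ℕ) (s : State) : Prop where
  cnt_eq : s.word wCnt 0 = A.card
  mem : ∀ i < s.word wCnt 0, ∃ e ∈ A, s.word wPos i = lst e
  inj : ∀ i < s.word wCnt 0, ∀ i' < s.word wCnt 0, s.word wPos i = s.word wPos i' → i = i'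
  vec_eq : listVec n (s.word wCnt 0) (s.word wPos) (s.real rVal) =
    ∑ e ∈ A, Pi.single (decode n (lst e)) (vec e)

theorem Selected.append {lst : ℕ → ℕ} {vec : ℕ → ℝ} {A : Finset ℕ} {s : State}
    (hs : Selected n lst vec A s) {e : ℕ} (heA : e ∉ A) (hinj : ∀ e' ∈ A, lst e' ≠ lst e)
    (hE : s.word wE 0 = e) (hl : s.word wList = lst) (hv : s.real rVec = vec) :
    Selected n lst vec (insert e A) (appendEntry.effect s) := by
  have e1 : (appendEntry.effect s).word wCnt 0 = s.word wCnt 0 + 1 := by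
    simp [appendEntry, Program.effect]
  have e2 : ∀ i, (appendEntry.effect s).word wPos i =
      if i = s.word wCnt 0 then lst e else s.word wPos i := by
    intro i
    simp [appendEntry, Program.effect, Function.update_apply, hE, hl]
  have e3 : ∀ i, (appendEntry.effect s).real rVal i =
      if i = s.word wCnt 0 then vec e else s.real rVal i := by
    intro i
    simp [appendEntry, Program.effect, Function.update_apply, hE, hv]
  constructor
  · rw [e1, hs.cnt_eq, Finset.card_insert_of_notMem heA]
  · intro i hi
    rw [e1] at hi
    rw [e2]
    split_ifs with h1
    · exact ⟨e, Finset.mem_insert_self _ _, rfl⟩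
    · obtain ⟨e', h2, h3⟩ := hs.mem i (by omega)
      exact ⟨e', Finset.mem_insert_of_mem h2, h3⟩
  · intro i hi i' hi'
    rw [e1] at hi hi'
    rw [e2, e2]
    split_ifs with h1 h2 h2
    · omega
    · obtain ⟨e', h3, h4⟩ := hs.mem i' (by omega)
      intro h5
      exact absurd (h4.symm.trans h5.symm) (hinj e' h3)
    · obtain ⟨e', h3, h4⟩ := hs.mem i (by omega)
      intro h5
      exact absurd (h4.symm.trans h5) (hinj e' h3)
    · exact hs.inj i (by omega) i' (by omega)
  · rw [e1, listVec, Finset.sum_range_succ, Finset.sum_insert heA, ← hs.vec_eq, add_comm, listVec]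
    congr 1
    · simp [e2, e3]
    · refine Finset.sum_congr rfl fun i hi => ?_
      have := Finset.mem_range.1 hi
      rw [e2, e3, if_neg (by omega), if_neg (by omega)]

theorem Selected.congr {lst : ℕ → ℕ} {vec : ℕ → ℝ} {A : Finset ℕ} {s s' : State}
    (hs : Selected n lst vec A s) (h1 : s'.word wCnt = s.word wCnt)
    (h2 : s'.word wPos = s.word wPos) (h3 : s'.real rVal = s.real rVal) :
    Selected n lst vec A s' := by
  constructor
  · rw [h1]; exact hs.cnt_eq
  · rw [h1, h2]; exact hs.mem
  · rw [h1, h2]; exact hs.inj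
  · rw [h1, h2, h3]; exact hs.vec_eq

variable {H : Instr → State → State → ℕ → Prop} [LocalInstr H]

/-- The running time of `selectEntries`. -/
def selectCost (n len : ℕ) : ℕ :=
  forCost len 40 2 + (20 + (forCost (n + 4) (forCost len 30 2 + 40) 2 +
    (5 + (forCost len 60 2 + forCost len 60 2))))

open Classical in
-- Bisection with rank `k + 1` on the absolute values brackets a threshold. All entries above `hi`
-- are kept; entries in `[lo, hi]` fill up the free places. When all `k` places are taken, a
-- rejected entry is at most `hi` and a kept one at least `lo`, so they compare up to the width of
-- the bracket.
theorem run_selectEntries {s : State} (he : Env n k r θ s) {len : ℕ} (hlen : s.word wLen 0 = len)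
    {M : ℝ} (hM : s.real rMax 0 = M) (hM0 : 0 ≤ M)
    (hinj : ∀ e < len, ∀ e' < len, s.word wList e = s.word wList e' → e = e')
    (hsmall : ((Finset.range len).filter fun e => M < |s.real rVec e|).card ≤ k) :
    Run H selectEntries s (selectCost n len) fun s' => ∃ A ⊆ Finset.range len,
      Selected n (s.word wList) (s.real rVec) A s' ∧ A.card ≤ k ∧
      (A = Finset.range len ∨ (A.card = k ∧ ∀ e ∈ A, ∀ e' < len, e' ∉ A →
        |s.real rVec e'| ≤ |s.real rVec e| + M / 2 ^ (n + 4))) := by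
  refine Run.seqF (B₁ := forCost len 40 2) (R := fun a => ∀ e < len, a.real rTmp e = |s.real rVec e|)
    ((Run.for (N := len) (B := 40) (I := fun m a => ∀ e < m, a.real rTmp e = |s.real rVec e|)
      (by decide) ?_ ?_ ?_).mono (by simp) fun _ h => h) fun s₁ hf₁ h₁ => ?_
  · intro a hfa; simp [hfa.word wLen, hlen]
  · simp
  · intro m hm a hfa hva hI
    refine Run.straight fun e hem => ?_
    simp only [Program.effect, Test.holds, RExp.eval, WExp.eval, hva, hfa.real rVec, Rat.cast_zero,
      zero_sub]
    split_ifs with h0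
    · simp only [real_setReal, real_setWord, if_true, Function.update_apply]
      split_ifs with h1
      · rw [h1, abs_of_nonneg h0]
      · exact hI e (by omega)
    · simp only [real_setReal, real_setWord, if_true, Function.update_apply]
      split_ifs with h1
      · rw [h1, abs_of_neg (not_le.1 h0)]
      · exact hI e (by omega)
  have he₁ := he.mono hf₁
  refine Run.seqF (B₁ := 20) (R := fun a => a.word wItems 0 = len ∧ a.word wKappa 0 = k + 1 ∧
      a.real rLo 0 = 0 ∧ a.real rHi 0 = M)
    (Run.straight ?_) fun s₂ hf₂ h₂ => ?_
  · simp [Program.effect, he₁.k_eq, hf₁.word wLen, hlen, hf₁.real rMax, hM]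
  obtain ⟨hit, hka, hlo, hhi⟩ := h₂
  have he₂ := he₁.mono hf₂
  have hrun := run_bisect (H := H) s₂ (by rw [hlo, hhi]; exact hM0)
  rw [he₂.pass, hit, hka, hlo, hhi] at hrun
  refine Run.seqF hrun fun s₃ hf₃ h₃ => ?_
  set lo := s₃.real rLo 0 with hlodef
  set hi := s₃.real rHi 0 with hhidef
  have eT : ∀ e < len, s₂.real rTmp e = |s.real rVec e| := by
    intro e hel
    rw [hf₂.real rTmp, h₁ e hel]
  have eT₃ : ∀ e < len, s₃.real rTmp e = |s.real rVec e| := by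
    intro e hel
    rw [hf₃.real rTmp, eT e hel]
  have hwid : hi - lo = M / 2 ^ (n + 4) := by rw [h₃.width, sub_zero]
  have eV₃ : s₃.real rVec = s.real rVec := by rw [hf₃.real rVec, hf₂.real rVec, hf₁.real rVec]
  have eL₃ : s₃.word wList = s.word wList := by rw [hf₃.word wList, hf₂.word wList, hf₁.word wList]
  have eN₃ : s₃.word wLen 0 = len := by rw [hf₃.word wLen, hf₂.word wLen, hf₁.word wLen, hlen]
  have he₃ := he₂.mono hf₃
  -- These entries fit into `k` places: either fewer than `k + 1` values reach `hi`, or `hi` is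
  -- still `M` and `hsmall` applies.
  set A₁ := (Finset.range len).filter fun e => hi < |s.real rVec e| with hA₁
  have hA₁k : A₁.card ≤ k := by
    rcases h₃.hi_count with h4 | h4
    · rw [hA₁, h4]; exact hsmall
    · have : A₁.card ≤ countGe (s₂.real rTmp) len hi := by
        refine Finset.card_le_card fun e hmem => ?_
        simp only [hA₁, Finset.mem_filter, Finset.mem_range] at hmem ⊢
        rw [eT e hmem.1]
        exact ⟨hmem.1, hmem.2.le⟩
      omega
  refine Run.seqF (B₁ := 5) (R := fun a => a.word wCnt 0 = 0)
    (Run.straight (by simp [Program.effect])) fun s₄ hf₄ h₄ => ?_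
  have eV₄ : s₄.real rVec = s.real rVec := by rw [hf₄.real rVec, eV₃]
  have eL₄ : s₄.word wList = s.word wList := by rw [hf₄.word wList, eL₃]
  have eN₄ : s₄.word wLen 0 = len := by rw [hf₄.word wLen, eN₃]
  have eH₄ : s₄.real rHi 0 = hi := by rw [hf₄.real rHi]
  have eO₄ : s₄.real rLo 0 = lo := by rw [hf₄.real rLo]
  have eT₄ : ∀ e < len, s₄.real rTmp e = |s.real rVec e| := by
    intro e hel
    rw [hf₄.real rTmp, eT₃ e hel]
  have he₄ := he₃.mono hf₄
  refine Run.seqF (B₁ := forCost len 60 2) (R := Selected n (s.word wList) (s.real rVec) A₁)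
    ((Run.for (N := len) (B := 60) (I := fun m a => Selected n (s.word wList) (s.real rVec)
      ((Finset.range m).filter fun e => hi < |s.real rVec e|) a)
      (by decide) ?_ ?_ ?_).mono (by simp) fun _ h => h) fun s₅ hf₅ h₅ => ?_
  · intro a hfa; simp [hfa.word wLen, eN₄]
  · constructor <;> simp [h₄, listVec]
  · intro m hm a hfa hva hI
    refine Run.straight ?_
    refine Selected.congr (s := (Program.ite (.leReal (.read rTmp (.var wE)) (.var rHi)) .skip
      appendEntry).effect a) ?_ (by simp) (by simp) (by simp)
    have hT := eT₄ m hm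
    simp only [Program.effect, Test.holds, RExp.eval, WExp.eval, hva, hfa.real rTmp, hfa.real rHi,
      eH₄, hT]
    rw [Finset.range_add_one, Finset.filter_insert]
    by_cases hc : |s.real rVec m| ≤ hi
    · rw [if_pos hc, if_neg (not_lt.2 hc)]
      exact hI
    · rw [if_neg hc, if_pos (not_le.1 hc)]
      refine hI.append (by simp) ?_ hva (by rw [hfa.word wList, eL₄]) (by rw [hfa.real rVec, eV₄])
      intro e' he'
      have h6 := Finset.mem_range.1 (Finset.mem_filter.1 he').1
      intro h7
      have := hinj e' (by omega) m hm h7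
      omega
  have eV₅ : s₅.real rVec = s.real rVec := by rw [hf₅.real rVec, eV₄]
  have eL₅ : s₅.word wList = s.word wList := by rw [hf₅.word wList, eL₄]
  have eN₅ : s₅.word wLen 0 = len := by rw [hf₅.word wLen, eN₄]
  have eH₅ : s₅.real rHi 0 = hi := by rw [hf₅.real rHi, eH₄]
  have eO₅ : s₅.real rLo 0 = lo := by rw [hf₅.real rLo, eO₄]
  have eT₅ : ∀ e < len, s₅.real rTmp e = |s.real rVec e| := by
    intro e hel
    rw [hf₅.real rTmp, eT₄ e hel]
  have he₅ := he₄.mono hf₅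
  -- The kept set depends on the order of the scan and is therefore quantified in the invariant;
  -- either it is full, or no entry scanned so far with value at least `lo` was rejected.
  refine (Run.for (N := len) (B := 60) (I := fun m a => ∃ A, A₁ ⊆ A ∧ A ⊆ Finset.range len ∧
      Selected n (s.word wList) (s.real rVec) A a ∧ A.card ≤ k ∧
      (∀ e ∈ A, lo ≤ |s.real rVec e|) ∧ (∀ e ∈ A, e ∈ A₁ ∨ e < m) ∧
      (A.card = k ∨ ∀ e < m, lo ≤ |s.real rVec e| → e ∈ A))
      (by decide) ?_ ?_ ?_).mono (by simp) ?_
  · intro a hfa; simp [hfa.word wLen, eN₅]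
  · refine ⟨A₁, subset_rfl, Finset.filter_subset _ _,
      h₅.congr (by simp) (by simp) (by simp), hA₁k, ?_, fun e he' => Or.inl he', Or.inr (by simp)⟩
    intro e he'
    have := (Finset.mem_filter.1 he').2
    have h6 : 0 ≤ M / 2 ^ (n + 4) := by positivity
    linarith
  · rintro m hm a hfa hva ⟨A, hA₁A, hAr, hsel, hAk, hAlo, hAm, hAc⟩
    refine Run.straight ?_
    have hT := eT₅ m hm
    have heff : ∀ A', Selected n (s.word wList) (s.real rVec) A' ((Program.ite (.conj (.conj
        (.leReal (.var rLo) (.read rTmp (.var wE)))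
        (.leReal (.read rTmp (.var wE)) (.var rHi))) (.neg (.leWord (.read 0 (.lit 1)) (.var wCnt))))
      appendEntry .skip).effect a) → Selected n (s.word wList) (s.real rVec) A'
        (((Program.ite (.conj (.conj (.leReal (.var rLo) (.read rTmp (.var wE)))
        (.leReal (.read rTmp (.var wE)) (.var rHi))) (.neg (.leWord (.read 0 (.lit 1)) (.var wCnt))))
      appendEntry .skip).effect a).setWord wE 0 (m + 1)) :=
      fun A' h => h.congr (by simp) (by simp) (by simp)
    simp only [Program.effect, Test.holds, RExp.eval, WExp.eval, hva, hfa.real rTmp, hfa.real rHi,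
      hfa.real rLo, eH₅, eO₅, hT, hfa.word 0, he₅.k_eq, hsel.cnt_eq, not_le] at heff ⊢
    by_cases hc : (lo ≤ |s.real rVec m| ∧ |s.real rVec m| ≤ hi) ∧ A.card < k
    · have hmA : m ∉ A := by
        intro hmA
        rcases hAm m hmA with h6 | h6
        · have := (Finset.mem_filter.1 h6).2
          linarith [hc.1.2]
        · omega
      refine ⟨insert m A, hA₁A.trans (Finset.subset_insert _ _),
        Finset.insert_subset (Finset.mem_range.2 hm) hAr, heff _ ?_, ?_, ?_, ?_, ?_⟩
      · rw [if_pos hc]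
        refine hsel.append hmA ?_ hva (by rw [hfa.word wList, eL₅]) (by rw [hfa.real rVec, eV₅])
        intro e' he' h7
        have := hinj e' (Finset.mem_range.1 (hAr he')) m hm h7
        exact hmA (this ▸ he')
      · rw [Finset.card_insert_of_notMem hmA]; omega
      · intro e he'
        rcases Finset.mem_insert.1 he' with rfl | h6
        · exact hc.1.1
        · exact hAlo e h6
      · intro e he'
        rcases Finset.mem_insert.1 he' with rfl | h6
        · right; omega
        · rcases hAm e h6 with h7 | h7
          · exact Or.inl h7
          · right; omega
      · rcases hAc with h6 | h6
        · omega
        · right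
          intro e hel hle
          rcases Nat.lt_succ_iff_lt_or_eq.1 hel with h7 | rfl
          · exact Finset.mem_insert_of_mem (h6 e h7 hle)
          · exact Finset.mem_insert_self _ _
    · refine ⟨A, hA₁A, hAr, heff _ ?_, hAk, hAlo, ?_, ?_⟩
      · rw [if_neg hc]; exact hsel
      · intro e he'
        rcases hAm e he' with h7 | h7
        · exact Or.inl h7
        · right; omega
      · rcases hAc with h6 | h6
        · exact Or.inl h6
        · by_cases h8 : A.card = k
          · exact Or.inl h8
          right
          intro e hel hle
          rcases Nat.lt_succ_iff_lt_or_eq.1 hel with h7 | rfl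
          · exact h6 e h7 hle
          · refine hA₁A (Finset.mem_filter.2 ⟨Finset.mem_range.2 hm, ?_⟩)
            by_contra h9
            exact hc ⟨⟨hle, not_lt.1 h9⟩, by omega⟩
  · rintro a ⟨A, hA₁A, hAr, hsel, hAk, hAlo, -, hAc⟩
    refine ⟨A, hAr, hsel, hAk, ?_⟩
    by_cases hcard : A.card = k
    · right
      refine ⟨hcard, fun e he' e' hel heA => ?_⟩
      have h6 := hAlo e he'
      have h7 : |s.real rVec e'| ≤ hi := by
        by_contra h8
        exact heA (hA₁A (Finset.mem_filter.2 ⟨Finset.mem_range.2 hel, not_le.1 h8⟩))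
      linarith
    · left
      have hAc' := hAc.resolve_left hcard
      refine Finset.Subset.antisymm hAr fun e hel => ?_
      rw [Finset.mem_range] at hel
      refine hAc' e hel ?_
      -- With a place left free, everything from `lo` upwards was kept. If `lo` had moved, that
      -- would be `k + 1` entries; so `lo = 0` and everything was kept.
      rcases h₃.lo_count with h6 | h6
      · rw [h6]; exact abs_nonneg _
      · exfalso
        have : countGe (s₂.real rTmp) len lo ≤ A.card := by
          refine Finset.card_le_card fun e' hmem => ?_
          simp only [Finset.mem_filter, Finset.mem_range] at hmem
          refine hAc' e' hmem.1 ?_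
          rw [← eT e' hmem.1]
          exact hmem.2
        omega

end Select

/-! ### Vectors given by lists -/

theorem forCost_mono {N N' B B' c : ℕ} (hN : N ≤ N') (hB : B ≤ B') :
    forCost N B c ≤ forCost N' B' c := by
  unfold forCost
  gcongr

theorem sum_single_apply {ι κ : Type*} [DecidableEq κ] {A : Finset ι} {f : ι → κ} (g : ι → ℝ)
    (hf : Set.InjOn f A) {e : ι} (he : e ∈ A) :
    (∑ e ∈ A, Pi.single (f e) (g e) : κ → ℝ) (f e) = g e := by
  rw [Finset.sum_apply, Finset.sum_eq_single_of_mem e he]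
  · simp
  · intro e' he' hne
    rw [Pi.single_apply, if_neg]
    exact fun h => hne (hf he' he h.symm)

theorem sum_single_apply_eq_zero {ι κ : Type*} [DecidableEq κ] {A : Finset ι} {f : ι → κ}
    (g : ι → ℝ) {u : κ} (hu : ∀ e ∈ A, f e ≠ u) :
    (∑ e ∈ A, Pi.single (f e) (g e) : κ → ℝ) u = 0 := by
  rw [Finset.sum_apply, Finset.sum_eq_zero]
  intro e he
  rw [Pi.single_apply, if_neg]
  exact fun h => hu e he h.symm

theorem isSparse_sum_single {ι κ : Type*} [Fintype κ] [DecidableEq κ] (A : Finset ι) (f : ι → κ)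
    (g : ι → ℝ) : IsSparse A.card (∑ e ∈ A, Pi.single (f e) (g e) : κ → ℝ) := by
  classical
  refine (Set.ncard_le_ncard (t := (A.image f : Set κ)) ?_ (Finset.finite_toSet _)).trans ?_
  · intro u hu
    by_contra hn
    refine hu (sum_single_apply_eq_zero g fun e he h => hn ?_)
    exact Finset.mem_coe.2 (Finset.mem_image.2 ⟨e, he, h⟩)
  · rw [Set.ncard_coe_finset]
    exact Finset.card_image_le

theorem isSparse_output {n k : ℕ} {s : State} (hs : s.word wCnt 0 ≤ k) :
    IsSparse k (output n s) := by
  have := isSparse_sum_single (Finset.range (s.word wCnt 0)) (fun i => decode n (s.word wPos i))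
    (s.real rVal)
  rw [Finset.card_range] at this
  exact le_trans this hs

/-! ### Correctness and cost of a block -/

section Block

variable {n r D k θ : ℕ} {Q : Program Empty} {h : F2 n → Fin D → F2 r} {x : F2 n → ℝ}
  {ω : ℕ → Fin D}

/-- A seed assigns values to at most `2 ^ r` entries. -/
theorem card_hits_le (z : F2 n → ℝ) (t : Fin D) (A : Finset (F2 n))
    (hA : ∀ u ∈ A, Hits h z t u) : A.card ≤ 2 ^ r := by
  have := Finset.card_le_card_of_injOn (s := A) (t := (Finset.univ : Finset (F2 r)))
    (fun u => h u t) (by simp) (fun u hu v hv huv => by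
      have h1 := hA u hu
      have h2 := hA v hv
      rw [Hits] at h1 h2
      simp only at huv
      rw [← h1, huv, h2])
  simpa [ZMod.card] using this

/-- Double counting: a new entry has at least `θ` hits, and each of the `2 * θ` seeds hits at most
`2 ^ r` entries. -/
theorem Gathered.len_le {z : F2 n → ℝ} {t : ℕ → Fin D} {first tb m : ℕ} {pos : ℕ → ℕ}
    {val : ℕ → ℝ} {s : State}
    (hg : Gathered h z t θ first tb m pos val (2 * θ) 0 s) (hθ : 1 ≤ θ) :
    s.word wLen 0 ≤ m + 2 * 2 ^ r := by
  classical
  set len := s.word wLen 0 with hlen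
  set A : Finset (F2 n) := (Finset.Ico m len).image fun e => decode n (s.word wList e) with hA
  have hAc : A.card = len - m := by
    rw [hA, Finset.card_image_of_injOn, Nat.card_Ico]
    intro e he e' he' heq
    simp only [Finset.coe_Ico, Set.mem_Ico] at he he'
    exact hg.list_inj e he.2 e' he'.2
      (decode_inj (hg.list_lt e he.2) (hg.list_lt e' he'.2) heq)
  have hcount : ∀ u ∈ A, θ ≤ hitCount h z t (2 * θ) 0 u := by
    intro u hu
    obtain ⟨e, he, rfl⟩ := Finset.mem_image.1 hu
    rw [Finset.mem_Ico] at he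
    have hee : encode (decode n (s.word wList e)) = s.word wList e :=
      encode_decode (hg.list_lt e he.2)
    rcases (hg.list_new _).1 ⟨e, he.2, hee.symm⟩ with ⟨e', h1, h2⟩ | h1
    · exfalso
      rw [hee, ← hg.list_old e' h1] at h2
      have := hg.list_inj e' (by omega) e he.2 h2
      omega
    · exact h1
  have h1 : A.card * θ ≤ ∑ u ∈ A, hitCount h z t (2 * θ) 0 u := by
    rw [← smul_eq_mul]
    exact Finset.card_nsmul_le_sum _ _ _ hcount
  have h2 : ∑ u ∈ A, hitCount h z t (2 * θ) 0 u ≤ 2 * θ * 2 ^ r := by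
    simp only [hitCount, not_lt_zero, and_false, if_false, add_zero]
    rw [Finset.sum_comm]
    refine (Finset.sum_le_card_nsmul _ _ (2 ^ r) fun i _ => ?_).trans (by simp)
    rw [← Finset.card_filter]
    exact card_hits_le z (t i) _ fun u hu => (Finset.mem_filter.1 hu).2
  have h3 : A.card * θ ≤ 2 * 2 ^ r * θ := by
    calc A.card * θ ≤ 2 * θ * 2 ^ r := h1.trans h2
      _ = 2 * 2 ^ r * θ := by ring
  have h4 := Nat.le_of_mul_le_mul_right h3 (by omega)
  omega

/-- A bound on the running time of `improve`. -/
def improveCost (n k r θ F : ℕ) : ℕ :=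
  (10 + forCost k 40 2 + 10) + (gatherCost n r θ k F +
    (forCost (k + 2 * 2 ^ r)
        (forCost (2 * θ) 20 2 + forCost (n + 4) (forCost (2 * θ) 30 2 + 40) 2 + 50) 2 +
      (selectCost n (k + 2 * 2 ^ r) + 10)))

theorem selectCost_mono {l l' : ℕ} (hl : l ≤ l') : selectCost n l ≤ selectCost n l' := by
  unfold selectCost
  have h1 : ∀ B, forCost l B 2 ≤ forCost l' B 2 := fun B => forCost_mono hl le_rfl
  have h2 : forCost (n + 4) (forCost l 30 2 + 40) 2 ≤ forCost (n + 4) (forCost l' 30 2 + 40) 2 :=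
    forCost_mono le_rfl (by have := h1 30; omega)
  have := h1 40
  have := h1 60
  omega

open Classical in
-- The deterministic part of the analysis: the memory is ready for the next block whatever the seeds
-- are, and the error contracts whenever at most a quarter of them are bad.
theorem run_improve {F : ℕ} (hQ : ComputesWithin Q k h F) {s : State} (hs : Ready n k r θ s)
    (hθ : 1 ≤ θ) (hkn : k ≤ 2 ^ n) :
    Run (Sem k Q h x ω) improve s (improveCost n k r θ F) fun s' =>
      Ready n k r θ s' ∧ s'.drawn = s.drawn + 2 * θ ∧
      (4 * (Finset.univ.filter fun i : Fin (2 * θ) =>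
        ¬ l1 (x - output n s - estimate h (x - output n s) (ω (s.drawn + i))) ≤
          l1 (x - output n s) / 64 + 8 * l1 (x - headApprox k x)).card ≤ 2 * θ →
        l1 (x - output n s') ≤ l1 (x - output n s) / 2 + 65 * l1 (x - headApprox k x)) := by
  set t : ℕ → Fin D := fun i => ω (s.drawn + i) with ht
  set x' := output n s with hx'
  set z := x - x' with hz
  have hcnt := hs.cnt_le
  refine Run.seqF ((run_startBlock (h := h) hs hθ z t).mono (B' := 10 + forCost k 40 2 + 10)
    (by have := forCost_mono (B := 40) (c := 2) hcnt le_rfl; omega) fun _ h => h)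
    fun s₁ hf₁ h₁ => ?_
  obtain ⟨hg₁, hfirst₁⟩ := h₁
  have he₁ := hs.env.mono hf₁
  have ec₁ : s₁.word wCnt = s.word wCnt := hf₁.word wCnt
  have ep₁ : s₁.word wPos = s.word wPos := hf₁.word wPos
  have ev₁ : s₁.real rVal = s.real rVal := hf₁.real rVal
  have ed₁ : s₁.drawn = s.drawn := hf₁.drawn
  have hrun₁ := run_gatherBlock (x := x) (ω := ω) hQ he₁ (by rw [ec₁, ep₁]; exact hs.pos_lt)
    (by rw [ec₁, ep₁, ev₁]; rfl) (by intro i _; rw [ed₁]) hg₁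
  rw [ec₁, ed₁] at hrun₁
  refine Run.seqF (hrun₁.mono (B' := gatherCost n r θ k F) ?_ fun _ h => h) fun s₂ hf₂ h₂ => ?_
  · unfold gatherCost
    refine forCost_mono le_rfl ?_
    have := forCost_mono (B := F + forCost n 60 2 + 50) (c := 2) hcnt le_rfl
    omega
  obtain ⟨hg₂, ed₂⟩ := h₂
  have he₂ := he₁.mono hf₂
  have hlen := (hg₂.len_le hθ).trans (Nat.add_le_add_right hcnt _)
  set len := s₂.word wLen 0 with hlendef
  set M := s₂.real rMax 0 with hMdef
  set lst := s₂.word wList with hlst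
  refine Run.seqF ((run_addMedians he₂ hg₂ (by rw [hf₂.word wFirst, hfirst₁])).mono
    (forCost_mono hlen le_rfl) fun _ h => h) fun s₃ hf₃ h₃ => ?_
  have he₃ := he₂.mono hf₃
  have el₃ : s₃.word wList = lst := hf₃.word wList
  have en₃ : s₃.word wLen 0 = len := by rw [hf₃.word wLen]
  have em₃ : s₃.real rMax 0 = M := by rw [hf₃.real rMax]
  have hM0 : 0 ≤ M := hg₂.max_nonneg
  set old : ℕ → ℝ := s₂.real rVec with hold
  set vec : ℕ → ℝ := s₃.real rVec with hvec
  have hoe : ∀ e < len, s.word wCnt 0 ≤ e → old e = 0 := by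
    intro e hel hce
    rw [hold, hg₂.vec e hel, if_neg (by omega)]
  -- A newly listed entry equals its median, which is at most `M`; only the at most `k` old entries
  -- can be larger.
  have hsmall : ((Finset.range len).filter fun e => M < |vec e|).card ≤ k := by
    refine le_trans ?_ hcnt
    rw [← Finset.card_range (s.word wCnt 0)]
    refine Finset.card_le_card fun e hmem => ?_
    simp only [Finset.mem_filter, Finset.mem_range] at hmem ⊢
    by_contra hce
    have h4 := (h₃ e hmem.1).1
    have h5 := hoe e hmem.1 (by omega)
    change |vec e - old e| ≤ M at h4
    rw [h5, sub_zero] at h4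
    linarith [hmem.2]
  refine Run.seqF ((run_selectEntries he₃ en₃ em₃ hM0 (by rw [el₃]; exact hg₂.list_inj)
    hsmall).mono (selectCost_mono hlen) fun _ h => h) fun s₄ hf₄ h₄ => ?_
  obtain ⟨A, hAr, hsel, hAk, hAc⟩ := h₄
  rw [el₃] at hsel
  have he₄ := he₃.mono hf₄
  have et₄ : s₄.word wTBase 0 = s.word wTBase 0 := by
    rw [hf₄.word wTBase, hf₃.word wTBase, hg₂.tbase]
  have eto₄ : s₄.word wTouch = s₂.word wTouch := by rw [hf₄.word wTouch, hf₃.word wTouch]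
  have er₄ : s₄.word wRow 0 = s.word wRow 0 + 2 * θ * 2 ^ n := by
    rw [hf₄.word wRow, hf₃.word wRow, hg₂.row]
  have ee₄ : s₄.real rEst = s₂.real rEst := by rw [hf₄.real rEst, hf₃.real rEst]
  have ed₄ : s₄.drawn = s.drawn + 2 * θ := by rw [hf₄.drawn, hf₃.drawn, ed₂]
  have e5 : ∀ a, a ≠ wTBase → ((incW wTBase (.var wSize)).effect s₄).word a = s₄.word a := by
    intro a ha
    simp [Program.effect, ha]
  have e6 : ((incW wTBase (.var wSize)).effect s₄).word wTBase 0 = s.word wTBase 0 + 2 ^ n := by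
    simp [Program.effect, et₄, he₄.size]
  have e7 : ((incW wTBase (.var wSize)).effect s₄).real = s₄.real := rfl
  have hdec : Set.InjOn (fun e => decode n (lst e)) (Finset.range len : Set ℕ) := by
    intro e hel e' hel' heq
    simp only [Finset.coe_range, Set.mem_Iio] at hel hel'
    exact hg₂.list_inj e hel e' hel' (decode_inj (hg₂.list_lt e hel) (hg₂.list_lt e' hel') heq)
  refine Run.straight ⟨?_, by simpa [Program.effect] using ed₄, ?_⟩
  · constructor
    · exact he₄.mono (ws := [wTBase]) (rs := []) (d := true)
        ⟨fun a ha => e5 a (by simpa using ha), fun a _ => rfl, by simp⟩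
    · rw [e5 _ (by decide), hsel.cnt_eq]; exact hAk
    · rw [e5 _ (by decide), e5 _ (by decide)]
      intro e hel
      obtain ⟨e', h6, h7⟩ := hsel.mem e hel
      rw [h7]
      exact hg₂.list_lt e' (Finset.mem_range.1 (hAr h6))
    · rw [e5 _ (by decide), e5 _ (by decide)]
      exact hsel.inj
    · intro c hc
      rw [e6] at hc
      rw [e5 _ (by decide), eto₄]
      exact hg₂.fresh c hc
    · intro c hc
      rw [e5 _ (by decide), er₄] at hc
      rw [e7, ee₄]
      obtain ⟨c', rfl⟩ := Nat.exists_eq_add_of_le hc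
      -- Every cell from the next block's region on lies in a row `2 * θ` or later of the estimate
      -- table, where no seed has written.
      have h6 : s.word wRow 0 + 2 * θ * 2 ^ n + c' = s.word wRow 0 +
          (2 * θ + c' / 2 ^ n) * 2 ^ n + encode (decode n (c' % 2 ^ n)) := by
        rw [encode_decode (Nat.mod_lt _ (by positivity)), add_mul]
        have := Nat.div_add_mod' c' (2 ^ n)
        omega
      rw [h6, hg₂.est, if_neg]
      simp [Done]
  · intro hbad
    have hout : output n ((incW wTBase (.var wSize)).effect s₄) =
        ∑ e ∈ A, Pi.single (decode n (lst e)) (vec e) := by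
      rw [← hsel.vec_eq]
      rw [output, e5 _ (by decide), e5 _ (by decide), e7, listVec]
    rw [hout]
    -- On listed entries `w` is the computed median, elsewhere zero; thus `x' + w` is the vector
    -- that enters the selection.
    set w : F2 n → ℝ := ∑ e ∈ Finset.range len, Pi.single (decode n (lst e)) (vec e - old e) with hw
    have hx'' : x' = ∑ e ∈ Finset.range len, Pi.single (decode n (lst e)) (old e) := by
      have h6 : Finset.range (s.word wCnt 0) ⊆ Finset.range len := by
        simpa using hg₂.len_ge
      rw [← Finset.sum_subset h6, hx', output]
      · refine Finset.sum_congr rfl fun e he => ?_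
        rw [Finset.mem_range] at he
        rw [hlst, hg₂.list_old e he, hold, hg₂.vec e (lt_of_lt_of_le he hg₂.len_ge), if_pos he]
      · intro e he he'
        rw [Finset.mem_range] at he he'
        rw [hoe e he (by omega), Pi.single_zero]
    have hv : x' + w = ∑ e ∈ Finset.range len, Pi.single (decode n (lst e)) (vec e) := by
      rw [hx'', hw, ← Finset.sum_add_distrib]
      refine Finset.sum_congr rfl fun e _ => ?_
      rw [← Pi.single_add, add_sub_cancel]
    have hve : ∀ e < len, (x' + w) (decode n (lst e)) = vec e := by
      intro e he
      rw [hv]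
      exact sum_single_apply vec hdec (Finset.mem_range.2 he)
    have hwe : ∀ e < len, w (decode n (lst e)) = vec e - old e := by
      intro e he
      rw [hw]
      exact sum_single_apply (fun e => vec e - old e) hdec (Finset.mem_range.2 he)
    have hdecA : Set.InjOn (fun e => decode n (lst e)) (A : Set ℕ) :=
      hdec.mono (by exact_mod_cast hAr)
    set K : Finset (F2 n) := A.image fun e => decode n (lst e) with hK
    have hKc : K.card = A.card := Finset.card_image_of_injOn hdecA
    refine l1_sub_le_of_block (W := 2 * θ) (by omega) hkn x x' w _ (fun i => ω (s.drawn + i)) M hM0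
      hg₂.max_le hbad ?_ K ?_ ?_ ?_
    · intro u
      by_cases hu : ∃ e < len, lst e = encode u
      · obtain ⟨e, he, heu⟩ := hu
        have h6 := (h₃ e he).2
        have h7 : decode n (s₂.word wList e) = u := by rw [← hlst, heu, decode_encode]
        rw [h7] at h6
        have h8 := hwe e he
        rw [heu, decode_encode] at h8
        rw [h8]
        exact h6
      · have h6 : w u = 0 := by
          rw [hw]
          refine sum_single_apply_eq_zero _ fun e he h7 => hu ⟨e, Finset.mem_range.1 he, ?_⟩
          rw [← h7, encode_decode (hg₂.list_lt e (Finset.mem_range.1 he))]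
        -- An unlisted entry has fewer than `θ` hits, so more than half of its estimates are zero,
        -- and `w u = 0` is as close to the residual as these.
        have h7 : ¬ θ ≤ hitCount h z t (2 * θ) 0 u := fun h8 =>
          hu ((hg₂.list_new u).2 (Or.inr h8))
        simp only [hitCount, not_lt_zero, and_false, if_false, add_zero] at h7
        rw [Finset.sum_range fun i => if Hits h z (t i) u then 1 else 0, ← Finset.card_filter] at h7
        have h8 := Finset.card_filter_add_card_filter_not
          (s := (Finset.univ : Finset (Fin (2 * θ)))) fun i => Hits h z (t i) u
        rw [Finset.card_univ, Fintype.card_fin] at h8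
        have h9 : (Finset.univ.filter fun i : Fin (2 * θ) => ¬ Hits h z (t i) u).card ≤
            (Finset.univ.filter fun i : Fin (2 * θ) => |w u - (x - x') u| ≤
              |estimate h (x - x') (ω (s.drawn + i)) u - (x - x') u| +
                2 * M / 2 ^ (n + 4)).card := by
          refine Finset.card_le_card fun i hi => ?_
          simp only [Finset.mem_filter, Finset.mem_univ, true_and] at hi ⊢
          rw [Hits] at hi
          have h10 : estimate h (x - x') (ω (s.drawn + i)) u = 0 := by
            rw [estimate, if_neg hi]
          rw [h10, h6]
          have : 0 ≤ 2 * M / 2 ^ (n + 4) := by positivity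
          linarith
        omega
    · intro u hu
      obtain ⟨e, he, rfl⟩ := Finset.mem_image.1 hu
      rw [hve e (Finset.mem_range.1 (hAr he))]
      exact sum_single_apply vec hdecA he
    · intro u hu
      refine sum_single_apply_eq_zero vec fun e he h6 => hu ?_
      exact Finset.mem_image.2 ⟨e, he, h6⟩
    · have hunl : ∀ u, (¬ ∃ e < len, decode n (lst e) = u) → (x' + w) u = 0 := by
        intro u hu
        rw [hv]
        exact sum_single_apply_eq_zero vec fun e he h6 => hu ⟨e, Finset.mem_range.1 he, h6⟩
      rcases hAc with hAc | ⟨hAc, hcmp⟩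
      · left
        intro u hu
        refine hunl u ?_
        rintro ⟨e, he, h6⟩
        exact hu (Finset.mem_image.2 ⟨e, by rw [hAc]; exact Finset.mem_range.2 he, h6⟩)
      · right
        refine ⟨hKc.trans hAc, fun u hu u' hu' => ?_⟩
        obtain ⟨e, he, rfl⟩ := Finset.mem_image.1 hu
        rw [hve e (Finset.mem_range.1 (hAr he))]
        by_cases h6 : ∃ e' < len, decode n (lst e') = u'
        · obtain ⟨e', he', rfl⟩ := h6
          rw [hve e' he']
          exact hcmp e he e' he' fun h7 => hu' (Finset.mem_image.2 ⟨e', h7, rfl⟩)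
        · rw [hunl u' h6, abs_zero]
          positivity

end Block

/-! ## Preparations -/

/-- Compute the power of two with exponent `e`. -/
def powerOfTwo (a v : ℕ) (e : WExp) : Program Instr :=
  letW a (.lit 1) ;; forLoop v e (incW a (.var a))

/-- Compute the constants of the algorithm. -/
def prepare : Program Instr :=
  powerOfTwo wBins wJ (.read 0 (.lit 2)) ;;
  powerOfTwo wSize wJ (.read 0 (.lit 0)) ;;
  letW wPass (.add (.read 0 (.lit 0)) (.lit 4)) ;;
  (letW wBlocks (.lit 1) ;; letR rFrac (.lit (1 / 2)) ;; letR rNum (.lit 1)) ;;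
  .loop (.neg (.leReal (.var rFrac) (.read 0 (.lit 1))))
    (letR rFrac (.div (.var rFrac) (.lit 2)) ;; incW wBlocks (.lit 1) ;;
      letR rNum (.add (.var rNum) (.lit 1))) ;;
  (letW wHalf (.lit 1) ;; letR rFrac (.div (.var rNum) (.lit 2))) ;;
  .loop (.neg (.leReal (.var rFrac) (.read 0 (.lit 0))))
    (letR rFrac (.div (.var rFrac) (.lit 2)) ;; incW wHalf (.lit 1)) ;;
  letW wWidth (.add (.var wHalf) (.var wHalf))

/-- The recovery algorithm. -/
def recover : Program Instr :=
  prepare ;; forLoop wB (.var wBlocks) improve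

section Prepare

variable {H : Instr → State → State → ℕ → Prop} [LocalInstr H]

theorem run_powerOfTwo {s : State} {a v : ℕ} {e : WExp} {N : ℕ} (hav : a ≠ v)
    (he : ∀ s', FrameOn [a, v] [] false s s' → e.eval s' = N) :
    Run H (powerOfTwo a v e) s (5 + forCost N 10 e.cost) fun s' => s'.word a 0 = 2 ^ N := by
  refine Run.seqF (B₁ := 5) (R := fun b => b.word a 0 = 1)
    (Run.straight (by simp [Program.effect]) (hB := by simp [Program.steps])) fun s₁ hf₁ h₁ => ?_
  refine Run.for (I := fun m b => b.word a 0 = 2 ^ m) ?_ ?_ ?_ ?_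
  · simpa [Program.words] using hav.symm
  · intro s' hf
    refine he s' ((hf₁.mono ?_ ?_ ?_).trans (hf.mono ?_ ?_ ?_)) <;>
      simp [Program.words, Program.reals, forLoop, Program.draws]
  · simp [hav, h₁]
  · intro i hi s' hf hv hI
    exact Run.straight (by simp [Program.effect, hav, hI, pow_succ, mul_two])
      (hB := by simp [Program.steps])

/-- The number of halvings of `c` that lead below `b`, counted from one. -/
structure IsHalvings (c b : ℝ) (m : ℕ) : Prop where
  pos : 1 ≤ m
  le : c / 2 ^ m ≤ b
  lt : ∀ i, 1 ≤ i → i < m → b < c / 2 ^ i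

theorem exists_isHalvings (c : ℝ) {b : ℝ} (hb : 0 < b) : ∃ m, IsHalvings c b m := by
  classical
  have hex : ∃ m : ℕ, c / 2 ^ (m + 1) ≤ b := by
    obtain ⟨m, hm⟩ := pow_unbounded_of_one_lt (c / b) (by norm_num : (1 : ℝ) < 2)
    refine ⟨m, ?_⟩
    rw [div_le_iff₀ (by positivity)]
    rw [div_lt_iff₀ hb] at hm
    rw [pow_succ]
    nlinarith [mul_pos hb (by positivity : (0 : ℝ) < 2 ^ m)]
  refine ⟨Nat.find hex + 1, by omega, Nat.find_spec hex, fun i hi hlt => ?_⟩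
  have := Nat.find_min hex (m := i - 1) (by omega)
  rw [Nat.sub_add_cancel hi] at this
  exact not_le.1 this

theorem one_le_log₁ (y : ℝ) : 1 ≤ log₁ y := le_max_left _ _

/-- If `m > 1`, then `m - 1` halvings do not suffice, so `m - 1` is at most the logarithm; the
remaining 1 is absorbed since `log₁` is at least 1. -/
theorem IsHalvings.le_log₁ {c b : ℝ} {m : ℕ} (hm : IsHalvings c b m) (hb : 0 < b) :
    (m : ℝ) ≤ 2 * log₁ (c / b) := by
  have h1 := one_le_log₁ (c / b)
  rcases hm.pos.eq_or_lt with h2 | h2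
  · rw [← h2]
    push_cast
    linarith
  · have h3 := hm.lt (m - 1) (by omega) (by omega)
    rw [lt_div_iff₀ (by positivity), mul_comm, ← lt_div_iff₀ hb] at h3
    have h4 : ((m - 1 : ℕ) : ℝ) ≤ Real.logb 2 (c / b) := by
      rw [Real.le_logb_iff_rpow_le (by norm_num) (lt_trans (by positivity) h3), Real.rpow_natCast]
      exact h3.le
    have h5 : Real.logb 2 (c / b) ≤ log₁ (c / b) := le_max_right _ _
    rw [Nat.cast_sub hm.pos] at h4
    push_cast at h4
    linarith

/-- A bound on the running time of `prepare`. -/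
def prepareCost (n r S θ : ℕ) : ℕ :=
  (5 + forCost r 10 2) + ((5 + forCost n 10 2) + (10 + (20 + ((S * 30 + 10) +
    (20 + ((θ * 30 + 10) + 10))))))

/-- Without logarithms on the machine, the number of blocks and their size are found by counting
halvings. The number of blocks is kept as a word and as a real, since the second count starts from
it and there is no conversion. -/
theorem run_prepare {n k r D S θ : ℕ} {η ν : ℝ} (hS : IsHalvings 1 ν S)
    (hθ : IsHalvings (S : ℝ) η θ) :
    Run H prepare (State.init [n, k, r, D] [η, ν]) (prepareCost n r S θ) fun s' =>
      Ready n k r θ s' ∧ s'.word wCnt 0 = 0 ∧ s'.word wBlocks 0 = S := by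
  set s := State.init [n, k, r, D] [η, ν] with hs
  have w0 : s.word 0 0 = n := by simp [hs, State.init]
  have w1 : s.word 0 1 = k := by simp [hs, State.init]
  have w2 : s.word 0 2 = r := by simp [hs, State.init]
  have r0 : s.real 0 0 = η := by simp [hs, State.init]
  have r1 : s.real 0 1 = ν := by simp [hs, State.init]
  have wz : ∀ a, a ≠ 0 → ∀ i, s.word a i = 0 := fun a ha i => by simp [hs, State.init, ha]
  have rz : ∀ a, a ≠ 0 → ∀ i, s.real a i = 0 := fun a ha i => by simp [hs, State.init, ha]
  suffices h : Run H prepare s (prepareCost n r S θ) fun s' =>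
      s'.word wBins 0 = 2 ^ r ∧ s'.word wSize 0 = 2 ^ n ∧ s'.word wPass 0 = n + 4 ∧
      s'.word wBlocks 0 = S ∧ s'.word wHalf 0 = θ ∧ s'.word wWidth 0 = 2 * θ by
    refine h.frame.mono le_rfl ?_
    rintro s' ⟨hf, h1, h2, h3, h4, h5, h6⟩
    have hc : s'.word wCnt 0 = 0 := by rw [hf.word wCnt, wz _ (by decide)]
    refine ⟨⟨⟨by rw [hf.word 0, w0], by rw [hf.word 0, w1], h1, h2, h3, h5, h6⟩, by omega, ?_, ?_,
      ?_, ?_⟩, hc, h4⟩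
    · rw [hc]; simp
    · rw [hc]; simp
    · intro c _; rw [hf.word wTouch, wz _ (by decide)]
    · intro c _; rw [hf.real rEst, rz _ (by decide)]
  refine Run.seqF (run_powerOfTwo (N := r) (by decide) fun s' hf => ?_) fun s₁ hf₁ h₁ => ?_
  · simp [hf.word 0, w2]
  refine Run.seqF (run_powerOfTwo (N := n) (by decide) fun s' hf => ?_) fun s₂ hf₂ h₂ => ?_
  · simp [hf.word 0, hf₁.word 0, w0]
  have b₂ : s₂.word wBins 0 = 2 ^ r := by rw [hf₂.word wBins, h₁]
  have z₂ : s₂.word 0 = s.word 0 := by rw [hf₂.word 0, hf₁.word 0]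
  have y₂ : s₂.real 0 = s.real 0 := by rw [hf₂.real 0, hf₁.real 0]
  refine Run.seqF (B₁ := 10) (R := fun b => b.word wPass 0 = n + 4)
    (Run.straight (by simp [Program.effect, z₂, w0])) fun s₃ hf₃ h₃ => ?_
  refine Run.seqF (B₁ := 20) (R := fun b => b.word wBlocks 0 = 1 ∧ b.real rFrac 0 = 1 / 2 ∧
      b.real rNum 0 = 1)
    (Run.straight (by simp [Program.effect])) fun s₄ hf₄ h₄ => ?_
  -- The fraction starts at `1/2` with count 1, so only `S - 1` passes remain.
  refine Run.seqF (B₁ := S * 30 + 10) (R := fun b => b.word wBlocks 0 = S ∧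
      b.real rNum 0 = S)
    ((Run.loop (K := S - 1) (B := 21) (I := fun i b => b.word wBlocks 0 = i + 1 ∧
      b.real rFrac 0 = 1 / 2 ^ (i + 1) ∧ b.real rNum 0 = i + 1) ?_ ?_ ?_).mono ?_ ?_)
    fun s₅ hf₅ h₅ => ?_
  · simp [h₄]
  · rintro i hi b hfb ⟨hb₁, hb₂, hb₃⟩
    constructor
    · have := hS.lt (i + 1) (by omega) (by omega)
      have e : b.real 0 1 = ν := by rw [hfb.real 0, hf₄.real 0, hf₃.real 0, y₂, r1]
      simp only [Test.holds, RExp.eval, WExp.eval, hb₂, e, not_le]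
      exact this
    · refine Run.straight ?_
      simp [Program.effect, hb₁, hb₂, hb₃, pow_succ]
      ring
  · rintro b hfb ⟨hb₁, hb₂, hb₃⟩
    have := hS.le
    have e : b.real 0 1 = ν := by rw [hfb.real 0, hf₄.real 0, hf₃.real 0, y₂, r1]
    rw [Nat.sub_add_cancel hS.pos] at hb₂
    simp only [Test.holds, RExp.eval, WExp.eval, hb₂, e, not_not]
    exact this
  · have : (S - 1) * 30 ≤ S * 30 := by omega
    simp only [Test.cost, RExp.cost, WExp.cost]
    omega
  · rintro b ⟨hb₁, -, hb₃⟩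
    rw [← Nat.cast_succ, Nat.succ_eq_add_one] at hb₃
    rw [Nat.sub_add_cancel hS.pos] at hb₁ hb₃
    exact ⟨hb₁, hb₃⟩
  refine Run.seqF (B₁ := 20) (R := fun b => b.word wHalf 0 = 1 ∧ b.real rFrac 0 = S / 2)
    (Run.straight (by simp [Program.effect, h₅])) fun s₆ hf₆ h₆ => ?_
  refine Run.seqF (B₁ := θ * 30 + 10) (R := fun b => b.word wHalf 0 = θ)
    ((Run.loop (K := θ - 1) (B := 21) (I := fun i b => b.word wHalf 0 = i + 1 ∧
      b.real rFrac 0 = S / 2 ^ (i + 1)) ?_ ?_ ?_).mono ?_ ?_)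
    fun s₇ hf₇ h₇ => ?_
  · simp [h₆]
  · rintro i hi b hfb ⟨hb₁, hb₂⟩
    constructor
    · have := hθ.lt (i + 1) (by omega) (by omega)
      have e : b.real 0 0 = η := by
        rw [hfb.real 0, hf₆.real 0, hf₅.real 0, hf₄.real 0, hf₃.real 0, y₂, r0]
      simp only [Test.holds, RExp.eval, WExp.eval, hb₂, e, not_le]
      exact this
    · refine Run.straight ?_
      simp [Program.effect, hb₁, hb₂, pow_succ]
      ring
  · rintro b hfb ⟨hb₁, hb₂⟩
    have := hθ.le
    have e : b.real 0 0 = η := by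
      rw [hfb.real 0, hf₆.real 0, hf₅.real 0, hf₄.real 0, hf₃.real 0, y₂, r0]
    rw [Nat.sub_add_cancel hθ.pos] at hb₂
    simp only [Test.holds, RExp.eval, WExp.eval, hb₂, e, not_not]
    exact this
  · have : (θ - 1) * 30 ≤ θ * 30 := by omega
    simp only [Test.cost, RExp.cost, WExp.cost]
    omega
  · rintro b ⟨hb₁, -⟩
    rw [hb₁, Nat.sub_add_cancel hθ.pos]
  · refine Run.straight ⟨?_, ?_, ?_, ?_, ?_, ?_⟩
    · simp [Program.effect]
      rw [hf₇.word wBins, hf₆.word wBins, hf₅.word wBins, hf₄.word wBins, hf₃.word wBins, b₂]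
    · simp [Program.effect]
      rw [hf₇.word wSize, hf₆.word wSize, hf₅.word wSize, hf₄.word wSize, hf₃.word wSize, h₂]
    · simp [Program.effect]
      rw [hf₇.word wPass, hf₆.word wPass, hf₅.word wPass, hf₄.word wPass, h₃]
    · simp [Program.effect]
      rw [hf₇.word wBlocks, hf₆.word wBlocks, h₅.1]
    · simp [Program.effect, h₇]
    · simp [Program.effect, h₇, two_mul]

end Prepare

/-! ## Counting steps -/

theorem forCost_le {N N' B c : ℕ} (hN : N ≤ N') (hN' : 1 ≤ N') (hc : c ≤ 3) :
    forCost N B c ≤ N' * (B + 27) := by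
  unfold forCost
  calc N * (B + c + 12) + c + 9 ≤ N' * (B + 15) + N' * 12 := by
        have : N * (B + c + 12) ≤ N' * (B + 15) := Nat.mul_le_mul hN (by omega)
        omega
    _ = N' * (B + 27) := by ring

/-- Each nested loop is dominated by a multiple of `θ * R * G`, where `G = F + n + 1` covers a call
of the subroutine, the `n` bits and the bisection passes. The numerical constants are generous. -/
theorem improveCost_le {n k r θ F : ℕ} (hθ : 1 ≤ θ) (hk : k ≤ 2 * 2 ^ r) :
    improveCost n k r θ F ≤ 10000 * (θ * 2 ^ r * (F + n + 1)) := by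
  unfold improveCost gatherCost selectCost
  set R := 2 ^ r with hR
  have hR1 : 1 ≤ R := Nat.one_le_two_pow
  set G := F + n + 1 with hG
  have hG1 : 1 ≤ G := by omega
  have m1 : R * G ≤ θ * R * G := by
    rw [mul_assoc]; exact Nat.le_mul_of_pos_left _ hθ
  have m2 : R ≤ R * G := Nat.le_mul_of_pos_right _ hG1
  have m4 : θ * R ≤ θ * R * G := Nat.le_mul_of_pos_right _ hG1
  have m5 : θ ≤ θ * R := Nat.le_mul_of_pos_right _ hR1
  have m6 : θ * G ≤ θ * R * G := Nat.mul_le_mul_right _ m5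
  have a1 : forCost k 40 2 ≤ 2 * R * (40 + 27) := forCost_le hk (by omega) (by norm_num)
  have a2 : forCost R 10 2 ≤ R * (10 + 27) := forCost_le le_rfl hR1 (by norm_num)
  have a3 : forCost R 20 2 ≤ R * (20 + 27) := forCost_le le_rfl hR1 (by norm_num)
  have a4 : forCost n (forCost R 20 2 + 10) 2 ≤ 84 * (R * G) := by
    refine (forCost_le (N' := G) (by omega) hG1 (by norm_num)).trans ?_
    calc G * (forCost R 20 2 + 10 + 27) ≤ G * (84 * R) := Nat.mul_le_mul_left _ (by omega)
      _ = 84 * (R * G) := by ring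
  have a5 : forCost n 60 2 ≤ G * (60 + 27) := forCost_le (by omega) hG1 (by norm_num)
  have a6 : forCost k (F + forCost n 60 2 + 50) 2 ≤ 330 * (R * G) := by
    refine (forCost_le hk (by omega) (by norm_num)).trans ?_
    calc 2 * R * (F + forCost n 60 2 + 50 + 27) ≤ 2 * R * (165 * G) :=
          Nat.mul_le_mul_left _ (by omega)
      _ = 330 * (R * G) := by ring
  have a7 : forCost R (F + forCost n 60 2 + 200) 2 ≤ 315 * (R * G) := by
    refine (forCost_le le_rfl hR1 (by norm_num)).trans ?_
    calc R * (F + forCost n 60 2 + 200 + 27) ≤ R * (315 * G) := Nat.mul_le_mul_left _ (by omega)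
      _ = 315 * (R * G) := by ring
  have a8 : forCost (2 * θ) (forCost R 10 2 + (5 + forCost n (forCost R 20 2 + 10) 2) +
      forCost k (F + forCost n 60 2 + 50) 2 + forCost R (F + forCost n 60 2 + 200) 2 + 20) 2 ≤
      1700 * (θ * R * G) := by
    refine (forCost_le le_rfl (by omega) (by norm_num)).trans ?_
    calc _ ≤ 2 * θ * (850 * (R * G)) := Nat.mul_le_mul_left _ (by omega)
      _ = 1700 * (θ * R * G) := by ring
  have a9 : forCost (2 * θ) 30 2 ≤ 2 * θ * (30 + 27) := forCost_le le_rfl (by omega) (by norm_num)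
  have a10 : forCost (2 * θ) 20 2 ≤ 2 * θ * (20 + 27) := forCost_le le_rfl (by omega) (by norm_num)
  have a11 : forCost (n + 4) (forCost (2 * θ) 30 2 + 40) 2 ≤ 724 * (θ * G) := by
    refine (forCost_le (N' := 4 * G) (by omega) (by omega) (by norm_num)).trans ?_
    calc 4 * G * (forCost (2 * θ) 30 2 + 40 + 27) ≤ 4 * G * (181 * θ) :=
          Nat.mul_le_mul_left _ (by omega)
      _ = 724 * (θ * G) := by ring
  have m7 : θ ≤ θ * G := Nat.le_mul_of_pos_right _ hG1
  have a12 : forCost (k + 2 * R) (forCost (2 * θ) 20 2 +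
      forCost (n + 4) (forCost (2 * θ) 30 2 + 40) 2 + 50) 2 ≤ 3600 * (θ * R * G) := by
    refine (forCost_le (N' := 4 * R) (by omega) (by omega) (by norm_num)).trans ?_
    calc _ ≤ 4 * R * (900 * (θ * G)) := Nat.mul_le_mul_left _ (by omega)
      _ = 3600 * (θ * R * G) := by ring
  have b : ∀ B, forCost (k + 2 * R) B 2 ≤ 4 * R * (B + 27) := fun B =>
    forCost_le (by omega) (by omega) (by norm_num)
  have b1 := b 30
  have b2 := b 40
  have b3 := b 60
  have a13 : forCost (n + 4) (forCost (k + 2 * R) 30 2 + 40) 2 ≤ 1180 * (R * G) := by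
    refine (forCost_le (N' := 4 * G) (by omega) (by omega) (by norm_num)).trans ?_
    calc _ ≤ 4 * G * (295 * R) := Nat.mul_le_mul_left _ (by omega)
      _ = 1180 * (R * G) := by ring
  omega

theorem totalCost_le {n k r θ F S : ℕ} (hS : 1 ≤ S) (hθ : 1 ≤ θ) (hk : k ≤ 2 * 2 ^ r)
    (hr : r ≤ n) :
    prepareCost n r S θ + forCost S (improveCost n k r θ F) 2 ≤
      12000 * (S * (θ * 2 ^ r * (F + n + 1))) := by
  have h1 := improveCost_le (n := n) (F := F) hθ hk
  set X := θ * 2 ^ r * (F + n + 1) with hX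
  have hR1 : 1 ≤ 2 ^ r := Nat.one_le_two_pow
  have hθX : θ ≤ X := by
    rw [hX, mul_assoc]
    exact Nat.le_mul_of_pos_right _ (Nat.mul_pos hR1 (by omega))
  have hnX : n + 1 ≤ X := by
    rw [hX]
    refine le_trans (by omega) (Nat.le_mul_of_pos_left (F + n + 1) (Nat.mul_pos hθ hR1))
  have h2 : forCost S (improveCost n k r θ F) 2 ≤ 10027 * (S * X) := by
    refine (forCost_le le_rfl hS (by norm_num)).trans ?_
    calc _ ≤ S * (10027 * X) := Nat.mul_le_mul_left _ (by omega)
      _ = 10027 * (S * X) := by ring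
  have h3 : X ≤ S * X := Nat.le_mul_of_pos_left _ hS
  have h4 : S ≤ S * X := Nat.le_mul_of_pos_right _ (by omega)
  have h5 : forCost r 10 2 ≤ (n + 1) * (10 + 27) := forCost_le (by omega) (by omega) (by norm_num)
  have h6 : forCost n 10 2 ≤ (n + 1) * (10 + 27) := forCost_le (by omega) (by omega) (by norm_num)
  unfold prepareCost
  omega

/-! ## Random seeds -/

section Random

open Classical in
-- An exponential moment bound. The weight 256 per bad seed averages to at most 2, so a block has
-- average weight at most `2 ^ W`; a block with more than `W / 4` bad seeds has weight at least `256
-- ^ (W / 4) = 4 ^ W`.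
theorem card_bad_blocks_le {D W : ℕ} (bad : Fin D → Prop)
    (hbad : 256 * (Finset.univ.filter bad).card ≤ D) :
    (Finset.univ.filter fun b : Fin W → Fin D =>
      W < 4 * (Finset.univ.filter fun i => bad (b i)).card).card * 2 ^ W ≤ D ^ W := by
  set T := Finset.univ.filter fun b : Fin W → Fin D =>
      W < 4 * (Finset.univ.filter fun i => bad (b i)).card with hT
  have h1 : ∑ t : Fin D, (if bad t then 256 else 1) ≤ 2 * D := by
    calc ∑ t : Fin D, (if bad t then 256 else 1)
        ≤ ∑ t : Fin D, ((if bad t then 256 else 0) + 1) :=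
          Finset.sum_le_sum fun t _ => by split_ifs <;> simp
      _ = 256 * (Finset.univ.filter bad).card + D := by
          rw [Finset.sum_add_distrib, ← Finset.sum_filter, Finset.sum_const, Finset.sum_const]
          simp [mul_comm]
      _ ≤ 2 * D := by omega
  have h2 : T.card * 4 ^ W ≤ (∑ t : Fin D, if bad t then 256 else 1) ^ W := by
    rw [Fintype.sum_pow, ← smul_eq_mul]
    refine (Finset.card_nsmul_le_sum T (fun b => ∏ i, if bad (b i) then 256 else 1) _
      fun b hb => ?_).trans (Finset.sum_le_sum_of_subset (Finset.subset_univ T))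
    have hb' := (Finset.mem_filter.1 hb).2
    rw [← Finset.prod_filter, Finset.prod_const, show 256 = 4 ^ 4 by norm_num, ← pow_mul]
    exact Nat.pow_le_pow_right (by norm_num) hb'.le
  have h3 : T.card * 2 ^ W * 2 ^ W ≤ D ^ W * 2 ^ W := by
    calc T.card * 2 ^ W * 2 ^ W = T.card * 4 ^ W := by
          rw [mul_assoc, ← mul_pow]; norm_num
      _ ≤ (2 * D) ^ W := h2.trans (Nat.pow_le_pow_left h1 W)
      _ = D ^ W * 2 ^ W := by rw [mul_pow, mul_comm]
  exact Nat.le_of_mul_le_mul_right h3 (by positivity)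

variable {D : ℕ} [NeZero D]

instance : IsProbabilityMeasure (seedLaw D) := by
  unfold seedLaw
  infer_instance

theorem seedLaw_cylinder (m : ℕ) (a : Fin m → Fin D) :
    seedLaw D {ω | ∀ i : Fin m, ω i = a i} = ((D : ENNReal)⁻¹) ^ m := by
  have h1 : {ω : ℕ → Fin D | ∀ i : Fin m, ω i = a i} =
      Set.pi (Finset.range m) fun i => if hi : i < m then {a ⟨i, hi⟩} else Set.univ := by
    ext ω
    simp only [Set.mem_ofPred_eq, Set.mem_pi, Finset.coe_range, Set.mem_Iio]
    constructor
    · intro h i hi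
      rw [dif_pos hi]
      exact h ⟨i, hi⟩
    · intro h i
      have := h i i.2
      rw [dif_pos i.2] at this
      exact this
  rw [h1, seedLaw, Measure.infinitePi_pi]
  · rw [Finset.prod_congr rfl (g := fun _ => (D : ENNReal)⁻¹), Finset.prod_const, Finset.card_range]
    intro i hi
    rw [dif_pos (Finset.mem_range.1 hi), PMF.toMeasure_apply_singleton _ _ (MeasurableSet.singleton _),
      PMF.uniformOfFintype_apply, Fintype.card_fin]
  · intro i hi
    exact MeasurableSet.of_discrete

/-- The seeds of a block. -/
def block (W i : ℕ) (ω : ℕ → Fin D) : Fin W → Fin D := fun j => ω (i * W + j)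

/-- A bad event about a block, which may depend on the seeds before that block, has small
probability if it has small probability for each choice of these seeds. -/
theorem seedLaw_block_le {σ : Type*} {W : ℕ} (X : (ℕ → Fin D) → σ) (i : ℕ)
    (hX : ∀ ω ω', (∀ j < i * W, ω j = ω' j) → X ω = X ω') (bad : σ → (Fin W → Fin D) → Prop)
    [∀ s, DecidablePred (bad s)]
    (hbad : ∀ s, (Finset.univ.filter (bad s)).card * 2 ^ W ≤ D ^ W) :
    seedLaw D {ω | bad (X ω) (block W i ω)} ≤ (2 ^ W : ENNReal)⁻¹ := by
  classical
  set m := i * W with hm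
  -- By `hX` only the first `m` seeds influence `X`, so the default value beyond them is harmless.
  -- The event is then covered by cylinders of length `m + W`.
  let ext : (Fin m → Fin D) → ℕ → Fin D := fun p j => if hj : j < m then p ⟨j, hj⟩ else 0
  set B : Finset ((_ : Fin m → Fin D) × (Fin W → Fin D)) :=
    Finset.univ.sigma fun p => Finset.univ.filter (bad (X (ext p))) with hB
  let cyl : ((_ : Fin m → Fin D) × (Fin W → Fin D)) → Set (ℕ → Fin D) := fun q =>
    {ω | ∀ j : Fin (m + W), ω j = Fin.append q.1 q.2 j}
  have hsub : {ω | bad (X ω) (block W i ω)} ⊆ ⋃ q ∈ B, cyl q := by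
    intro ω hω
    have hω' : bad (X (ext fun j => ω j)) (block W i ω) := by
      rw [hX (ext fun j => ω j) ω]
      · exact hω
      · intro j hj
        simp only [ext]
        rw [dif_pos hj]
    simp only [Set.mem_iUnion]
    refine ⟨⟨fun j => ω j, block W i ω⟩, ?_, ?_⟩
    · simp only [hB, Finset.mem_sigma, Finset.mem_univ, true_and, Finset.mem_filter]
      exact hω'
    · intro j
      refine Fin.addCases (fun j => ?_) (fun j => ?_) j
      · simp
      · simp [block, hm]
  have hcard : B.card * 2 ^ W ≤ D ^ (m + W) := by
    rw [hB, Finset.card_sigma, Finset.sum_mul, pow_add]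
    refine (Finset.sum_le_card_nsmul _ _ (D ^ W) fun p _ => hbad _).trans ?_
    simp
  have hD0 : (D : ENNReal) ≠ 0 := by exact_mod_cast NeZero.ne D
  have hDt : (D : ENNReal) ≠ ⊤ := ENNReal.natCast_ne_top D
  calc seedLaw D {ω | bad (X ω) (block W i ω)} ≤ seedLaw D (⋃ q ∈ B, cyl q) := measure_mono hsub
    _ ≤ ∑ q ∈ B, seedLaw D (cyl q) := measure_biUnion_finset_le _ _
    _ = B.card * ((D : ENNReal)⁻¹) ^ (m + W) := by
        rw [Finset.sum_congr rfl fun q _ => seedLaw_cylinder (m + W) (Fin.append q.1 q.2),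
          Finset.sum_const, nsmul_eq_mul]
    _ ≤ (2 ^ W : ENNReal)⁻¹ := by
        rw [← ENNReal.inv_pow, ← div_eq_mul_inv]
        refine ENNReal.div_le_of_le_mul ?_
        rw [mul_comm, ← div_eq_mul_inv, ENNReal.le_div_iff_mul_le (Or.inl (by positivity))
          (Or.inl (by simp))]
        exact_mod_cast hcard

end Random

/-! ## The algorithm -/

theorem Ready.setWord_block {n k r θ : ℕ} {s : State} (hs : Ready n k r θ s) (i : ℕ) :
    Ready n k r θ (s.setWord wB 0 i) := by
  have hf : FrameOn [wB] [] false s (s.setWord wB 0 i) := by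
    constructor <;> intros <;> simp_all [State.setWord]
  refine ⟨hs.env.mono hf, ?_, ?_, ?_, ?_, ?_⟩
  · rw [hf.word wCnt]; exact hs.cnt_le
  · rw [hf.word wCnt, hf.word wPos]; exact hs.pos_lt
  · rw [hf.word wCnt, hf.word wPos]; exact hs.pos_inj
  · rw [hf.word wTBase, hf.word wTouch]; exact hs.fresh_touch
  · rw [hf.word wRow, hf.real rEst]; exact hs.fresh_est

theorem output_setWord_block (n : ℕ) (s : State) (i : ℕ) :
    output n (s.setWord wB 0 i) = output n s := by
  simp [output, State.setWord]

section Step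

variable {n k r D θ : ℕ} [NeZero D] {h : F2 n → Fin D → F2 r} {Q : Program Empty} {F : ℕ}

/-- The seed `t` is bad for the residual in the state `s`. -/
def IsBadSeed (k : ℕ) (h : F2 n → Fin D → F2 r) (x : F2 n → ℝ) (s : State) (t : Fin D) : Prop :=
  ¬ l1 (x - output n s - estimate h (x - output n s) t) ≤
    l1 (x - output n s) / 64 + 8 * l1 (x - headApprox k x)

open Classical in
/-- More than a quarter of the seeds are bad. -/
def IsBadBlock (k θ : ℕ) (h : F2 n → Fin D → F2 r) (x : F2 n → ℝ) (s : State)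
    (b : Fin (2 * θ) → Fin D) : Prop :=
  2 * θ < 4 * (Finset.univ.filter fun i => IsBadSeed k h x s (b i)).card

open Classical in
theorem card_isBadBlock_le (hk : 1 ≤ k)
    (hh : IsLosslessCondenser (Real.logb 2 (4 * (k : ℝ))) (1 / 2 ^ 18) h) (x : F2 n → ℝ)
    {s : State} (hs : Ready n k r θ s) :
    (Finset.univ.filter (IsBadBlock k θ h x s)).card * 2 ^ (2 * θ) ≤ D ^ (2 * θ) := by
  have h1 : 256 * (Finset.univ.filter (IsBadSeed k h x s)).card ≤ D := by
    convert card_bad_seeds_le hk hh x (output n s) (isSparse_output hs.cnt_le)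
  convert card_bad_blocks_le (W := 2 * θ) (IsBadSeed k h x s) h1
  exact Iff.rfl

/-- The final state can be chosen as a function of the state and the seeds of the block alone: a run
with an arbitrary continuation `ω₀` is transported to every `ω` that agrees on the block. -/
theorem exists_improve (hQ : ComputesWithin Q k h F) (hθ : 1 ≤ θ) (hkn : k ≤ 2 ^ n)
    (x : F2 n → ℝ) {s : State} (hs : Ready n k r θ s) (b : Fin (2 * θ) → Fin D) :
    ∃ s', Ready n k r θ s' ∧ s'.drawn = s.drawn + 2 * θ ∧
      (∀ ω : ℕ → Fin D, (∀ i : Fin (2 * θ), ω (s.drawn + i) = b i) →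
        ∃ T ≤ improveCost n k r θ F, Exec (Sem k Q h x ω) improve s s' T) ∧
      (¬ IsBadBlock k θ h x s b → l1 (x - output n s') ≤
        l1 (x - output n s) / 2 + 65 * l1 (x - headApprox k x)) := by
  let ω₀ : ℕ → Fin D := fun j =>
    if hj : j - s.drawn < 2 * θ then b ⟨j - s.drawn, hj⟩ else 0
  have hω₀ : ∀ i : Fin (2 * θ), ω₀ (s.drawn + i) = b i := by
    intro i
    simp [ω₀]
  obtain ⟨s', T, hex, hT, h1, h2, h3⟩ := run_improve (x := x) (ω := ω₀) hQ hs hθ hkn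
  refine ⟨s', h1, h2, fun ω hω => ⟨T, hT, hex.congr_seeds fun j hj hj' => ?_⟩, fun hb => h3 ?_⟩
  · have h4 : j - s.drawn < 2 * θ := by omega
    have h5 := hω ⟨j - s.drawn, h4⟩
    rw [← hω₀] at h5
    simpa [Nat.add_sub_cancel' hj] using h5.symm
  · refine le_of_eq_of_le (congrArg (4 * ·) (congrArg Finset.card (Finset.ext fun i => ?_)))
      (not_lt.1 hb)
    simp [IsBadSeed, hω₀]

/-- A run of the algorithm whose memory contents after each block depend only on the seeds drawn
so far. -/
theorem exists_recover (hQ : ComputesWithin Q k h F) (hkn : k ≤ 2 ^ n) (x : F2 n → ℝ)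
    {S : ℕ} {η ν : ℝ} (hS : IsHalvings 1 ν S) (hθ : IsHalvings (S : ℝ) η θ) :
    ∃ X : ℕ → (ℕ → Fin D) → {s : State // Ready n k r θ s},
      (∀ i ω ω', (∀ j < i * (2 * θ), ω j = ω' j) → X i ω = X i ω') ∧
      (∀ ω, output n (X 0 ω).1 = 0) ∧
      (∀ i ω, (X i ω).1.drawn = i * (2 * θ)) ∧
      (∀ i ω, ¬ IsBadBlock k θ h x (X i ω).1 (block (2 * θ) i ω) →
        l1 (x - output n (X (i + 1) ω).1) ≤
          l1 (x - output n (X i ω).1) / 2 + 65 * l1 (x - headApprox k x)) ∧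
      ∀ ω, ∃ T, Recovers recover Q k h x η ν ω (X S ω).1 T ∧
        T ≤ prepareCost n r S θ + forCost S (improveCost n k r θ F) 2 := by
  obtain ⟨s₀, T₀, hex₀, hT₀, hf₀, hr₀, hc₀, hb₀⟩ := (run_prepare (n := n) (k := k) (r := r) (D := D)
    (H := Sem k Q h x fun _ => 0) hS hθ).frame
  have hd₀ : s₀.drawn = 0 := by rw [hf₀.drawn]; rfl
  -- Iterating this choice function makes the dependence on earlier seeds evident, without any
  -- appeal to determinism of the machine.
  choose next hn₁ hn₂ hn₃ hn₄ using fun s : {s : State // Ready n k r θ s} =>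
    exists_improve hQ hθ.pos hkn x s.2
  let X : ℕ → (ℕ → Fin D) → {s : State // Ready n k r θ s} := fun i ω =>
    Nat.rec ⟨s₀.setWord wB 0 0, hr₀.setWord_block 0⟩
      (fun i s => ⟨(next s (block (2 * θ) i ω)).setWord wB 0 (i + 1),
        (hn₁ s (block (2 * θ) i ω)).setWord_block (i + 1)⟩) i
  have hX0 : ∀ ω, (X 0 ω).1 = s₀.setWord wB 0 0 := fun ω => rfl
  have hXs : ∀ i ω, X (i + 1) ω = ⟨(next (X i ω) (block (2 * θ) i ω)).setWord wB 0 (i + 1),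
    (hn₁ (X i ω) (block (2 * θ) i ω)).setWord_block (i + 1)⟩ := fun i ω => rfl
  have hd : ∀ i ω, (X i ω).1.drawn = i * (2 * θ) := by
    intro i ω
    induction i with
    | zero => simp [hX0, State.setWord, hd₀]
    | succ i ih =>
      rw [hXs]
      have := hn₂ (X i ω) (block (2 * θ) i ω)
      simp only [State.setWord, this, ih]
      ring
  refine ⟨X, ?_, ?_, hd, ?_, ?_⟩
  · intro i ω ω' hω
    induction i with
    | zero => rfl
    | succ i ih =>
      rw [add_mul, one_mul] at hω
      have h1 : block (2 * θ) i ω = block (2 * θ) i ω' := by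
        funext j
        exact hω _ (by omega)
      rw [hXs, hXs]
      rw [Subtype.mk.injEq, ih fun j hj => hω j (by omega), h1]
  · intro ω
    rw [hX0, output_setWord_block, output]
    simp [hc₀]
  · intro i ω hb
    rw [hXs, output_setWord_block]
    exact hn₄ _ _ hb
  · intro ω
    have hrun : Run (Sem k Q h x ω) recover (State.init [n, k, r, D] [η, ν])
        (prepareCost n r S θ + forCost S (improveCost n k r θ F) 2) fun s => s = (X S ω).1 := by
      refine Run.seq (R := fun s => s = s₀)
        ⟨s₀, T₀, hex₀.congr_seeds fun i _ hi => absurd hi (by omega), hT₀, rfl⟩ ?_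
      rintro _ rfl
      refine Run.for (I := fun i s => s = (X i ω).1) (by decide) ?_ (hX0 ω).symm ?_
      · intro s' hf
        simp [hf.word wBlocks, hb₀]
      · rintro i hi _ hf - rfl
        obtain ⟨T, hT, hex⟩ := hn₃ (X i ω) (block (2 * θ) i ω) ω fun j => by
          rw [hd]; rfl
        exact ⟨_, T, hex, hT, by rw [hXs]⟩
    obtain ⟨s, T, hex, hT, rfl⟩ := hrun
    exact ⟨T, hex, hT⟩

end Step

/-! ### Convergence, number of seeds and success probability -/

/-- The additive errors form a geometric series, `65 * (1 + 1/2 + ...) = 130`. -/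
theorem le_geometric {E : ℕ → ℝ} {τ : ℝ} {S : ℕ} (hτ : 0 ≤ τ)
    (hE : ∀ i < S, E (i + 1) ≤ E i / 2 + 65 * τ) :
    E S ≤ E 0 / 2 ^ S + 130 * τ := by
  induction S with
  | zero => simp; positivity
  | succ S ih =>
    have h1 := hE S (by omega)
    have h2 := ih fun i hi => hE i (by omega)
    rw [pow_succ, ← div_div]
    linarith

theorem log₁_two_mul_le {y : ℝ} (hy : 0 < y) : log₁ (2 * y) ≤ 2 * log₁ y := by
  have h1 := one_le_log₁ y
  have h2 : Real.logb 2 y ≤ log₁ y := le_max_right _ _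
  refine max_le (by linarith) ?_
  rw [Real.logb_mul (by norm_num) hy.ne', Real.logb_self_eq_one (by norm_num)]
  linarith

theorem log₁_mono {y z : ℝ} (hy : 0 < y) (hyz : y ≤ z) : log₁ y ≤ log₁ z :=
  max_le_max le_rfl (Real.logb_le_logb_of_le (by norm_num) hy hyz)

/-- Both counts are at most twice a `log₁`. Replacing `S` by `2 * log₁ (1 / ν)` inside the second
one costs another factor 2, whence 8. -/
theorem halvings_le {S θ : ℕ} {η ν : ℝ} (hη : 0 < η) (hν : 0 < ν) (hS : IsHalvings 1 ν S)
    (hθ : IsHalvings (S : ℝ) η θ) :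
    (θ : ℝ) * S ≤ 8 * (log₁ (log₁ (1 / ν) / η) * log₁ (1 / ν)) := by
  have h1 := hS.le_log₁ hν
  have h2 := hθ.le_log₁ hη
  have h3 := one_le_log₁ (1 / ν)
  have h4 : (1 : ℝ) ≤ S := by exact_mod_cast hS.pos
  have h5 : log₁ ((S : ℝ) / η) ≤ 2 * log₁ (log₁ (1 / ν) / η) := by
    refine (log₁_mono (by positivity) ?_).trans (log₁_two_mul_le (by positivity))
    rw [← mul_div_assoc]
    gcongr
  have h6 := one_le_log₁ (log₁ (1 / ν) / η)
  calc (θ : ℝ) * S ≤ (4 * log₁ (log₁ (1 / ν) / η)) * (2 * log₁ (1 / ν)) := by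
        gcongr
        linarith
    _ = _ := by ring

/-- Union bound over the blocks, `S / 2 ^ (2 * θ) ≤ S / 2 ^ θ ≤ η`. Only subadditivity is used to
pass to the complement, so no measurability is needed. -/
theorem seedLaw_success {n k r D S θ : ℕ} [NeZero D] {h : F2 n → Fin D → F2 r} (hk : 1 ≤ k)
    (hh : IsLosslessCondenser (Real.logb 2 (4 * (k : ℝ))) (1 / 2 ^ 18) h) (x : F2 n → ℝ) {η : ℝ}
    (hη : 0 < η) (hθ : IsHalvings (S : ℝ) η θ)
    (X : ℕ → (ℕ → Fin D) → {s : State // Ready n k r θ s})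
    (hX : ∀ i ω ω', (∀ j < i * (2 * θ), ω j = ω' j) → X i ω = X i ω') :
    ENNReal.ofReal (1 - η) ≤ seedLaw D
      {ω | ∀ i < S, ¬ IsBadBlock k θ h x (X i ω).1 (block (2 * θ) i ω)} := by
  classical
  set A := {ω : ℕ → Fin D | ∀ i < S, ¬ IsBadBlock k θ h x (X i ω).1 (block (2 * θ) i ω)} with hA
  have h1 : seedLaw D Aᶜ ≤ ENNReal.ofReal η := by
    have hsub : Aᶜ ⊆ ⋃ i ∈ Finset.range S,
        {ω | IsBadBlock k θ h x (X i ω).1 (block (2 * θ) i ω)} := by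
      intro ω hω
      simpa [hA] using hω
    calc seedLaw D Aᶜ ≤ ∑ i ∈ Finset.range S, (2 ^ (2 * θ) : ENNReal)⁻¹ :=
          (measure_mono hsub).trans ((measure_biUnion_finset_le _ _).trans
            (Finset.sum_le_sum fun i _ => seedLaw_block_le (X i) i (hX i)
              (fun s => IsBadBlock k θ h x s.1) fun s => card_isBadBlock_le hk hh x s.2))
      _ = ENNReal.ofReal ((S : ℝ) / 2 ^ (2 * θ)) := by
          rw [Finset.sum_const, Finset.card_range, nsmul_eq_mul, ← div_eq_mul_inv,
            ENNReal.ofReal_div_of_pos (by positivity), ENNReal.ofReal_natCast,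
            ENNReal.ofReal_pow (by norm_num), ENNReal.ofReal_ofNat]
      _ ≤ ENNReal.ofReal η := by
          refine ENNReal.ofReal_le_ofReal (le_trans ?_ hθ.le)
          gcongr
          · norm_num
          · omega
  rw [ENNReal.ofReal_sub _ hη.le, ENNReal.ofReal_one, tsub_le_iff_right]
  calc (1 : ENNReal) = seedLaw D (A ∪ Aᶜ) := by rw [Set.union_compl_self, measure_univ]
    _ ≤ seedLaw D A + seedLaw D Aᶜ := measure_union_le _ _
    _ ≤ _ := by gcongr

end SparseRecovery

end

theorem mainTheorem4 :
    ∃ c : ℝ, 0 < c ∧ ∃ ε : ℝ, 0 < ε ∧ ∃ P : SparseRecovery.Program SparseRecovery.Instr,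
      ∀ a : ℝ, 0 < a → ∃ C : ℝ, 0 < C ∧
        ∀ f : ℕ → ℕ, (∀ m : ℕ, 1 ≤ m → a * (m : ℝ) ≤ (f m : ℝ)) →
        ∀ (Q : SparseRecovery.Program Empty) (n k r D : ℕ) [NeZero D]
          (h : SparseRecovery.F2 n → Fin D → SparseRecovery.F2 r),
          1 ≤ n → 1 ≤ k → k ≤ 2 ^ n → r ≤ n →
          SparseRecovery.IsLosslessCondenser (Real.logb 2 (4 * (k : ℝ))) ε h →
          SparseRecovery.ComputesWithin Q k h (f n) →
          ∀ η ν : ℝ, 0 < η → 0 < ν → ∀ x : SparseRecovery.F2 n → ℝ,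
            ∃ out : (ℕ → Fin D) → SparseRecovery.State,
              (∀ ω : ℕ → Fin D,
                SparseRecovery.IsSparse k (SparseRecovery.output n (out ω)) ∧
                (((out ω).drawn : ℕ) : ℝ) ≤
                  C * (SparseRecovery.log₁ (SparseRecovery.log₁ (1 / ν) / η) *
                    SparseRecovery.log₁ (1 / ν)) ∧
                ∃ T : ℕ, SparseRecovery.Recovers P Q k h x η ν ω (out ω) T ∧
                  (T : ℝ) ≤ C * ((2 : ℝ) ^ r *
                    SparseRecovery.log₁ (SparseRecovery.log₁ (1 / ν) / η) *
                    SparseRecovery.log₁ (1 / ν) * (f n : ℝ))) ∧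
              ENNReal.ofReal (1 - η) ≤ SparseRecovery.seedLaw D {ω : ℕ → Fin D |
                SparseRecovery.l1 (SparseRecovery.output n (out ω) - x) ≤
                  c * SparseRecovery.l1 (x - SparseRecovery.headApprox k x) +
                    ν * SparseRecovery.l1 x} := by
  -- The 96000 is `12000 * 8`, from `totalCost_le` and `halvings_le`; the factor `2 + 1 / a` comes
  -- from `f n + n + 1 ≤ (2 + 1 / a) * f n`.
  refine ⟨130, by norm_num, 1 / 2 ^ 18, by positivity, SparseRecovery.recover, fun a ha =>
    ⟨96000 * (2 + 1 / a), by positivity, ?_⟩⟩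
  intro f hf Q n k r D _ h hn hk hkn hr hh hQ η ν hη hν x
  obtain ⟨S, hS⟩ := SparseRecovery.exists_isHalvings 1 hν
  obtain ⟨θ, hθ⟩ := SparseRecovery.exists_isHalvings (S : ℝ) hη
  obtain ⟨X, hX, hX0, hXd, hXE, hXT⟩ := SparseRecovery.exists_recover hQ hkn x hS hθ
  have hLA := SparseRecovery.halvings_le hη hν hS hθ
  have hA1 := SparseRecovery.one_le_log₁ (SparseRecovery.log₁ (1 / ν) / η)
  have hL1 := SparseRecovery.one_le_log₁ (1 / ν)
  set A := SparseRecovery.log₁ (SparseRecovery.log₁ (1 / ν) / η)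
  set L := SparseRecovery.log₁ (1 / ν)
  have ha' : 0 < 1 / a := by positivity
  refine ⟨fun ω => (X S ω).1, fun ω => ⟨SparseRecovery.isSparse_output (X S ω).2.cnt_le, ?_, ?_⟩,
    ?_⟩
  · rw [hXd]
    push_cast
    have h1 : 0 ≤ A * L := by positivity
    nlinarith [mul_nonneg ha'.le h1]
  · obtain ⟨T, hT, hTle⟩ := hXT ω
    refine ⟨T, hT, ?_⟩
    have h1 := hTle.trans (SparseRecovery.totalCost_le hS.pos hθ.pos
      (SparseRecovery.card_le_two_mul_two_pow (by norm_num) hk hkn hh) hr)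
    have h2 : (T : ℝ) ≤ 12000 * (S * (θ * 2 ^ r * (f n + n + 1))) := by exact_mod_cast h1
    have h3 : a * n ≤ f n := hf n hn
    -- Being a positive natural number, `f n` also absorbs the summand 1.
    have h4 : (1 : ℝ) ≤ f n := by
      have hn' : (1 : ℝ) ≤ n := by exact_mod_cast hn
      have : (0 : ℝ) < f n := lt_of_lt_of_le (by positivity) h3
      exact_mod_cast this
    have h5 : (n : ℝ) ≤ 1 / a * f n := by
      rw [one_div, inv_mul_eq_div, le_div_iff₀ ha]
      linarith
    calc (T : ℝ) ≤ 12000 * (S * (θ * 2 ^ r * (f n + n + 1))) := h2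
      _ = 12000 * ((θ * S) * (2 ^ r * (f n + n + 1))) := by ring
      _ ≤ 12000 * ((8 * (A * L)) * (2 ^ r * ((2 + 1 / a) * f n))) := by
          gcongr
          linarith
      _ = _ := by ring
  · refine (SparseRecovery.seedLaw_success hk hh x hη hθ X hX).trans
      (MeasureTheory.measure_mono fun ω hω => ?_)
    have h1 := SparseRecovery.le_geometric (E := fun i => SparseRecovery.l1
      (x - SparseRecovery.output n (X i ω).1)) (SparseRecovery.l1_nonneg _)
      fun i hi => hXE i ω (hω i hi)
    simp only [hX0, sub_zero] at h1
    have h2 : SparseRecovery.l1 x / 2 ^ S ≤ ν * SparseRecovery.l1 x := by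
      have := mul_le_mul_of_nonneg_left hS.le (SparseRecovery.l1_nonneg x)
      rw [mul_one_div] at this
      linarith
    show SparseRecovery.l1 _ ≤ _
    rw [SparseRecovery.l1_sub_comm]
    linarith
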